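/- Fix the following conventions. A round-shaped planar tree is a finite planar rooted tree each of whose vertices is either neutral, with at least two inputs, or closed, labelled and with any number of inputs. A square-rooted tree is a planar rooted tree whose root is square-shaped, either neutral with at least one input or open, labelled and with any number of inputs, and whose other vertices are as in a round-shaped tree. For a sequence $I=(s_1,\dots,s_m)$ in $\{\mathfrak c,\mathfrak o\}$, let $\mathcal T(I;\mathfrak c)$ be the set of round-shaped planar trees whose closed vertices are labelled bijectively by $\{1,\dots,m\}$ (empty if some $s_i=\mathfrak o$), and let $\mathcal T(I;\mathfrak o)$ be the set of nonempty words of square-rooted trees whose closed (resp. open) vertices are labelled bijectively by $\{i: s_i=\mathfrak c\}$ (resp. $\{i:s_i=\mathfrak o\}$). Let $v$ be a vertex with subtrees $T_1,\dots,T_k$ above it. The blow-ups $d_v$ replace $v$ by two vertices $v^1, v^2$ as follows. * $v$ neutral round: $v^1$ and $v^2$ are neutral round, $v^2$ sits above $v^1$ and carries $T_i,\dots,T_{i+j}$ (at least two and not all of the subtrees), and $v^1$ carries the other subtrees; sign $-$. * $v$ closed: either $v^1$ is neutral round, below $v^2$, which is closed, $v^2$ carries consecutive subtrees $T_{i+1},\dots,T_{j-1}$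 (possibly none, not all), and $v^1$ carries $T_1,\dots,T_i,v^2,T_j,\dots,T_k$; sign $-$. Or $v^1$ is closed and $v^2$ is neutral round above $v^1$, carrying at least two consecutive subtrees; sign $+$. * $v$ open: either $v^1$ is open and $v^2$ is neutral round above $v^1$, carrying at least two consecutive subtrees; sign $+$. Or the tree is cut in the word of $v^1$ open carrying $T_1,\dots,T_i$ and $v^2$ neutral square carrying $T_{i+1},\dots,T_k$ with $0\le i<k$; sign $+$. Or it is cut in the word of $v^1$ neutral square carrying $T_1,\dots,T_i$ and $v^2$ open carrying $T_{i+1},\dots,T_k$ with $0<i\le k$; sign $-$. * $v$ neutral square: either $v^1$ is neutral square and $v^2$ is neutral round above $v^1$, carrying at least two consecutive subtrees; sign $-$. Or the tree is cut in the word of two neutral square-rooted trees carrying $T_1,\dots,T_i$ and $T_{i+1},\dots,T_k$ with $0<i<k$; sign $-$. Neutral vertices have degree $-1$ and labelled vertices degree $0$. An element $W\in\mathcal T(I;x)$ is oriented by the product $v_1\wedge\dots\wedge v_r$ of its vertices, and $d(W\otimes v_1\wedge\dots\wedge v_r)=\sum_i(-1)^{|v_1|+\dots+|v_{i-1}|}d_{v_i}(W)\otimes(v_1\wedge\dots\wedge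 v_i^1\wedge v_i^2\wedge\dots\wedge v_r)$. The complex $\mathrm{rBr}(I;x)$ is the free $\mathbb Z$-module on $\mathcal T(I;x)$ in which $W$ has degree $c-p$, where $p$ is the number of neutral vertices of $W$ and $c=\#\{i:s_i=\mathfrak c\}-\delta_{x,\mathfrak c}$, with the differential $(-1)^{c}d$. Write $T'\le T$ if $T'$ is obtained from $T$ by iterated blow-ups, and let $\langle\mathcal T_{\le T}\rangle$ be the submodule of $\mathrm{rBr}(I;x)$ spanned by $\mathcal T_{\le T}=\{T': T'\le T\}$; it is stable under the differential. Let $G_{n+1}$ be the neutral square-shaped root with $n+1$ closed leaves $1,\dots,n+1$; let $\Gamma_{1,n}$ (resp. $M_{1,n}$) be the open (resp. closed) root labelled $1$ with $n$ closed leaves $2,\dots,n+1$. The Stasheff polytope $K_m$ ($m\ge2$) is a convex polytope of dimension $m-2$ whose poset of nonempty faces is isomorphic to the set of bracketings of a word of $m$ letters (sets of intervals of letters, pairwise nested or disjoint, none a single letter or the whole word), a bracketing being smaller when it has more brackets. The cyclohedron $W_n$ is a convex polytope of dimension $n$ whose poset of nonempty faces is isomorphic to the set, ordered in the same way, of bracketings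 of $n+1$ letters on a circle (sets of arcs from a letter $i$ to a letter $j\ne i$, pairwise nested or disjoint, where the $n+1$ arcs from $i$ to $i-1$ count as different and pairwise not nested). The cellular chain complex $C^{cell}_*(P)$ of a polytope $P$ is freely generated by its nonempty faces, each with a chosen orientation, the boundary of a face being the sum of its facets with the signs given by the orientations. **Proposition.** For every $n\ge0$ there are isomorphisms of chain complexes 1. $\langle\mathcal T_{\le G_{n+1}}\rangle\cong C^{cell}_*(K_{n+2})$, 2. $\langle\mathcal T_{\le \Gamma_{1,n}}\rangle\cong C^{cell}_*(K_{n+2})$, 3. $\langle\mathcal T_{\le M_{1,n}}\rangle\cong C^{cell}_*(W_{n})$, for every realization of the polytopes $K_{n+2}$ and $W_n$ and every choice of orientations of their faces. They carry generators to oriented faces up to sign, through an isomorphism of posets between $\mathcal T_{\le T}$ ($T=G_{n+1},\Gamma_{1,n},M_{1,n}$) and the poset of nonempty faces. -/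

import Mathlib

/-! ### Planar rooted trees and words of planar rooted trees -/

namespace RelBrace

/-- The two colours: closed and open. -/
inductive Colour : Type
  | cl : Colour
  | op : Colour
  deriving DecidableEq

/-- Planar rooted trees with round-shaped vertices. A vertex is either neutral, or closed and
labelled by a natural number; the list is the list of the subtrees above the vertex, from left
to right. -/
inductive RTree : Type
  | neutral : List RTree → RTree
  | closed : ℕ → List RTree → RTree

/-- Planar rooted trees whose root is square-shaped, neutral or open and labelled, and whose other
vertices are round-shaped. -/
inductive STree : Type
  | neutral : List RTree → STree
  | opened : ℕ → List RTree → STree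

mutual
/-- The number of neutral vertices of a tree. -/
def RTree.neutrals : RTree → ℕ
  | .neutral L => forestNeutrals L + 1
  | .closed _ L => forestNeutrals L
/-- The number of neutral vertices of a list of trees. -/
def forestNeutrals : List RTree → ℕ
  | [] => 0
  | t :: L => t.neutrals + forestNeutrals L
end

mutual
/-- The labels of the closed vertices of a tree, with multiplicity. -/
def RTree.labels : RTree → Multiset ℕ
  | .neutral L => forestLabels L
  | .closed a L => a ::ₘ forestLabels L
/-- The labels of the closed vertices of a list of trees, with multiplicity. -/
def forestLabels : List RTree → Multiset ℕ
  | [] => 0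
  | t :: L => t.labels + forestLabels L
end

/-- Every neutral round-shaped vertex has at least two inputs. -/
inductive RTree.Admissible : RTree → Prop
  | neutral (L : List RTree) : 2 ≤ L.length → (∀ t ∈ L, t.Admissible) →
      (RTree.neutral L).Admissible
  | closed (a : ℕ) (L : List RTree) : (∀ t ∈ L, t.Admissible) → (RTree.closed a L).Admissible

/-- The number of neutral vertices of a tree with square-shaped root. -/
def STree.neutrals : STree → ℕ
  | .neutral L => forestNeutrals L + 1
  | .opened _ L => forestNeutrals L

/-- The labels of the closed vertices of a tree with square-shaped root. -/
def STree.labels : STree → Multiset ℕ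
  | .neutral L => forestLabels L
  | .opened _ L => forestLabels L

/-- The labels of the open vertices of a tree with square-shaped root. -/
def STree.openLabels : STree → Multiset ℕ
  | .neutral _ => 0
  | .opened a _ => {a}

/-- Every neutral square-shaped vertex has at least one input and every neutral round-shaped vertex
has at least two. -/
inductive STree.Admissible : STree → Prop
  | neutral (L : List RTree) : 1 ≤ L.length → (∀ t ∈ L, t.Admissible) →
      (STree.neutral L).Admissible
  | opened (a : ℕ) (L : List RTree) : (∀ t ∈ L, t.Admissible) → (STree.opened a L).Admissible

/-- Either a tree with round-shaped vertices or a word of trees with square-shaped roots. -/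
inductive PreTree : Type
  | tree : RTree → PreTree
  | word : List STree → PreTree

/-- The number of neutral vertices. -/
def PreTree.neutrals : PreTree → ℕ
  | .tree t => t.neutrals
  | .word W => (W.map STree.neutrals).sum

/-- The labels of the closed vertices. -/
def PreTree.labels : PreTree → Multiset ℕ
  | .tree t => t.labels
  | .word W => (W.map STree.labels).sum

/-- The labels of the open vertices. -/
def PreTree.openLabels : PreTree → Multiset ℕ
  | .tree _ => 0
  | .word W => (W.map STree.openLabels).sum

/-- Trees have closed output, nonempty words have open output; the vertices have enough inputs. -/
inductive PreTree.Admissible : Colour → PreTree → Prop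
  | tree (t : RTree) : t.Admissible → PreTree.Admissible .cl (.tree t)
  | word (W : List STree) : W ≠ [] → (∀ S ∈ W, S.Admissible) → PreTree.Admissible .op (.word W)

/-- The positions `i ∈ {1, …, n}` with `s_i = c` in the sequence `I = (s_1, …, s_n)`. -/
def positions (c : Colour) (I : List Colour) : Multiset ℕ :=
  (((List.range I.length).filter fun i => I[i]? = some c).map (· + 1) : List ℕ)

/-- Membership in the set `𝒯(I; x)`: the closed vertices are in bijection, through their labels,
with the closed entries of `I`, and the open vertices with the open entries of `I`. -/
structure IsTree (I : List Colour) (x : Colour) (S : PreTree) : Prop where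
  admissible : S.Admissible x
  labels_eq : S.labels = positions .cl I
  openLabels_eq : S.openLabels = positions .op I

/-- The set `𝒯(I; x)` of generators. -/
def Tr (I : List Colour) (x : Colour) : Type := {S : PreTree // IsTree I x S}

/-! ### Blow-ups, with their signs

A tree or word `W` is oriented by `v_1 ∧ ⋯ ∧ v_n`, the product of its vertices in the order in which
a vertex comes before everything above it and what is above a vertex is read from left to right.
Neutral vertices have degree `-1` and the other vertices degree `0`, so only the neutral ones
contribute signs. A blow-up replaces `v` by `v¹ ∧ v²`; the signs below are those of the defining
formulas together with the Koszul sign that brings the vertices of the new tree back in order. -/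

/-- All ways to cut a list in two consecutive pieces. -/
def cuts₂ {α : Type} : List α → List (List α × List α)
  | [] => [([], [])]
  | a :: L => ([], a :: L) :: (cuts₂ L).map fun p => (a :: p.1, p.2)

/-- All ways to cut a list in three consecutive pieces. -/
def cuts₃ {α : Type} (L : List α) : List (List α × List α × List α) :=
  (cuts₂ L).flatMap fun p => (cuts₂ p.2).map fun q => (p.1, q.1, q.2)

/-- The sign `(-1)^k`. -/
def sgn (k : ℕ) : ℤ := (-1) ^ k

/-- Blow-ups of a neutral round-shaped root with subtrees `L`. -/
def neutralRootBlowUps (L : List RTree) : List (ℤ × RTree) :=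
  ((cuts₃ L).filter fun p => 2 ≤ p.2.1.length ∧ p.2.1.length < L.length).map fun p =>
    (-sgn (forestNeutrals p.1), .neutral (p.1 ++ .neutral p.2.1 :: p.2.2))

/-- Blow-ups of a closed root labelled `a` with subtrees `L`: either a new neutral root which takes
at least one of the outer inputs, or a new neutral vertex above, over at least two consecutive
inputs. -/
def closedRootBlowUps (a : ℕ) (L : List RTree) : List (ℤ × RTree) :=
  (((cuts₃ L).filter fun p => 1 ≤ p.1.length + p.2.2.length).map fun p =>
    ((-1 : ℤ), .neutral (p.1 ++ .closed a p.2.1 :: p.2.2))) ++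
  (((cuts₃ L).filter fun p => 2 ≤ p.2.1.length).map fun p =>
    (sgn (forestNeutrals p.1), .closed a (p.1 ++ .neutral p.2.1 :: p.2.2)))

mutual
/-- All blow-ups of a tree at one of its vertices, with their signs. -/
def RTree.blowUps : RTree → List (ℤ × RTree)
  | .neutral L => neutralRootBlowUps L ++
      (forestBlowUps L).map fun p => (-p.1, .neutral p.2)
  | .closed a L => closedRootBlowUps a L ++
      (forestBlowUps L).map fun p => (p.1, .closed a p.2)
/-- All blow-ups of a list of trees at one vertex, with their signs. -/
def forestBlowUps : List RTree → List (ℤ × List RTree)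
  | [] => []
  | t :: L => (t.blowUps.map fun p => (p.1, p.2 :: L)) ++
      (forestBlowUps L).map fun p => (sgn t.neutrals * p.1, t :: p.2)
end

/-- All blow-ups of a tree with square-shaped root, with their signs; the result is a word. -/
def STree.blowUps : STree → List (ℤ × List STree)
  | .neutral L =>
      (((cuts₃ L).filter fun p => 2 ≤ p.2.1.length).map fun p =>
        (-sgn (forestNeutrals p.1), [.neutral (p.1 ++ .neutral p.2.1 :: p.2.2)])) ++
      (((cuts₂ L).filter fun p => 1 ≤ p.1.length ∧ 1 ≤ p.2.length).map fun p =>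
        (-sgn (forestNeutrals p.1), [.neutral p.1, .neutral p.2])) ++
      ((forestBlowUps L).map fun p => (-p.1, [.neutral p.2]))
  | .opened a L =>
      (((cuts₃ L).filter fun p => 2 ≤ p.2.1.length).map fun p =>
        (sgn (forestNeutrals p.1), [.opened a (p.1 ++ .neutral p.2.1 :: p.2.2)])) ++
      (((cuts₂ L).filter fun p => 1 ≤ p.2.length).map fun p =>
        (sgn (forestNeutrals p.1), [.opened a p.1, .neutral p.2])) ++
      (((cuts₂ L).filter fun p => 1 ≤ p.1.length).map fun p =>
        ((-1 : ℤ), [.neutral p.1, .opened a p.2])) ++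
      ((forestBlowUps L).map fun p => (p.1, [.opened a p.2]))

/-- All blow-ups of a word of trees at one of its vertices, with their signs. -/
def wordBlowUps : List STree → List (ℤ × List STree)
  | [] => []
  | S :: W => (S.blowUps.map fun p => (p.1, p.2 ++ W)) ++
      (wordBlowUps W).map fun p => (sgn S.neutrals * p.1, S :: p.2)

/-- All blow-ups of a tree or word at one of its vertices, with their signs. -/
def PreTree.blowUps : PreTree → List (ℤ × PreTree)
  | .tree t => t.blowUps.map fun p => (p.1, .tree p.2)
  | .word W => (wordBlowUps W).map fun p => (p.1, .word p.2)

/-! ### Blow-ups do not leave `𝒯(I; x)` -/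

theorem cuts₂_append {α : Type} {L : List α} {p : List α × List α} (h : p ∈ cuts₂ L) :
    p.1 ++ p.2 = L := by
  induction L generalizing p with
  | nil => simp [cuts₂] at h; simp [h]
  | cons a L ih =>
    simp only [cuts₂, List.mem_cons, List.mem_map] at h
    rcases h with rfl | ⟨q, hq, rfl⟩
    · simp
    · simp [ih hq]

theorem cuts₃_append {α : Type} {L : List α} {p : List α × List α × List α} (h : p ∈ cuts₃ L) :
    p.1 ++ (p.2.1 ++ p.2.2) = L := by
  simp only [cuts₃, List.mem_flatMap, List.mem_map] at h
  obtain ⟨q, hq, r, hr, rfl⟩ := h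
  simp [cuts₂_append hr, cuts₂_append hq]

theorem forestLabels_append (L M : List RTree) :
    forestLabels (L ++ M) = forestLabels L + forestLabels M := by
  induction L with
  | nil => simp [forestLabels]
  | cons t L ih => simp [forestLabels, ih, add_assoc]

/-- What a round-shaped blow-up preserves. -/
theorem RTree.blowUps_spec (t : RTree) :
    ∀ p ∈ t.blowUps, p.2.labels = t.labels ∧ (t.Admissible → p.2.Admissible) := by
  refine RTree.rec (motive_1 := fun t => ∀ p ∈ t.blowUps,
      p.2.labels = t.labels ∧ (t.Admissible → p.2.Admissible))
    (motive_2 := fun L => ∀ p ∈ forestBlowUps L, forestLabels p.2 = forestLabels L ∧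
      p.2.length = L.length ∧
      ((∀ t ∈ L, t.Admissible) → ∀ t ∈ p.2, t.Admissible)) ?_ ?_ ?_ ?_ t
  · intro L ih p hp
    simp only [RTree.blowUps, neutralRootBlowUps, List.mem_append, List.mem_map,
      List.mem_filter] at hp
    rcases hp with ⟨q, ⟨hq, hl⟩, rfl⟩ | ⟨q, hq, rfl⟩
    · have hL := cuts₃_append hq
      obtain ⟨A, B, C⟩ := q
      simp only at hL hl ⊢
      subst hL
      simp only [decide_eq_true_eq, List.length_append] at hl
      refine ⟨by simp [RTree.labels, forestLabels_append, forestLabels], ?_⟩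
      rintro (⟨_, _, h⟩ | _)
      refine .neutral _ (by simp; omega) ?_
      intro t ht
      simp only [List.mem_append, List.mem_cons] at ht h
      rcases ht with ht | rfl | ht
      · exact h t (by tauto)
      · exact .neutral _ hl.1 fun t ht => h t (by tauto)
      · exact h t (by tauto)
    · obtain ⟨h1, h2, h3⟩ := ih q hq
      refine ⟨by simp [RTree.labels, h1], ?_⟩
      rintro (⟨_, hl, h⟩ | _)
      exact .neutral _ (by simp only [h2]; exact hl) (h3 h)
  · intro a L ih p hp
    simp only [RTree.blowUps, closedRootBlowUps, List.mem_append, List.mem_map,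
      List.mem_filter] at hp
    rcases hp with (⟨q, ⟨hq, hl⟩, rfl⟩ | ⟨q, ⟨hq, hl⟩, rfl⟩) | ⟨q, hq, rfl⟩
    · have hL := cuts₃_append hq
      obtain ⟨A, B, C⟩ := q
      simp only at hL hl ⊢
      subst hL
      simp only [decide_eq_true_eq] at hl
      refine ⟨?_, ?_⟩
      · simp only [RTree.labels, forestLabels_append, forestLabels, ← Multiset.singleton_add]
        abel
      · rintro (_ | ⟨_, _, h⟩)
        refine .neutral _ (by simp; omega) ?_
        intro t ht
        simp only [List.mem_append, List.mem_cons] at ht h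
        rcases ht with ht | rfl | ht
        · exact h t (by tauto)
        · exact .closed _ _ fun t ht => h t (by tauto)
        · exact h t (by tauto)
    · have hL := cuts₃_append hq
      obtain ⟨A, B, C⟩ := q
      simp only at hL hl ⊢
      subst hL
      simp only [decide_eq_true_eq] at hl
      refine ⟨by simp [RTree.labels, forestLabels_append, forestLabels], ?_⟩
      rintro (_ | ⟨_, _, h⟩)
      refine .closed _ _ ?_
      intro t ht
      simp only [List.mem_append, List.mem_cons] at ht h
      rcases ht with ht | rfl | ht
      · exact h t (by tauto)
      · exact .neutral _ hl fun t ht => h t (by tauto)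
      · exact h t (by tauto)
    · obtain ⟨h1, h2, h3⟩ := ih q hq
      refine ⟨by simp [RTree.labels, h1], ?_⟩
      rintro (_ | ⟨_, _, h⟩)
      exact .closed _ _ (h3 h)
  · intro p hp
    simp [forestBlowUps] at hp
  · intro t L iht ihL p hp
    simp only [forestBlowUps, List.mem_append, List.mem_map] at hp
    rcases hp with ⟨q, hq, rfl⟩ | ⟨q, hq, rfl⟩
    · obtain ⟨h1, h2⟩ := iht q hq
      refine ⟨by simp [forestLabels, h1], by simp, ?_⟩
      intro h s hs
      simp only [List.mem_cons] at hs h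
      rcases hs with rfl | hs
      · exact h2 (h t (Or.inl rfl))
      · exact h s (Or.inr hs)
    · obtain ⟨h1, h2, h3⟩ := ihL q hq
      refine ⟨by simp [forestLabels, h1], by simp [h2], ?_⟩
      intro h s hs
      simp only [List.mem_cons] at hs h
      rcases hs with rfl | hs
      · exact h s (Or.inl rfl)
      · exact h3 (fun s hs => h s (Or.inr hs)) s hs

theorem forestBlowUps_spec (L : List RTree) : ∀ p ∈ forestBlowUps L,
    forestLabels p.2 = forestLabels L ∧ p.2.length = L.length ∧
      ((∀ t ∈ L, t.Admissible) → ∀ t ∈ p.2, t.Admissible) := by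
  induction L with
  | nil => intro p hp; simp [forestBlowUps] at hp
  | cons t L ihL =>
    intro p hp
    simp only [forestBlowUps, List.mem_append, List.mem_map] at hp
    rcases hp with ⟨q, hq, rfl⟩ | ⟨q, hq, rfl⟩
    · obtain ⟨h1, h2⟩ := t.blowUps_spec q hq
      refine ⟨by simp [forestLabels, h1], by simp, ?_⟩
      intro h s hs
      simp only [List.mem_cons] at hs h
      rcases hs with rfl | hs
      · exact h2 (h t (Or.inl rfl))
      · exact h s (Or.inr hs)
    · obtain ⟨h1, h2, h3⟩ := ihL q hq
      refine ⟨by simp [forestLabels, h1], by simp [h2], ?_⟩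
      intro h s hs
      simp only [List.mem_cons] at hs h
      rcases hs with rfl | hs
      · exact h s (Or.inl rfl)
      · exact h3 (fun s hs => h s (Or.inr hs)) s hs

/-- What a blow-up of a tree with square-shaped root preserves. -/
theorem STree.blowUps_spec (S : STree) : ∀ p ∈ S.blowUps,
    (p.2.map STree.labels).sum = S.labels ∧ (p.2.map STree.openLabels).sum = S.openLabels ∧
      (S.Admissible → ∀ S' ∈ p.2, S'.Admissible) := by
  have grp : ∀ A B C : List RTree, 2 ≤ B.length → (∀ t ∈ A ++ (B ++ C), t.Admissible) →
      ∀ t ∈ A ++ RTree.neutral B :: C, t.Admissible := by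
    intro A B C hl h t ht
    simp only [List.mem_append, List.mem_cons] at ht h
    rcases ht with ht | rfl | ht
    · exact h t (by tauto)
    · exact .neutral _ hl fun t ht => h t (by tauto)
    · exact h t (by tauto)
  cases S with
  | neutral L =>
    intro p hp
    simp only [STree.blowUps, List.mem_append, List.mem_map, List.mem_filter] at hp
    rcases hp with (⟨q, ⟨hq, hl⟩, rfl⟩ | ⟨q, ⟨hq, hl⟩, rfl⟩) | ⟨q, hq, rfl⟩
    · have hL := cuts₃_append hq
      simp only [decide_eq_true_eq] at hl
      subst hL
      refine ⟨by simp [STree.labels, RTree.labels, forestLabels_append, forestLabels],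
        by simp [STree.openLabels], ?_⟩
      rintro (⟨_, _, h⟩ | _)
      simp only [List.mem_singleton, forall_eq]
      exact .neutral _ (by simp; omega) (grp _ _ _ hl h)
    · have hL := cuts₂_append hq
      simp only [decide_eq_true_eq] at hl
      subst hL
      refine ⟨by simp [STree.labels, forestLabels_append], by simp [STree.openLabels], ?_⟩
      rintro (⟨_, _, h⟩ | _)
      simp only [List.mem_append] at h
      intro S' hS'
      simp only [List.mem_cons, List.not_mem_nil, or_false] at hS'
      rcases hS' with rfl | rfl
      · exact .neutral _ hl.1 fun t ht => h t (by tauto)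
      · exact .neutral _ hl.2 fun t ht => h t (by tauto)
    · obtain ⟨h1, h2, h3⟩ := forestBlowUps_spec L q hq
      refine ⟨by simp [STree.labels, h1], by simp [STree.openLabels], ?_⟩
      rintro (⟨_, hl, h⟩ | _)
      simp only [List.mem_singleton, forall_eq]
      exact .neutral _ (by simp only [h2]; exact hl) (h3 h)
  | opened a L =>
    intro p hp
    simp only [STree.blowUps, List.mem_append, List.mem_map, List.mem_filter] at hp
    rcases hp with ((⟨q, ⟨hq, hl⟩, rfl⟩ | ⟨q, ⟨hq, hl⟩, rfl⟩) | ⟨q, ⟨hq, hl⟩, rfl⟩) | ⟨q, hq, rfl⟩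
    · have hL := cuts₃_append hq
      simp only [decide_eq_true_eq] at hl
      subst hL
      refine ⟨by simp [STree.labels, RTree.labels, forestLabels_append, forestLabels],
        by simp [STree.openLabels], ?_⟩
      rintro (_ | ⟨_, _, h⟩)
      simp only [List.mem_singleton, forall_eq]
      exact .opened _ _ (grp _ _ _ hl h)
    · have hL := cuts₂_append hq
      simp only [decide_eq_true_eq] at hl
      subst hL
      refine ⟨by simp [STree.labels, forestLabels_append], by simp [STree.openLabels], ?_⟩
      rintro (_ | ⟨_, _, h⟩)
      simp only [List.mem_append] at h
      intro S' hS'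
      simp only [List.mem_cons, List.not_mem_nil, or_false] at hS'
      rcases hS' with rfl | rfl
      · exact .opened _ _ fun t ht => h t (by tauto)
      · exact .neutral _ hl fun t ht => h t (by tauto)
    · have hL := cuts₂_append hq
      simp only [decide_eq_true_eq] at hl
      subst hL
      refine ⟨by simp [STree.labels, forestLabels_append], by simp [STree.openLabels], ?_⟩
      rintro (_ | ⟨_, _, h⟩)
      simp only [List.mem_append] at h
      intro S' hS'
      simp only [List.mem_cons, List.not_mem_nil, or_false] at hS'
      rcases hS' with rfl | rfl
      · exact .neutral _ hl fun t ht => h t (by tauto)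
      · exact .opened _ _ fun t ht => h t (by tauto)
    · obtain ⟨h1, h2, h3⟩ := forestBlowUps_spec L q hq
      refine ⟨by simp [STree.labels, h1], by simp [STree.openLabels], ?_⟩
      rintro (_ | ⟨_, _, h⟩)
      simp only [List.mem_singleton, forall_eq]
      exact .opened _ _ (h3 h)

theorem STree.blowUps_ne_nil (S : STree) : ∀ p ∈ S.blowUps, p.2 ≠ [] := by
  intro p hp
  cases S <;> simp only [STree.blowUps, List.mem_append, List.mem_map] at hp
  · rcases hp with (⟨q, _, rfl⟩ | ⟨q, _, rfl⟩) | ⟨q, _, rfl⟩ <;> simp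
  · rcases hp with ((⟨q, _, rfl⟩ | ⟨q, _, rfl⟩) | ⟨q, _, rfl⟩) | ⟨q, _, rfl⟩ <;> simp

theorem wordBlowUps_spec (W : List STree) : ∀ p ∈ wordBlowUps W,
    (p.2.map STree.labels).sum = (W.map STree.labels).sum ∧
      (p.2.map STree.openLabels).sum = (W.map STree.openLabels).sum ∧ p.2 ≠ [] ∧
      ((∀ S ∈ W, S.Admissible) → ∀ S ∈ p.2, S.Admissible) := by
  induction W with
  | nil => intro p hp; simp [wordBlowUps] at hp
  | cons S W ih =>
    intro p hp
    simp only [wordBlowUps, List.mem_append, List.mem_map] at hp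
    rcases hp with ⟨q, hq, rfl⟩ | ⟨q, hq, rfl⟩
    · obtain ⟨h1, h2, h3⟩ := S.blowUps_spec q hq
      refine ⟨by simp [h1], by simp [h2], by simp [S.blowUps_ne_nil q hq], ?_⟩
      intro h S' hS'
      simp only [List.mem_append] at hS'
      rcases hS' with hS' | hS'
      · exact h3 (h S (by simp)) S' hS'
      · exact h S' (by simp [hS'])
    · obtain ⟨h1, h2, -, h3⟩ := ih q hq
      refine ⟨by simp [h1], by simp [h2], by simp, ?_⟩
      intro h S' hS'
      simp only [List.mem_cons] at hS'
      rcases hS' with rfl | hS'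
      · exact h _ (by simp)
      · exact h3 (fun R hR => h R (by simp [hR])) S' hS'

/-- A blow-up of an element of `𝒯(I; x)` is an element of `𝒯(I; x)`. -/
theorem IsTree.blowUp {I : List Colour} {x : Colour} {S : PreTree} (hS : IsTree I x S)
    {p : ℤ × PreTree} (hp : p ∈ S.blowUps) : IsTree I x p.2 := by
  obtain ⟨ha, hl, ho⟩ := hS
  cases ha with
  | tree t ht =>
    simp only [PreTree.blowUps, List.mem_map] at hp
    obtain ⟨q, hq, rfl⟩ := hp
    obtain ⟨h1, h2⟩ := t.blowUps_spec q hq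
    exact ⟨.tree _ (h2 ht), by simpa [PreTree.labels, h1] using hl,
      by simpa [PreTree.openLabels] using ho⟩
  | word W hW h =>
    simp only [PreTree.blowUps, List.mem_map] at hp
    obtain ⟨q, hq, rfl⟩ := hp
    obtain ⟨h1, h2, h3, h4⟩ := wordBlowUps_spec W q hq
    exact ⟨.word _ h3 (h4 h), by simpa [PreTree.labels, h1] using hl,
      by simpa [PreTree.openLabels, h2] using ho⟩

/-! ### The poset `𝒯(I; x)` and the complex `rBr(I; x)` -/

/-- `IsBlowUp S S'`: the element `S'` is one of the blow-ups of `S`. -/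
def IsBlowUp {I : List Colour} {x : Colour} (S S' : Tr I x) : Prop :=
  ∃ s : ℤ, (s, S'.1) ∈ S.1.blowUps

/-- `S' ≤ S` when `S'` is obtained from `S` by iterated blow-ups. -/
instance {I : List Colour} {x : Colour} : Preorder (Tr I x) where
  le S' S := Relation.ReflTransGen IsBlowUp S S'
  le_refl _ := .refl
  le_trans _ _ _ h h' := h'.trans h

/-- The number of closed entries of `I`, minus one if the output `x` is closed: the operadic
(de)suspension with respect to the closed colour shifts degrees by this number. -/
def shift (I : List Colour) (x : Colour) : ℤ :=
  (I.count .cl : ℤ) - (if x = .cl then 1 else 0)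

/-- The degree in `rBr(I; x)`: neutral vertices count for `-1`, and degrees are shifted. -/
def Tr.degree {I : List Colour} {x : Colour} (S : Tr I x) : ℤ :=
  shift I x - (S.1.neutrals : ℤ)

/-- The underlying module of `rBr(I; x)`. -/
abbrev RBr (I : List Colour) (x : Colour) : Type := Tr I x →₀ ℤ

/-- The generator of `rBr(I; x)` given by an element of `𝒯(I; x)`. -/
noncomputable def gen {I : List Colour} {x : Colour} (S : Tr I x) : RBr I x := Finsupp.single S 1

/-- The differential of the suspended complex on a generator: the signed sum of all blow-ups. -/
noncomputable def blowUpSum {I : List Colour} {x : Colour} (S : Tr I x) : RBr I x :=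
  (S.1.blowUps.attach.map fun p =>
    p.1.1 • gen (⟨p.1.2, S.2.blowUp p.2⟩ : Tr I x)).sum

/-- The differential of `rBr(I; x)`. Undoing the suspension, which shifts degrees by
`shift I x`, multiplies the differential by `(-1)^(shift I x)`. -/
noncomputable def differential (I : List Colour) (x : Colour) : RBr I x →ₗ[ℤ] RBr I x :=
  Finsupp.linearCombination ℤ fun S : Tr I x => ((shift I x).negOnePow : ℤ) • blowUpSum S

/-- The submodule of `rBr(I; x)` generated by the elements of `𝒯(I; x)` below `T`. -/
noncomputable def below {I : List Colour} {x : Colour} (T : Tr I x) : Submodule ℤ (RBr I x) :=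
  Submodule.span ℤ (gen '' Set.Iic T)

theorem differential_mem_below {I : List Colour} {x : Colour} (T : Tr I x) :
    ∀ c ∈ below T, differential I x c ∈ below T := by
  intro c hc
  induction hc using Submodule.span_induction with
  | mem c hc =>
    obtain ⟨S, hS, rfl⟩ := hc
    simp only [differential, gen, Finsupp.linearCombination_single, one_smul]
    refine Submodule.smul_mem _ _ (list_sum_mem ?_)
    intro y hy
    simp only [List.mem_map] at hy
    obtain ⟨p, -, rfl⟩ := hy
    refine Submodule.smul_mem _ _ (Submodule.subset_span ⟨_, ?_, rfl⟩)
    exact Relation.ReflTransGen.tail (show Relation.ReflTransGen IsBlowUp T S from hS)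
      ⟨p.1.1, p.2⟩
  | zero => simp
  | add a b _ _ ha hb => simpa using Submodule.add_mem _ ha hb
  | smul r a _ ha => simpa using Submodule.smul_mem _ r ha

/-- The differential of the subcomplex of `rBr(I; x)` generated by the elements below `T`. -/
noncomputable def belowDifferential {I : List Colour} {x : Colour} (T : Tr I x) :
    below T →ₗ[ℤ] below T :=
  (differential I x).restrict (differential_mem_below T)

/-- The generator of the subcomplex given by an element below `T`. -/
noncomputable def belowGen {I : List Colour} {x : Colour} (T : Tr I x) (S : Set.Iic T) : below T :=
  ⟨gen S.1, Submodule.subset_span ⟨S.1, S.2, rfl⟩⟩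

/-! ### The generators `G_{n+1}`, `Γ_{1,n}` and `M_{1,n}` -/

/-- The list of `k` closed leaves labelled `a + 1, …, a + k`. -/
def leaves (a k : ℕ) : List RTree := (List.range k).map fun i => .closed (i + a + 1) []

theorem forestLabels_leaves (a k : ℕ) :
    forestLabels (leaves a k) = (((List.range k).map fun i => i + a + 1 : List ℕ) : Multiset ℕ) := by
  unfold leaves
  generalize List.range k = R
  induction R with
  | nil => rfl
  | cons i R ih =>
    simp only [List.map_cons, forestLabels, ih, RTree.labels, ← Multiset.cons_coe]
    simp

theorem leaves_admissible (a k : ℕ) : ∀ t ∈ leaves a k, t.Admissible := by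
  intro t ht
  simp only [leaves, List.mem_map] at ht
  obtain ⟨i, -, rfl⟩ := ht
  exact .closed _ _ (by simp)

theorem positions_replicate (c d : Colour) (n : ℕ) : positions c (List.replicate n d) =
    if c = d then (((List.range n).map (· + 1) : List ℕ) : Multiset ℕ) else 0 := by
  unfold positions
  split_ifs with h
  · subst h
    congr 2
    simp only [List.length_replicate, List.filter_eq_self, List.mem_range]
    intro i hi
    simp [hi]
  · have : (List.range (List.replicate n d).length).filter
        (fun i => (List.replicate n d)[i]? = some c) = [] := by
      rw [List.filter_eq_nil_iff]
      intro i hi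
      simp only [List.length_replicate, List.mem_range] at hi
      simp [hi, Ne.symm h]
    rw [this]
    rfl

theorem positions_cons (c d : Colour) (I : List Colour) : positions c (d :: I) =
    (if c = d then {1} else 0) + (positions c I).map (· + 1) := by
  unfold positions
  simp only [List.length_cons, List.range_succ_eq_map, List.filter_cons, List.filter_map,
    List.getElem?_cons_zero]
  split_ifs with h1 h2 h2
  · simp [Function.comp_def]
  · simp_all
  · simp_all
  · simp [Function.comp_def]

/-- `G_{n+1}`: a neutral square-shaped root with `n + 1` closed leaves `1, …, n + 1`. -/
def G (n : ℕ) : Tr (List.replicate (n + 1) .cl) .op :=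
  ⟨.word [.neutral (leaves 0 (n + 1))],
    .word _ (by simp) (by simpa using .neutral _ (by simp [leaves]) (leaves_admissible _ _)),
    by simp [PreTree.labels, STree.labels, forestLabels_leaves, positions_replicate],
    by simp [PreTree.openLabels, STree.openLabels, positions_replicate]⟩

/-- `Γ_{1,n}`: an open root labelled `1` with `n` closed leaves `2, …, n + 1`. -/
def Gam (n : ℕ) : Tr (.op :: List.replicate n .cl) .op :=
  ⟨.word [.opened 1 (leaves 1 n)],
    .word _ (by simp) (by simpa using .opened _ _ (leaves_admissible _ _)),
    by simp [PreTree.labels, STree.labels, forestLabels_leaves, positions_cons,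
      positions_replicate],
    by simp [PreTree.openLabels, STree.openLabels, positions_cons, positions_replicate]⟩

/-- `M_{1,n}`: a closed root labelled `1` with `n` closed leaves `2, …, n + 1`. -/
def M (n : ℕ) : Tr (List.replicate (n + 1) .cl) .cl :=
  ⟨.tree (.closed 1 (leaves 1 n)),
    .tree _ (.closed _ _ (leaves_admissible _ _)),
    by simp [PreTree.labels, RTree.labels, forestLabels_leaves, List.replicate_succ,
      positions_cons, positions_replicate],
    by simp [PreTree.openLabels, positions_replicate]⟩

/-! ### Convex polytopes and their cellular chain complexes -/

section Polytope

variable {E : Type*} [NormedAddCommGroup E] [NormedSpace ℝ E]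

/-- A nonempty convex polytope: the convex hull of a nonempty finite set. -/
def IsPolytope (P : Set E) : Prop := ∃ s : Finset E, s.Nonempty ∧ P = convexHull ℝ (s : Set E)

/-- The nonempty faces of `P` (including `P` itself), ordered by inclusion. -/
def Face (P : Set E) : Type _ := {F : Set E // F.Nonempty ∧ IsExposed ℝ P F}

instance (P : Set E) : PartialOrder (Face P) := inferInstanceAs (PartialOrder (Subtype _))

/-- The space of directions of a face. -/
abbrev Face.direction {P : Set E} (F : Face P) : Submodule ℝ E := vectorSpan ℝ F.1

/-- The dimension of a face. -/
noncomputable def Face.dim {P : Set E} (F : Face P) : ℕ := Module.finrank ℝ F.direction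

/-- A choice of an orientation of every face, each given by an ordered basis of the space of
directions of the face (so that a vertex has its positive orientation). -/
abbrev Orientations (P : Set E) : Type _ :=
  ∀ F : Face P, Module.Basis (Fin F.dim) ℝ F.direction

/-- For a facet `G` of `F`, the determinant, in the chosen basis of `F`, of the vector `q - p`
followed by the chosen basis of `G`, where `p` is a point of `F` and `q` a point of `G`. If `p` is
not on `G` then `q - p` leaves `F` through `G`. -/
noncomputable def outwardDet {P : Set E} (o : Orientations P) {F G : Face P} (hGF : G ≤ F)
    (hdim : F.dim = G.dim + 1) (p : F.1) (q : G.1) : ℝ :=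
  (o F).det fun i : Fin F.dim =>
    Fin.cons (α := fun _ => F.direction)
      ⟨(q : E) -ᵥ (p : E), vsub_mem_vectorSpan ℝ (hGF q.2) p.2⟩
      (fun j => ⟨(o G j : E), vectorSpan_mono ℝ hGF (o G j).2⟩) (Fin.cast hdim i)

open Classical in
/-- The incidence number of the oriented faces `F` and `G`: zero unless `G` is a facet of `F`, and
then `1` or `-1` according to whether the orientation of `G` is the one induced by that of `F`
(outward vector first) or not. -/
noncomputable def incidence {P : Set E} (o : Orientations P) (F G : Face P) : ℤ :=
  if h : G ≤ F ∧ F.dim = G.dim + 1 then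
    if ∃ (p : F.1) (q : G.1), 0 < outwardDet o h.1 h.2 p q then 1 else -1
  else 0

/-- The boundary operator of the cellular chain complex of `P`, whose chains are the integral
combinations of oriented faces. (A polytope has finitely many faces.) -/
noncomputable def cellularBoundary {P : Set E} (o : Orientations P) :
    (Face P →₀ ℤ) →ₗ[ℤ] (Face P →₀ ℤ) :=
  Finsupp.linearCombination ℤ fun F : Face P =>
    ∑ᶠ G : Face P, incidence o F G • Finsupp.single G (1 : ℤ)

end Polytope

/-! ### Bracketings, associahedra and cyclohedra -/

/-- A bracketing of a word of `m` letters: a set of brackets, where a bracket is an interval of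
letters which is neither a single letter nor the whole word, such that any two brackets are nested
or disjoint. -/
def PathBracketing (m : ℕ) : Type :=
  {A : Finset (Finset (Fin m)) //
    (∀ B ∈ A, (∃ i j : Fin m, i < j ∧ B = Finset.Icc i j) ∧ B ≠ Finset.univ) ∧
    ∀ B ∈ A, ∀ C ∈ A, B ⊆ C ∨ C ⊆ B ∨ Disjoint B C}

/-- A bracketing gets smaller when brackets are added. -/
instance (m : ℕ) : PartialOrder (PathBracketing m) where
  le A B := B.1 ⊆ A.1
  le_refl _ := subset_rfl
  le_trans _ _ _ h h' := h'.trans h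
  le_antisymm _ _ h h' := Subtype.ext (subset_antisymm h' h)

/-- The letters `i, i + 1, …, j` of the arc from `i` to `j`, for `n + 1` letters `0, …, n` in cyclic
order (the subtraction is that of `ℤ/(n+1)`). -/
def arc {n : ℕ} (b : Fin (n + 1) × Fin (n + 1)) : Finset (Fin (n + 1)) :=
  Finset.univ.filter fun a => a - b.1 ≤ b.2 - b.1

/-- The arc `b` is part of the arc `c`: starting from the first letter of `c`, one meets the first
letter of `b`, then the last letter of `b`, then the last letter of `c`. -/
def IsSubarc {n : ℕ} (b c : Fin (n + 1) × Fin (n + 1)) : Prop :=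
  b.1 - c.1 ≤ b.2 - c.1 ∧ b.2 - c.1 ≤ c.2 - c.1

/-- A bracketing of `n + 1` letters on a circle: a set of brackets, where a bracket is an arc
from a letter `i` to a letter `j ≠ i`, such that any two brackets are nested or disjoint. The
`n + 1` arcs from `i` to `i - 1` have the same letters but are different brackets. -/
def CyclicBracketing (n : ℕ) : Type :=
  {A : Finset (Fin (n + 1) × Fin (n + 1)) //
    (∀ b ∈ A, b.1 ≠ b.2) ∧
    ∀ b ∈ A, ∀ c ∈ A, IsSubarc b c ∨ IsSubarc c b ∨ Disjoint (arc b) (arc c)}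

/-- A bracketing gets smaller when brackets are added. -/
instance (n : ℕ) : PartialOrder (CyclicBracketing n) where
  le A B := B.1 ⊆ A.1
  le_refl _ := subset_rfl
  le_trans _ _ _ h h' := h'.trans h
  le_antisymm _ _ h h' := Subtype.ext (subset_antisymm h' h)

/-- `K` is a Stasheff polytope (associahedron) `K_m`: a convex polytope of dimension `m - 2` whose
poset of nonempty faces is isomorphic to the poset of bracketings of a word of `m` letters. -/
structure IsStasheffPolytope {E : Type*} [NormedAddCommGroup E] [NormedSpace ℝ E]
    (m : ℕ) (K : Set E) : Prop where
  polytope : IsPolytope K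
  finrank_eq : Module.finrank ℝ (vectorSpan ℝ K) + 2 = m
  faces : Nonempty (Face K ≃o PathBracketing m)

/-- `W` is a cyclohedron `W_n`: a convex polytope of dimension `n` whose poset of nonempty faces is
isomorphic to the poset of bracketings of `n + 1` letters on a circle. -/
structure IsCyclohedron {E : Type*} [NormedAddCommGroup E] [NormedSpace ℝ E]
    (n : ℕ) (W : Set E) : Prop where
  polytope : IsPolytope W
  finrank_eq : Module.finrank ℝ (vectorSpan ℝ W) = n
  faces : Nonempty (Face W ≃o CyclicBracketing n)

/-- The submodule of `rBr(I; x)` generated by the elements of `𝒯(I; x)` below `T` is a chain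
complex which, for every choice of orientations of the faces of `P`, is isomorphic to the cellular
chain complex of `P`; the isomorphism carries the generators to the oriented cells, up to sign,
through an isomorphism of the poset of elements below `T` with the poset of faces of `P`, and
preserves degrees. -/
def GivesCellularChains {I : List Colour} {x : Colour} (T : Tr I x)
    {E : Type*} [NormedAddCommGroup E] [NormedSpace ℝ E] (P : Set E) : Prop :=
  belowDifferential T ∘ₗ belowDifferential T = 0 ∧
  ∀ o : Orientations P,
    ∃ (e : Set.Iic T ≃o Face P) (Φ : below T ≃ₗ[ℤ] (Face P →₀ ℤ)),
      (∀ c : below T, Φ (belowDifferential T c) = cellularBoundary o (Φ c)) ∧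
      ∀ S : Set.Iic T, S.1.degree = (e S).dim ∧
        ∃ u : ℤˣ, Φ (belowGen T S) = Finsupp.single (e S) (u : ℤ)

end RelBrace

-- The elements below each of the three trees form the face poset of a flag complex. An element is
-- recorded by the set of brackets given by its neutral vertices; a blow-up adds one bracket, and
-- every bracket compatible with those present can be added. For `G` the letters are the leaves and
-- one additional last letter, and the first root, whose interval is the whole word, is not counted.
-- For `Gam` there is one additional letter on either side of the leaves. For `M` the letters on the
-- circle are the leaves and the root: a neutral vertex below the marked closed vertex gives the arc
-- formed by the root and the leaves outside the branch towards the marked vertex, any other neutral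
-- vertex gives the interval of its leaves. This is the content of `treeModel_G`, `treeModel_Gam`
-- and `treeModel_M`; the flag complexes are identified with bracketings in
-- `exists_pathBracketing_equiv` and `exists_cyclicBracketing_equiv`, hence with the faces of the
-- polytopes.
--
-- Signs on the side of trees: list the brackets in the order of the vertices. Moving the new
-- bracket to the front of the list costs exactly the sign of the blow-up, up to a factor `κ b`
-- which depends on the bracket alone. After every generator is rescaled by the sign that sorts its
-- brackets, the differential is left exterior multiplication by the sum of the `κ b • b`, so the
-- two ways to add two brackets have opposite signs (`TreeModel.blowUpSum_mul`) and the differential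
-- squares to zero. The coefficients can be read off because different blow-ups give different trees
-- (`Tr.blowUps_nodup`).
--
-- Signs on the side of polytopes: the two ways from a face down to a face of codimension two also
-- have opposite signs (`incidence_diamond`), since both products are signs of one determinant with
-- its first two vectors exchanged.
--
-- Hence the product of the two systems of signs is the same along both sides of every diamond. Two
-- elements with a common blow-up are themselves blow-ups of a common element, so such a system is a
-- coboundary (`exists_gauge`), and the signs `u` so obtained rescale the generators to a chain
-- isomorphism.
--
-- Since the faces are given only up to isomorphism of posets, dimensions have to be compared with
-- degrees (`TreeModel.dim_eq_degree`). The dimension falls at every blow-up and agrees with the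
-- degree at the top, while the degree falls by one at every blow-up and is zero when no blow-up is
-- left; this leaves no room for a discrepancy.

namespace RelBrace

/-! ### Determinants of a vector followed by a basis of a hyperplane -/

section Hyperplane

variable {U V : Type*} [AddCommGroup U] [Module ℝ U] [AddCommGroup V] [Module ℝ V] {k : ℕ}

/-- The determinant of a vector followed by the images of the vectors of a basis. -/
noncomputable def hyperplaneDet (b : Module.Basis (Fin (k + 1)) ℝ V)
    (c : Module.Basis (Fin k) ℝ U) (j : U →ₗ[ℝ] V) (x : V) : ℝ :=
  b.det (Fin.cons (α := fun _ => V) x fun i => j (c i))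

/-- With `x` fixed, the left side is an alternating form of top degree in the vectors of `U`, hence
a multiple of `c.det`; evaluation at `c` gives the factor. -/
theorem det_cons_map (b : Module.Basis (Fin (k + 1)) ℝ V) (c : Module.Basis (Fin k) ℝ U)
    (j : U →ₗ[ℝ] V) (x : V) (w : Fin k → U) :
    b.det (Fin.cons (α := fun _ => V) x fun i => j (w i)) = c.det w * hyperplaneDet b c j x := by
  have h := AlternatingMap.eq_smul_basis_det c ((b.det.curryLeft x).compLinearMap j)
  have h' := congrArg (fun f => f w) h
  simp only [AlternatingMap.compLinearMap_apply, AlternatingMap.curryLeft_apply_apply,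
    AlternatingMap.smul_apply, smul_eq_mul] at h'
  rw [mul_comm]
  exact h'

/-- The functional `l` vanishes on the image of `j` but not at `x`, so `x` is independent of that
image. -/
theorem hyperplaneDet_ne_zero (b : Module.Basis (Fin (k + 1)) ℝ V) (c : Module.Basis (Fin k) ℝ U)
    (j : U →ₗ[ℝ] V) (hj : Function.Injective j) (l : V →ₗ[ℝ] ℝ) (hl : ∀ u, l (j u) = 0)
    {x : V} (hx : l x ≠ 0) : hyperplaneDet b c j x ≠ 0 := by
  have hli : LinearIndependent ℝ (Fin.cons (α := fun _ => V) x fun i => j (c i)) := by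
    rw [linearIndependent_finCons]
    refine ⟨c.linearIndependent.map' j (LinearMap.ker_eq_bot.2 hj), fun hmem => hx ?_⟩
    have : Submodule.span ℝ (Set.range fun i => j (c i)) ≤ LinearMap.ker l := by
      rw [Submodule.span_le]
      rintro _ ⟨i, rfl⟩
      exact hl _
    exact this hmem
  have : Module.Finite ℝ V := Module.Finite.of_basis b
  have hs := hli.span_eq_top_of_card_eq_finrank' (Module.finrank_eq_card_basis b).symm
  exact ((Module.Basis.is_basis_iff_det b).1 ⟨hli, hs⟩).ne_zero

/-- As a function of `x` the determinant is linear and vanishes on the image of `j`, which is the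
kernel of `l`; so it is proportional to `l`. -/
theorem hyperplaneDet_eq (b : Module.Basis (Fin (k + 1)) ℝ V) (c : Module.Basis (Fin k) ℝ U)
    (j : U →ₗ[ℝ] V) (hj : Function.Injective j) (l : V →ₗ[ℝ] ℝ) (hl : ∀ u, l (j u) = 0)
    {x₀ : V} (hx : l x₀ ≠ 0) (x : V) :
    hyperplaneDet b c j x = l x / l x₀ * hyperplaneDet b c j x₀ := by
  have : Module.Finite ℝ V := Module.Finite.of_basis b
  let D : V →ₗ[ℝ] ℝ :=
    { toFun := hyperplaneDet b c j
      map_add' := fun u v => by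
        have := congrArg (fun f => f fun i => j (c i)) (b.det.curryLeft.map_add u v)
        exact this
      map_smul' := fun r v => by
        have := congrArg (fun f => f fun i => j (c i)) (b.det.curryLeft.map_smul r v)
        exact this }
  -- Both spaces have dimension `k`.
  have hrange : LinearMap.range j = LinearMap.ker l := by
    refine Submodule.eq_of_le_of_finrank_le ?_ ?_
    · rintro _ ⟨u, rfl⟩
      exact hl u
    · have h1 := l.finrank_range_add_finrank_ker
      have h2 : LinearMap.range l = ⊤ := LinearMap.range_eq_top.2
        (LinearMap.surjective (fun h => hx (by simp [h])))
      rw [h2, finrank_top, Module.finrank_self, Module.finrank_eq_card_basis b,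
        Fintype.card_fin] at h1
      rw [LinearMap.finrank_range_of_inj hj, Module.finrank_eq_card_basis c, Fintype.card_fin]
      omega
  have hD : ∀ u, D (j u) = 0 := by
    intro u
    refine AlternatingMap.map_linearDependent b.det _ fun hli => ?_
    rw [linearIndependent_finCons] at hli
    refine hli.2 ?_
    rw [Set.range_comp' j c, Submodule.span_image, c.span_eq]
    exact ⟨u, trivial, rfl⟩
  have hmem : x - (l x / l x₀) • x₀ ∈ LinearMap.range j := by
    rw [hrange, LinearMap.mem_ker]
    simp [hx]
  obtain ⟨u, hu⟩ := hmem
  have h := hD u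
  rw [hu, map_sub, map_smul, smul_eq_mul, sub_eq_zero] at h
  exact h

/-- Each product is a single determinant in `V`, of the vectors `x₁`, `x₂` and the basis of `W`; the
two differ by exchanging the first two vectors. This is the linear algebra behind the vanishing of
the square of a cellular boundary. -/
theorem hyperplaneDet_mul_hyperplaneDet {U₁ U₂ W : Type*} [AddCommGroup U₁] [Module ℝ U₁]
    [AddCommGroup U₂] [Module ℝ U₂] [AddCommGroup W] [Module ℝ W]
    (b : Module.Basis (Fin (k + 1 + 1)) ℝ V) (c₁ : Module.Basis (Fin (k + 1)) ℝ U₁)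
    (c₂ : Module.Basis (Fin (k + 1)) ℝ U₂) (d : Module.Basis (Fin k) ℝ W)
    (i₁ : U₁ →ₗ[ℝ] V) (i₂ : U₂ →ₗ[ℝ] V) (j₁ : W →ₗ[ℝ] U₁) (j₂ : W →ₗ[ℝ] U₂)
    (h : ∀ w, i₁ (j₁ w) = i₂ (j₂ w)) (x₁ : U₁) (x₂ : U₂) :
    hyperplaneDet c₁ d j₁ x₁ * hyperplaneDet b c₁ i₁ (i₂ x₂) =
      -(hyperplaneDet c₂ d j₂ x₂ * hyperplaneDet b c₂ i₂ (i₁ x₁)) := by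
  rw [hyperplaneDet, ← det_cons_map b c₁ i₁ (i₂ x₂), hyperplaneDet,
    ← det_cons_map b c₂ i₂ (i₁ x₁)]
  rw [← AlternatingMap.map_swap b.det _ (i := 0) (j := 1) (by simp)]
  congr 1
  funext i
  refine Fin.cases ?_ (fun i => Fin.cases ?_ (fun i => ?_) i) i
  · simp
  · simp
  · have : Equiv.swap (0 : Fin (k + 1 + 1)) 1 i.succ.succ = i.succ.succ :=
      Equiv.swap_apply_of_ne_of_ne (by simp [Fin.ext_iff]) (by simp [Fin.ext_iff])
    simp [this, h]

/-- Dimensions of faces are related by propositional equalities only; this brings all bases to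
literal index types `Fin (k + 1)` and `Fin k`. -/
theorem hyperplaneDet_reindex {m n : ℕ} (h : m = n + 1) (e : n = k)
    (b : Module.Basis (Fin m) ℝ V) (c : Module.Basis (Fin n) ℝ U) (j : U →ₗ[ℝ] V) (x : V) :
    hyperplaneDet (b.reindex (finCongr h)) c j x =
      hyperplaneDet (b.reindex (finCongr (h.trans (congrArg (· + 1) e))))
        (c.reindex (finCongr e)) j x := by
  subst e
  simp

end Hyperplane

open Classical in
/-- The sign of a nonzero real number. -/
noncomputable def realSign (x : ℝ) : ℤ := if 0 < x then 1 else -1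

/-- Zero has sign `-1` by convention, so neither this nor `realSign_neg` extends to zero. -/
theorem realSign_mul {x y : ℝ} (hx : x ≠ 0) (hy : y ≠ 0) :
    realSign (x * y) = realSign x * realSign y := by
  rcases lt_or_gt_of_ne hx with h1 | h1 <;> rcases lt_or_gt_of_ne hy with h2 | h2
  · simp [realSign, h1.not_gt, h2.not_gt, mul_pos_of_neg_of_neg h1 h2]
  · simp [realSign, h1.not_gt, h2, (mul_neg_of_neg_of_pos h1 h2).not_gt]
  · simp [realSign, h1, h2.not_gt, (mul_neg_of_pos_of_neg h1 h2).not_gt]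
  · simp [realSign, h1, h2]

theorem realSign_neg {x : ℝ} (hx : x ≠ 0) : realSign (-x) = -realSign x := by
  rcases lt_or_gt_of_ne hx with h1 | h1 <;> simp [realSign, h1, h1.not_gt]

/-! ### Dimensions of faces and incidence numbers -/

section Faces

variable {E : Type*} [NormedAddCommGroup E] [NormedSpace ℝ E] {P : Set E}

/-- The exposing functional of a face attains its maximum over `P` exactly there. It serves below as
the outward direction of every face that contains `G`. -/
theorem Face.exists_functional (G : Face P) :
    ∃ l : E →ₗ[ℝ] ℝ, (∀ x ∈ G.1, ∀ y ∈ P, l y ≤ l x) ∧ ∀ x ∈ G.1, ∀ y ∈ P, y ∉ G.1 → l y < l x := by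
  obtain ⟨l, hl⟩ := G.2.2 G.2.1
  refine ⟨l.toLinearMap, fun x hx y hy => ?_, fun x hx y hy hyG => ?_⟩
  · rw [hl] at hx
    exact hx.2 y hy
  · by_contra hlt
    have hxy : l x ≤ l y := not_lt.1 hlt
    rw [hl] at hx hyG
    exact hyG ⟨hy, fun z hz => (hx.2 z hz).trans hxy⟩

theorem Face.subset (F : Face P) : F.1 ⊆ P := F.2.2.subset

theorem functional_eq_zero {G : Face P} {l : E →ₗ[ℝ] ℝ}
    (hl : ∀ x ∈ G.1, ∀ y ∈ P, l y ≤ l x) : ∀ v ∈ G.direction, l v = 0 := by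
  intro v hv
  have : G.direction ≤ LinearMap.ker l := by
    rw [Face.direction, vectorSpan_def, Submodule.span_le]
    rintro _ ⟨x, hx, y, hy, rfl⟩
    have h1 := hl x hx y (G.subset hy)
    have h2 := hl y hy x (G.subset hx)
    simp only [SetLike.mem_coe, LinearMap.mem_ker, vsub_eq_sub, map_sub]
    linarith
  exact this hv

/-- The functional exposing `G` is constant on `G` but smaller at a point of `F` outside `G`, so the
directions of `G` are a proper subspace. -/
theorem Face.dim_lt [FiniteDimensional ℝ E] {F G : Face P} (h : G < F) : G.dim < F.dim := by
  obtain ⟨q, hq⟩ := G.2.1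
  obtain ⟨p, hp, hpG⟩ := Set.exists_of_ssubset (show G.1 ⊂ F.1 from h)
  obtain ⟨l, hl, hl'⟩ := G.exists_functional
  refine Submodule.finrank_lt_finrank_of_lt (lt_of_le_of_ne (vectorSpan_mono ℝ h.le) fun he => ?_)
  have hmem : q -ᵥ p ∈ G.direction := by
    exact he ▸ vsub_mem_vectorSpan ℝ (h.le hq) hp
  have h1 := functional_eq_zero hl _ hmem
  have h2 := hl' q hq p (F.subset hp) hpG
  rw [vsub_eq_sub, map_sub] at h1
  linarith

/-- The intersection of two faces with a common point. -/
def Face.inter (F G : Face P) (h : (F.1 ∩ G.1).Nonempty) : Face P :=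
  ⟨F.1 ∩ G.1, h, F.2.2.inter G.2.2⟩

/-- A polytope as a face of itself. -/
def topFace (hP : P.Nonempty) : Face P := ⟨P, hP, IsExposed.refl P⟩

theorem outwardDet_eq {o : Orientations P} {F G : Face P} (hGF : G ≤ F)
    (hdim : F.dim = G.dim + 1) (p : F.1) (q : G.1) :
    outwardDet o hGF hdim p q = hyperplaneDet ((o F).reindex (finCongr hdim)) (o G)
      (Submodule.inclusion (vectorSpan_mono ℝ hGF))
      ⟨(q : E) -ᵥ (p : E), vsub_mem_vectorSpan ℝ (hGF q.2) p.2⟩ := by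
  rw [hyperplaneDet, Module.Basis.det_reindex]
  rfl

/-- The determinant is proportional to `l (q - p)`, where `l` exposes `G`. This is never negative,
and positive as soon as `p` lies outside `G`, so the sign does not depend on the points chosen. -/
theorem outwardDet_facts (o : Orientations P) {F G : Face P} (hGF : G ≤ F)
    (hdim : F.dim = G.dim + 1) {p₀ : E} (hp₀ : p₀ ∈ F.1) (hpG : p₀ ∉ G.1) {q₀ : E}
    (hq₀ : q₀ ∈ G.1) :
    outwardDet o hGF hdim ⟨p₀, hp₀⟩ ⟨q₀, hq₀⟩ ≠ 0 ∧
      ∀ (p : F.1) (q : G.1), ∃ t : ℝ, 0 ≤ t ∧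
        outwardDet o hGF hdim p q = t * outwardDet o hGF hdim ⟨p₀, hp₀⟩ ⟨q₀, hq₀⟩ := by
  obtain ⟨l, hl, hl'⟩ := G.exists_functional
  have hinj : Function.Injective (Submodule.inclusion (vectorSpan_mono ℝ hGF)) :=
    Submodule.inclusion_injective _
  have hzero : ∀ u : G.direction,
      (l.domRestrict F.direction) (Submodule.inclusion (vectorSpan_mono ℝ hGF) u) = 0 :=
    fun u => functional_eq_zero hl _ u.2
  have hpos : 0 < (l.domRestrict F.direction)
      ⟨q₀ -ᵥ p₀, vsub_mem_vectorSpan ℝ (hGF hq₀) hp₀⟩ := by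
    simpa using hl' q₀ hq₀ p₀ (F.subset hp₀) hpG
  refine ⟨?_, fun p q => ?_⟩
  · rw [outwardDet_eq]
    exact hyperplaneDet_ne_zero _ _ _ hinj _ hzero hpos.ne'
  · refine ⟨_, ?_, by
      rw [outwardDet_eq, outwardDet_eq]
      exact hyperplaneDet_eq _ _ _ hinj _ hzero hpos.ne' _⟩
    refine div_nonneg ?_ hpos.le
    simpa using hl q q.2 p (F.subset p.2)

-- The existential in `incidence` may be tested at any single pair with `p` outside `G`.
open Classical in
theorem incidence_eq_sign (o : Orientations P) {F G : Face P} (hGF : G ≤ F)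
    (hdim : F.dim = G.dim + 1) {p : E} (hp : p ∈ F.1) (hpG : p ∉ G.1) {q : E} (hq : q ∈ G.1) :
    outwardDet o hGF hdim ⟨p, hp⟩ ⟨q, hq⟩ ≠ 0 ∧
      incidence o F G = realSign (outwardDet o hGF hdim ⟨p, hp⟩ ⟨q, hq⟩) := by
  obtain ⟨h1, h2⟩ := outwardDet_facts o hGF hdim hp hpG hq
  refine ⟨h1, ?_⟩
  rw [incidence, dif_pos ⟨hGF, hdim⟩, realSign]
  refine if_congr ⟨?_, fun h => ⟨_, _, h⟩⟩ rfl rfl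
  rintro ⟨p', q', h⟩
  obtain ⟨t, ht, he⟩ := h2 p' q'
  rw [he] at h
  exact pos_of_mul_pos_right h ht

theorem incidence_isUnit (o : Orientations P) {F G : Face P} (hGF : G ≤ F)
    (hdim : F.dim = G.dim + 1) : IsUnit (incidence o F G) := by
  rw [incidence, dif_pos ⟨hGF, hdim⟩]
  split_ifs <;> simp

theorem incidence_diamond [FiniteDimensional ℝ E] (o : Orientations P) {F G₁ G₂ H : Face P}
    (h₁ : G₁ ≤ F) (h₂ : G₂ ≤ F) (k₁ : H ≤ G₁) (k₂ : H ≤ G₂) (hne : G₁ ≠ G₂)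
    (d₁ : F.dim = G₁.dim + 1) (d₂ : F.dim = G₂.dim + 1) (e₁ : G₁.dim = H.dim + 1)
    (e₂ : G₂.dim = H.dim + 1) :
    incidence o F G₁ * incidence o G₁ H = -(incidence o F G₂ * incidence o G₂ H) := by
  -- Two different facets with the common facet `H` meet in `H` only: an intersection larger than
  -- `H` would have the dimension of both and coincide with both.
  have key : ∀ {G₁ G₂ : Face P}, G₁ ≠ G₂ → H ≤ G₁ → H ≤ G₂ → G₁.dim = H.dim + 1 →
      G₂.dim = H.dim + 1 → ∃ g ∈ G₁.1, g ∉ H.1 ∧ g ∉ G₂.1 := by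
    intro G₁ G₂ hne k₁ k₂ e₁ e₂
    have hlt : H < G₁ := lt_of_le_of_ne k₁ (by rintro rfl; omega)
    obtain ⟨g, hg, hgH⟩ := Set.exists_of_ssubset (show H.1 ⊂ G₁.1 from hlt)
    refine ⟨g, hg, hgH, fun hg2 => hne ?_⟩
    let K : Face P := G₁.inter G₂ ⟨g, hg, hg2⟩
    have hHK : H < K := by
      refine lt_of_le_of_ne (fun x hx => ⟨k₁ hx, k₂ hx⟩) fun h => hgH ?_
      rw [h]
      exact ⟨hg, hg2⟩
    have hdimK := Face.dim_lt hHK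
    have hK₁ : K ≤ G₁ := fun x hx => hx.1
    have hK₂ : K ≤ G₂ := fun x hx => hx.2
    have hK₁' : K = G₁ := by
      by_contra h
      have := Face.dim_lt (lt_of_le_of_ne hK₁ h)
      omega
    have hK₂' : K = G₂ := by
      by_contra h
      have := Face.dim_lt (lt_of_le_of_ne hK₂ h)
      omega
    exact hK₁'.symm.trans hK₂'
  obtain ⟨g₁, hg₁, hg₁H, hg₁G⟩ := key hne k₁ k₂ e₁ e₂
  obtain ⟨g₂, hg₂, hg₂H, hg₂G⟩ := key hne.symm k₂ k₁ e₂ e₁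
  obtain ⟨q, hq⟩ := H.2.1
  -- The inner point for the facet `G₁` of `F` is taken on `G₂`, and conversely, so that the same
  -- two vectors `q - g₁` and `q - g₂` occur on both sides.
  obtain ⟨n1, s1⟩ := incidence_eq_sign o h₁ d₁ (h₂ hg₂) hg₂G (k₁ hq)
  obtain ⟨n2, s2⟩ := incidence_eq_sign o h₂ d₂ (h₁ hg₁) hg₁G (k₂ hq)
  obtain ⟨n3, s3⟩ := incidence_eq_sign o k₁ e₁ hg₁ hg₁H hq
  obtain ⟨n4, s4⟩ := incidence_eq_sign o k₂ e₂ hg₂ hg₂H hq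
  have hrel : outwardDet o k₁ e₁ ⟨g₁, hg₁⟩ ⟨q, hq⟩ * outwardDet o h₁ d₁ ⟨g₂, h₂ hg₂⟩ ⟨q, k₁ hq⟩ =
      -(outwardDet o k₂ e₂ ⟨g₂, hg₂⟩ ⟨q, hq⟩ *
        outwardDet o h₂ d₂ ⟨g₁, h₁ hg₁⟩ ⟨q, k₂ hq⟩) := by
    rw [outwardDet_eq, outwardDet_eq, outwardDet_eq, outwardDet_eq, hyperplaneDet_reindex d₁ e₁,
      hyperplaneDet_reindex d₂ e₂]
    exact hyperplaneDet_mul_hyperplaneDet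
      ((o F).reindex (finCongr (d₁.trans (congrArg (· + 1) e₁))))
      ((o G₁).reindex (finCongr e₁)) ((o G₂).reindex (finCongr e₂)) (o H)
      (Submodule.inclusion (vectorSpan_mono ℝ h₁)) (Submodule.inclusion (vectorSpan_mono ℝ h₂))
      (Submodule.inclusion (vectorSpan_mono ℝ k₁)) (Submodule.inclusion (vectorSpan_mono ℝ k₂))
      (fun w => rfl) ⟨q -ᵥ g₁, vsub_mem_vectorSpan ℝ (k₁ hq) hg₁⟩
      ⟨q -ᵥ g₂, vsub_mem_vectorSpan ℝ (k₂ hq) hg₂⟩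
  rw [s1, s2, s3, s4, ← realSign_mul n1 n3, ← realSign_mul n2 n4, mul_comm, hrel, mul_comm,
    realSign_neg (mul_ne_zero n2 n4)]

end Faces

-- Simultaneous induction on trees and forests

theorem RTree.forest_induction {P : RTree → Prop} {Q : List RTree → Prop}
    (neutral : ∀ L, Q L → P (.neutral L)) (closed : ∀ a L, Q L → P (.closed a L))
    (nil : Q []) (cons : ∀ t L, P t → Q L → Q (t :: L)) : (∀ t, P t) ∧ ∀ L, Q L := by
  have h : ∀ t, P t := fun t =>
    RTree.rec (motive_1 := P) (motive_2 := Q) neutral closed nil cons t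
  exact ⟨h, fun L => by induction L with
    | nil => exact nil
    | cons t L ih => exact cons t L (h t) ih⟩

/-! ### Cuts -/

theorem mem_cuts₂ {α : Type} {L : List α} {p : List α × List α} :
    p ∈ cuts₂ L ↔ p.1 ++ p.2 = L := by
  refine ⟨cuts₂_append, ?_⟩
  obtain ⟨A, B⟩ := p
  rintro rfl
  induction A with
  | nil => cases B <;> simp [cuts₂]
  | cons a A ih => simp only [List.cons_append, cuts₂, List.mem_cons, List.mem_map]
                   exact Or.inr ⟨_, ih, rfl⟩

theorem mem_cuts₃ {α : Type} {L : List α} {p : List α × List α × List α} :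
    p ∈ cuts₃ L ↔ p.1 ++ (p.2.1 ++ p.2.2) = L := by
  refine ⟨cuts₃_append, fun h => ?_⟩
  simp only [cuts₃, List.mem_flatMap, List.mem_map]
  exact ⟨(p.1, p.2.1 ++ p.2.2), mem_cuts₂.2 h, (p.2.1, p.2.2), mem_cuts₂.2 rfl, rfl⟩

theorem nodup_cuts₂ {α : Type} (L : List α) : (cuts₂ L).Nodup := by
  induction L with
  | nil => simp [cuts₂]
  | cons a L ih =>
    simp only [cuts₂, List.nodup_cons, List.mem_map]
    refine ⟨by simp, ih.map ?_⟩
    rintro ⟨A, B⟩ ⟨A', B'⟩ h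
    simpa using h

theorem nodup_cuts₃ {α : Type} (L : List α) : (cuts₃ L).Nodup := by
  rw [cuts₃, List.nodup_flatMap]
  refine ⟨fun p _ => (nodup_cuts₂ _).map ?_, ?_⟩
  · rintro ⟨A, B⟩ ⟨A', B'⟩ h
    simpa using h
  · refine (nodup_cuts₂ L).imp_of_mem ?_
    rintro p q hp hq hne x hx hx'
    simp only [List.mem_map] at hx hx'
    obtain ⟨r, hr, rfl⟩ := hx
    obtain ⟨r', hr', h⟩ := hx'
    have h1 : q.1 = p.1 := congrArg (fun x => x.1) h
    rw [mem_cuts₂] at hp hq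
    exact hne (Prod.ext h1.symm (by rw [← hp, h1] at hq; exact (List.append_cancel_left hq).symm))

/-! ### Neutral vertices -/

theorem forestNeutrals_append (L M : List RTree) :
    forestNeutrals (L ++ M) = forestNeutrals L + forestNeutrals M := by
  induction L with
  | nil => simp [forestNeutrals]
  | cons t L ih => simp [forestNeutrals, ih, add_assoc]

theorem blowUps_neutrals :
    (∀ t : RTree, ∀ p ∈ t.blowUps, p.2.neutrals = t.neutrals + 1) ∧
    ∀ L, ∀ p ∈ forestBlowUps L, forestNeutrals p.2 = forestNeutrals L + 1 := by
  refine RTree.forest_induction ?_ ?_ ?_ ?_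
  · intro L ih p hp
    simp only [RTree.blowUps, neutralRootBlowUps, List.mem_append, List.mem_map,
      List.mem_filter, mem_cuts₃] at hp
    rcases hp with ⟨q, ⟨rfl, hl⟩, rfl⟩ | ⟨q, hq, rfl⟩
    · simp [RTree.neutrals, forestNeutrals_append, forestNeutrals]; omega
    · simp [RTree.neutrals, ih q hq]
  · intro a L ih p hp
    simp only [RTree.blowUps, closedRootBlowUps, List.mem_append, List.mem_map,
      List.mem_filter, mem_cuts₃] at hp
    rcases hp with (⟨q, ⟨rfl, hl⟩, rfl⟩ | ⟨q, ⟨rfl, hl⟩, rfl⟩) | ⟨q, hq, rfl⟩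
    · simp [RTree.neutrals, forestNeutrals_append, forestNeutrals]
    · simp [RTree.neutrals, forestNeutrals_append, forestNeutrals]; omega
    · simp [RTree.neutrals, ih q hq]
  · intro p hp; simp [forestBlowUps] at hp
  · intro t L iht ihL p hp
    simp only [forestBlowUps, List.mem_append, List.mem_map] at hp
    rcases hp with ⟨q, hq, rfl⟩ | ⟨q, hq, rfl⟩
    · simp [forestNeutrals, iht q hq]; omega
    · simp [forestNeutrals, ihL q hq]; omega

theorem STree.blowUps_neutrals (S : STree) :
    ∀ p ∈ S.blowUps, (p.2.map STree.neutrals).sum = S.neutrals + 1 := by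
  intro p hp
  cases S with
  | neutral L =>
    simp only [STree.blowUps, List.mem_append, List.mem_map, List.mem_filter, mem_cuts₃,
      mem_cuts₂] at hp
    rcases hp with (⟨q, ⟨rfl, hl⟩, rfl⟩ | ⟨q, ⟨rfl, hl⟩, rfl⟩) | ⟨q, hq, rfl⟩
    · simp [STree.neutrals, RTree.neutrals, forestNeutrals_append, forestNeutrals]; omega
    · simp [STree.neutrals, forestNeutrals_append]; omega
    · simp [STree.neutrals, RelBrace.blowUps_neutrals.2 L q hq]
  | opened a L =>
    simp only [STree.blowUps, List.mem_append, List.mem_map, List.mem_filter, mem_cuts₃,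
      mem_cuts₂] at hp
    rcases hp with ((⟨q, ⟨rfl, hl⟩, rfl⟩ | ⟨q, ⟨rfl, hl⟩, rfl⟩) | ⟨q, ⟨rfl, hl⟩, rfl⟩) |
      ⟨q, hq, rfl⟩
    · simp [STree.neutrals, RTree.neutrals, forestNeutrals_append, forestNeutrals]; omega
    · simp [STree.neutrals, forestNeutrals_append]; omega
    · simp [STree.neutrals, forestNeutrals_append]; omega
    · simp [STree.neutrals, RelBrace.blowUps_neutrals.2 L q hq]

theorem wordBlowUps_neutrals (W : List STree) : ∀ p ∈ wordBlowUps W,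
    (p.2.map STree.neutrals).sum = (W.map STree.neutrals).sum + 1 := by
  induction W with
  | nil => intro p hp; simp [wordBlowUps] at hp
  | cons S W ih =>
    intro p hp
    simp only [wordBlowUps, List.mem_append, List.mem_map] at hp
    rcases hp with ⟨q, hq, rfl⟩ | ⟨q, hq, rfl⟩
    · simp [S.blowUps_neutrals q hq]; omega
    · simp [ih q hq]; omega

theorem PreTree.blowUps_neutrals (S : PreTree) :
    ∀ p ∈ S.blowUps, p.2.neutrals = S.neutrals + 1 := by
  intro p hp
  cases S with
  | tree t =>
    simp only [PreTree.blowUps, List.mem_map] at hp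
    obtain ⟨q, hq, rfl⟩ := hp
    exact RelBrace.blowUps_neutrals.1 t q hq
  | word W =>
    simp only [PreTree.blowUps, List.mem_map] at hp
    obtain ⟨q, hq, rfl⟩ := hp
    exact wordBlowUps_neutrals W q hq

/-! ### The degree is nonnegative, and zero exactly when there are no blow-ups -/

/-- Joining at least two trees at a neutral vertex adds one vertex and removes at least one tree, so
neutral vertices and trees together never outnumber the labels. The inequality is strict only if
some neutral vertex has more than two inputs or some closed vertex has an input, and either permits
a blow-up. -/
theorem neutrals_lt_labels :
    (∀ t : RTree, t.Admissible → t.neutrals + 1 ≤ t.labels.card ∧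
      (t.blowUps = [] → t.neutrals + 1 = t.labels.card)) ∧
    ∀ L : List RTree, (∀ t ∈ L, t.Admissible) →
      forestNeutrals L + L.length ≤ (forestLabels L).card ∧
      (forestBlowUps L = [] → forestNeutrals L + L.length = (forestLabels L).card) := by
  refine RTree.forest_induction ?_ ?_ ?_ ?_
  · rintro L ih (⟨_, hl, h⟩ | _)
    obtain ⟨h1, h2⟩ := ih h
    refine ⟨by simp only [RTree.neutrals, RTree.labels]; omega, fun hb => ?_⟩
    simp only [RTree.blowUps, neutralRootBlowUps, List.append_eq_nil_iff, List.map_eq_nil_iff,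
      List.filter_eq_nil_iff, mem_cuts₃] at hb
    have h3 := h2 hb.2
    have : ¬ 2 < L.length := by
      intro hlt
      -- With three inputs, the first two can be grouped.
      refine hb.1 ([], L.take 2, L.drop 2) (by simp) ?_
      simp; omega
    simp only [RTree.neutrals, RTree.labels]
    omega
  · rintro a L ih (_ | ⟨_, _, h⟩)
    obtain ⟨h1, h2⟩ := ih h
    refine ⟨by simp only [RTree.neutrals, RTree.labels, Multiset.card_cons]; omega, fun hb => ?_⟩
    simp only [RTree.blowUps, closedRootBlowUps, List.append_eq_nil_iff, List.map_eq_nil_iff,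
      List.filter_eq_nil_iff, mem_cuts₃] at hb
    have h3 := h2 hb.2
    have : ¬ 0 < L.length := by
      intro hlt
      -- All inputs can be moved to a new neutral root, whose first input is the closed vertex.
      refine hb.1.1 ([], [], L) (by simp) ?_
      simp; omega
    simp only [RTree.neutrals, RTree.labels, Multiset.card_cons]
    omega
  · intro _; simp [forestNeutrals, forestLabels]
  · intro t L iht ihL h
    obtain ⟨h1, h2⟩ := iht (h t (by simp))
    obtain ⟨h3, h4⟩ := ihL fun s hs => h s (by simp [hs])
    simp only [forestNeutrals, forestLabels, List.length_cons, Multiset.card_add]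
    refine ⟨by omega, fun hb => ?_⟩
    simp only [forestBlowUps, List.append_eq_nil_iff, List.map_eq_nil_iff] at hb
    have := h2 hb.1
    have := h4 hb.2
    omega

theorem STree.neutrals_le_labels (S : STree) (hS : S.Admissible) :
    S.neutrals ≤ S.labels.card ∧ (S.blowUps = [] → S.neutrals = S.labels.card) := by
  cases hS with
  | neutral L hl h =>
    obtain ⟨h1, h2⟩ := neutrals_lt_labels.2 L h
    refine ⟨by simp only [STree.neutrals, STree.labels]; omega, fun hb => ?_⟩
    simp only [STree.blowUps, List.append_eq_nil_iff, List.map_eq_nil_iff,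
      List.filter_eq_nil_iff, mem_cuts₃] at hb
    have h3 := h2 hb.2
    have : ¬ 1 < L.length := by
      intro hlt
      -- All inputs can be grouped, because a neutral square vertex may have a single input.
      refine hb.1.1 ([], L, []) (by simp) ?_
      simp; omega
    simp only [STree.neutrals, STree.labels]
    omega
  | opened a L h =>
    obtain ⟨h1, h2⟩ := neutrals_lt_labels.2 L h
    refine ⟨by simp only [STree.neutrals, STree.labels]; omega, fun hb => ?_⟩
    simp only [STree.blowUps, List.append_eq_nil_iff, List.map_eq_nil_iff,
      List.filter_eq_nil_iff, mem_cuts₂] at hb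
    have h3 := h2 hb.2
    have : ¬ 0 < L.length := by
      intro hlt
      -- All inputs can be given to a neutral tree to the left of the open vertex.
      refine hb.1.2 (L, []) (by simp) ?_
      simp; omega
    simp only [STree.neutrals, STree.labels]
    omega

theorem word_neutrals_le_labels (W : List STree) (hW : ∀ S ∈ W, S.Admissible) :
    (W.map STree.neutrals).sum ≤ (W.map STree.labels).sum.card ∧
      (wordBlowUps W = [] → (W.map STree.neutrals).sum = (W.map STree.labels).sum.card) := by
  induction W with
  | nil => simp
  | cons S W ih =>
    obtain ⟨h1, h2⟩ := S.neutrals_le_labels (hW S (by simp))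
    obtain ⟨h3, h4⟩ := ih fun R hR => hW R (by simp [hR])
    simp only [List.map_cons, List.sum_cons, Multiset.card_add]
    refine ⟨by omega, fun hb => ?_⟩
    simp only [wordBlowUps, List.append_eq_nil_iff, List.map_eq_nil_iff] at hb
    rw [h2 hb.1, h4 hb.2]

theorem card_positions (c : Colour) (I : List Colour) : (positions c I).card = I.count c := by
  induction I with
  | nil => simp [positions]
  | cons d I ih =>
    rw [positions_cons, Multiset.card_add, Multiset.card_map, ih, List.count_cons]
    by_cases h : c = d
    · simp [h, add_comm]
    · simp [h, Ne.symm h]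

theorem nodup_positions (c : Colour) (I : List Colour) : (positions c I).Nodup := by
  rw [positions, Multiset.coe_nodup]
  exact (List.nodup_range.filter _).map fun _ _ h => Nat.succ_injective h

/-- The labels are counted by the closed entries of `I`. A tree has room for one neutral vertex
fewer than a word, which matches the one subtracted in `shift` for a closed output. -/
theorem Tr.degree_nonneg {I : List Colour} {x : Colour} (S : Tr I x) :
    0 ≤ S.degree ∧ (S.1.blowUps = [] → S.degree = 0) := by
  obtain ⟨S, ha, hl, -⟩ := S
  have hc := card_positions .cl I
  rw [← hl] at hc
  unfold Tr.degree shift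
  cases ha with
  | tree t ht =>
    obtain ⟨h1, h2⟩ := neutrals_lt_labels.1 t ht
    simp only [PreTree.labels] at hc
    simp only [PreTree.neutrals, PreTree.blowUps, List.map_eq_nil_iff, if_true]
    exact ⟨by omega, fun h => by have := h2 h; omega⟩
  | word W _ hW =>
    obtain ⟨h1, h2⟩ := word_neutrals_le_labels W hW
    simp only [PreTree.labels] at hc
    simp only [PreTree.neutrals, PreTree.blowUps, List.map_eq_nil_iff, reduceCtorEq, if_false]
    exact ⟨by omega, fun h => by have := h2 h; omega⟩

theorem IsBlowUp.degree {I : List Colour} {x : Colour} {S S' : Tr I x} (h : IsBlowUp S S') :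
    S.degree = S'.degree + 1 := by
  obtain ⟨s, hs⟩ := h
  have := PreTree.blowUps_neutrals _ _ hs
  simp only [Tr.degree, this]
  push_cast
  ring

theorem Tr.exists_isBlowUp {I : List Colour} {x : Colour} (S : Tr I x) (h : S.degree ≠ 0) :
    ∃ S', IsBlowUp S S' := by
  obtain ⟨p, hp⟩ := List.exists_mem_of_ne_nil _ fun h' => h (S.degree_nonneg.2 h')
  exact ⟨⟨p.2, S.2.blowUp hp⟩, p.1, hp⟩

/-! ### Different blow-ups give different trees -/

theorem sizeOf_forest_mem {L : List RTree} {t : RTree} (h : t ∈ L) : t ≠ .neutral L := by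
  rintro rfl
  have := List.sizeOf_lt_of_mem h
  simp at this

theorem sizeOf_forest_mem_closed {a : ℕ} {L : List RTree} {t : RTree} (h : t ∈ L) :
    t ≠ .closed a L := by
  rintro rfl
  have := List.sizeOf_lt_of_mem h
  simp at this

/-- Replacing one of two different consecutive blocks by a single entry gives different results,
if that entry is not the first entry after the cut. -/
theorem replace_block_injective {α : Type} {A B C A' B' C' : List α} {x : List α → α}
    (h : A ++ (B ++ C) = A' ++ (B' ++ C')) (h' : A ++ x B :: C = A' ++ x B' :: C')
    (hB : ∀ y ∈ (B ++ C).head?, y ≠ x B) (hB' : ∀ y ∈ (B' ++ C').head?, y ≠ x B') :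
    A = A' ∧ B = B' ∧ C = C' := by
  have hlen : B.length = B'.length := by
    have h1 := congrArg List.length h
    have h2 := congrArg List.length h'
    simp at h1 h2
    omega
  have key : ∀ {A B C A' B' C' : List α}, A ++ (B ++ C) = A' ++ (B' ++ C') →
      A ++ x B :: C = A' ++ x B' :: C' → (∀ y ∈ (B ++ C).head?, y ≠ x B) →
      ¬ A.length < A'.length := by
    intro A B C A' B' C' h h' hB hlt
    have h1 := congrArg (fun l => l[A.length]?) h
    have h2 := congrArg (fun l => l[A.length]?) h'
    simp only [List.getElem?_append_right le_rfl, List.getElem?_append_left hlt, Nat.sub_self,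
      List.getElem?_cons_zero] at h1 h2
    -- If `A` were shorter, the entry at its end would be the first entry of `B ++ C` by `h` and the
    -- entry `x B` by `h'`.
    rw [← h2, ← List.head?_eq_getElem?] at h1
    exact hB (x B) (by simp [h1]) rfl
  have hA : A.length = A'.length := le_antisymm (not_lt.1 (key h.symm h'.symm hB'))
    (not_lt.1 (key h h' hB))
  obtain ⟨h1, h2⟩ := List.append_inj h hA
  obtain ⟨h3, h4⟩ := List.append_inj h2 hlen
  exact ⟨h1, h3, h4⟩

theorem nodup_map_cuts₃ {β : Type} (L : List RTree) (P : List RTree × List RTree × List RTree → Bool)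
    (x : List RTree → RTree) (f : List RTree → β) (hf : Function.Injective f)
    (hP : ∀ p ∈ cuts₃ L, P p → ∀ y ∈ (p.2.1 ++ p.2.2).head?, y ≠ x p.2.1) :
    (((cuts₃ L).filter P).map fun p => f (p.1 ++ x p.2.1 :: p.2.2)).Nodup := by
  refine List.Nodup.map_on ?_ ((nodup_cuts₃ L).filter _)
  intro p hp q hq h
  rw [List.mem_filter] at hp hq
  obtain ⟨h1, h2, h3⟩ := replace_block_injective
    ((cuts₃_append hp.1).trans (cuts₃_append hq.1).symm) (hf h) (hP p hp.1 hp.2) (hP q hq.1 hq.2)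
  exact Prod.ext h1 (Prod.ext h2 h3)

theorem head_ne_neutral {B C : List RTree} (h : 1 ≤ B.length) :
    ∀ y ∈ (B ++ C).head?, y ≠ .neutral B := by
  cases B with
  | nil => simp at h
  | cons b B => simpa using sizeOf_forest_mem (L := b :: B) (by simp)

/-- For empty `B` the new entry is the leaf labelled `a`, which might repeat its right neighbour;
then the position of the insertion would be lost. Distinct labels exclude this. -/
theorem head_ne_closed {a : ℕ} {B C : List RTree} (h : a ∉ forestLabels (B ++ C)) :
    ∀ y ∈ (B ++ C).head?, y ≠ .closed a B := by
  cases B with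
  | nil =>
    cases C with
    | nil => simp
    | cons c C =>
      simp only [List.nil_append, List.head?_cons, Option.mem_some_iff, forall_eq']
      rintro rfl
      simp [forestLabels, RTree.labels] at h
  | cons b B => simpa using sizeOf_forest_mem_closed (L := b :: B) (by simp)

theorem nodup_map_snd {α β γ : Type} {f : β → γ} (hf : Function.Injective f) {l : List (α × β)}
    (h : (l.map Prod.snd).Nodup) : (l.map fun p => f p.2).Nodup := by
  have := h.map hf
  rwa [List.map_map] at this

/-- Blow-ups of the root lower its number of inputs or change its type, unlike those above the root;
a blow-up of the first tree of a forest changes its number of neutral vertices, unlike those of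
later trees. -/
theorem blowUps_nodup :
    (∀ t : RTree, t.labels.Nodup → (t.blowUps.map Prod.snd).Nodup) ∧
    ∀ L, (forestLabels L).Nodup → ((forestBlowUps L).map Prod.snd).Nodup := by
  refine RTree.forest_induction ?_ ?_ ?_ ?_
  · intro L ih hn
    simp only [RTree.blowUps, neutralRootBlowUps, List.map_append, List.map_map,
      Function.comp_def]
    refine List.nodup_append'.2 ⟨nodup_map_cuts₃ L _ _ RTree.neutral (fun _ _ h => by simpa using h)
      ?_, ?_, ?_⟩
    · intro p _ hp
      simp only [decide_eq_true_eq] at hp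
      exact head_ne_neutral (by omega)
    · exact nodup_map_snd (fun _ _ h => by simpa using h) (ih hn)
    · simp only [List.disjoint_left, List.mem_map, List.mem_filter, decide_eq_true_eq, mem_cuts₃]
      rintro _ ⟨p, ⟨rfl, hp⟩, rfl⟩ ⟨q, hq, h⟩
      have := (forestBlowUps_spec _ q hq).2.1
      simp only [RTree.neutral.injEq] at h
      rw [h] at this
      simp at this
      omega
  · intro a L ih hn
    rw [RTree.labels, Multiset.nodup_cons] at hn
    simp only [RTree.blowUps, closedRootBlowUps, List.map_append, List.map_map,
      Function.comp_def]
    refine List.nodup_append'.2 ⟨List.nodup_append'.2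
      ⟨nodup_map_cuts₃ L _ (RTree.closed a) RTree.neutral (fun _ _ h => by simpa using h) ?_,
      nodup_map_cuts₃ L _ RTree.neutral (RTree.closed a) (fun _ _ h => by simpa using h) ?_, ?_⟩,
      ?_, ?_⟩
    · intro p hp _
      refine head_ne_closed fun h => hn.1 ?_
      rw [← cuts₃_append hp, forestLabels_append]
      exact Multiset.mem_add.2 (Or.inr h)
    · intro p _ hp
      simp only [decide_eq_true_eq] at hp
      exact head_ne_neutral (by omega)
    · simp only [List.disjoint_left, List.mem_map]
      rintro _ ⟨p, -, rfl⟩ ⟨q, -, h⟩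
      simp at h
    · exact nodup_map_snd (fun _ _ h => by simpa using h) (ih hn.2)
    · simp only [List.disjoint_left, List.mem_append, List.mem_map, List.mem_filter,
        decide_eq_true_eq, mem_cuts₃]
      rintro _ (⟨p, ⟨rfl, hp⟩, rfl⟩ | ⟨p, ⟨rfl, hp⟩, rfl⟩) ⟨q, hq, h⟩
      · simp at h
      · have := (forestBlowUps_spec _ q hq).2.1
        simp only [RTree.closed.injEq, true_and] at h
        rw [h] at this
        simp at this
        omega
  · simp [forestBlowUps]
  · intro t L iht ihL hn
    rw [forestLabels, Multiset.nodup_add] at hn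
    simp only [forestBlowUps, List.map_append, List.map_map, Function.comp_def]
    refine List.nodup_append'.2 ⟨?_, ?_, ?_⟩
    · exact nodup_map_snd (f := fun s => s :: L) (fun _ _ h => by simpa using h) (iht hn.1)
    · exact nodup_map_snd (fun _ _ h => by simpa using h) (ihL hn.2.1)
    · simp only [List.disjoint_left, List.mem_map]
      rintro _ ⟨p, hp, rfl⟩ ⟨q, hq, h⟩
      have := blowUps_neutrals.1 t p hp
      simp only [List.cons.injEq] at h
      rw [← h.1] at this
      omega

theorem STree.blowUps_nodup (S : STree) (hS : S.labels.Nodup) :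
    (S.blowUps.map Prod.snd).Nodup := by
  cases S with
  | neutral L =>
    simp only [STree.blowUps, List.map_append, List.map_map, Function.comp_def]
    refine List.nodup_append'.2 ⟨List.nodup_append'.2
      ⟨nodup_map_cuts₃ L _ RTree.neutral (fun M => [STree.neutral M])
        (fun _ _ h => by simpa using h) ?_, ?_, ?_⟩, ?_, ?_⟩
    · intro p _ hp
      simp only [decide_eq_true_eq] at hp
      exact head_ne_neutral (by omega)
    · exact ((nodup_cuts₂ L).filter _).map fun p q h => by simpa [Prod.ext_iff] using h
    · simp only [List.disjoint_left, List.mem_map]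
      rintro _ ⟨p, -, rfl⟩ ⟨q, -, h⟩
      simp at h
    · exact nodup_map_snd (f := fun M => [STree.neutral M]) (fun _ _ h => by simpa using h) 
        (RelBrace.blowUps_nodup.2 L hS)
    · simp only [List.disjoint_left, List.mem_append, List.mem_map, List.mem_filter,
        decide_eq_true_eq, mem_cuts₃]
      rintro _ (⟨p, ⟨rfl, hp⟩, rfl⟩ | ⟨p, ⟨-, hp⟩, rfl⟩) ⟨q, hq, h⟩
      · have := (forestBlowUps_spec _ q hq).2.1
        simp only [List.cons.injEq, STree.neutral.injEq, and_true] at h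
        rw [h] at this
        simp at this
        omega
      · simp at h
  | opened a L =>
    simp only [STree.blowUps, List.map_append, List.map_map, Function.comp_def]
    refine List.nodup_append'.2 ⟨List.nodup_append'.2 ⟨List.nodup_append'.2
      ⟨nodup_map_cuts₃ L _ RTree.neutral (fun M => [STree.opened a M])
        (fun _ _ h => by simpa using h) ?_, ?_, ?_⟩, ?_, ?_⟩, ?_, ?_⟩
    · intro p _ hp
      simp only [decide_eq_true_eq] at hp
      exact head_ne_neutral (by omega)
    · exact ((nodup_cuts₂ L).filter _).map fun p q h => by simpa [Prod.ext_iff] using h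
    · simp only [List.disjoint_left, List.mem_map]
      rintro _ ⟨p, -, rfl⟩ ⟨q, -, h⟩
      simp at h
    · exact ((nodup_cuts₂ L).filter _).map fun p q h => by simpa [Prod.ext_iff] using h
    · simp only [List.disjoint_left, List.mem_append, List.mem_map]
      rintro _ (⟨p, -, rfl⟩ | ⟨p, -, rfl⟩) ⟨q, -, h⟩ <;> simp at h
    · exact nodup_map_snd (f := fun M => [STree.opened a M]) (fun _ _ h => by simpa using h) 
        (RelBrace.blowUps_nodup.2 L hS)
    · simp only [List.disjoint_left, List.mem_append, List.mem_map, List.mem_filter,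
        decide_eq_true_eq, mem_cuts₃]
      rintro _ ((⟨p, ⟨rfl, hp⟩, rfl⟩ | ⟨p, -, rfl⟩) | ⟨p, -, rfl⟩) ⟨q, hq, h⟩
      · have := (forestBlowUps_spec _ q hq).2.1
        simp only [List.cons.injEq, STree.opened.injEq, and_true, true_and] at h
        rw [h] at this
        simp at this
        omega
      · simp at h
      · simp at h

/-- The first tree of the result has a root of another type, fewer inputs, or more neutral vertices.
In a word this separates the blow-ups of the first tree from those of the following ones. -/
theorem STree.head_blowUps (S : STree) : ∀ p ∈ S.blowUps, ∀ R W, p.2 = R :: W → R ≠ S := by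
  intro p hp R W hR
  rintro rfl
  cases R with
  | neutral L =>
    simp only [STree.blowUps, List.mem_append, List.mem_map, List.mem_filter, mem_cuts₃,
      mem_cuts₂, decide_eq_true_eq] at hp
    rcases hp with (⟨q, ⟨hq, hl⟩, rfl⟩ | ⟨q, ⟨hq, hl⟩, rfl⟩) | ⟨q, hq, rfl⟩
    · simp only [List.cons.injEq, STree.neutral.injEq] at hR
      rw [← hR.1] at hq
      have := congrArg List.length hq
      simp at this
      omega
    · simp only [List.cons.injEq, STree.neutral.injEq] at hR
      rw [← hR.1] at hq
      have := congrArg List.length hq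
      simp at this
      simp [this] at hl
    · simp only [List.cons.injEq, STree.neutral.injEq] at hR
      have := RelBrace.blowUps_neutrals.2 L q hq
      rw [hR.1] at this
      omega
  | opened a L =>
    simp only [STree.blowUps, List.mem_append, List.mem_map, List.mem_filter, mem_cuts₃,
      mem_cuts₂, decide_eq_true_eq] at hp
    rcases hp with ((⟨q, ⟨hq, hl⟩, rfl⟩ | ⟨q, ⟨hq, hl⟩, rfl⟩) | ⟨q, ⟨hq, hl⟩, rfl⟩) |
      ⟨q, hq, rfl⟩
    · simp only [List.cons.injEq, STree.opened.injEq] at hR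
      rw [← hR.1.2] at hq
      have := congrArg List.length hq
      simp at this
      omega
    · simp only [List.cons.injEq, STree.opened.injEq] at hR
      rw [← hR.1.2] at hq
      have := congrArg List.length hq
      simp at this
      simp [this] at hl
    · simp at hR
    · simp only [List.cons.injEq, STree.opened.injEq] at hR
      have := RelBrace.blowUps_neutrals.2 L q hq
      rw [hR.1.2] at this
      omega

theorem wordBlowUps_nodup (W : List STree) (hW : (W.map STree.labels).sum.Nodup) :
    ((wordBlowUps W).map Prod.snd).Nodup := by
  induction W with
  | nil => simp [wordBlowUps]
  | cons S W ih =>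
    simp only [List.map_cons, List.sum_cons, Multiset.nodup_add] at hW
    simp only [wordBlowUps, List.map_append, List.map_map, Function.comp_def]
    refine List.nodup_append'.2 ⟨?_, ?_, ?_⟩
    · exact nodup_map_snd (f := fun V => V ++ W) (fun _ _ h => by simpa using h)
        (S.blowUps_nodup hW.1)
    · exact nodup_map_snd (f := fun V => S :: V) (fun _ _ h => by simpa using h) (ih hW.2.1)
    · simp only [List.disjoint_left, List.mem_map]
      rintro _ ⟨p, hp, rfl⟩ ⟨q, -, h⟩
      cases hV : p.2 with
      | nil => exact S.blowUps_ne_nil p hp hV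
      | cons R V =>
        rw [hV] at h
        simp only [List.cons_append, List.cons.injEq] at h
        exact S.head_blowUps p hp R V hV h.1.symm

theorem Tr.blowUps_nodup {I : List Colour} {x : Colour} (S : Tr I x) :
    (S.1.blowUps.map Prod.snd).Nodup := by
  obtain ⟨S, ha, hl, -⟩ := S
  have hn : S.labels.Nodup := hl ▸ nodup_positions _ _
  cases ha with
  | tree t _ =>
    simp only [PreTree.blowUps, List.map_map, Function.comp_def]
    exact nodup_map_snd (fun _ _ h => by simpa using h) (RelBrace.blowUps_nodup.1 t hn)
  | word W _ _ =>
    simp only [PreTree.blowUps, List.map_map, Function.comp_def]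
    exact nodup_map_snd (fun _ _ h => by simpa using h) (wordBlowUps_nodup W hn)

/-! ### The coefficients of the differential -/

theorem sum_smul_gen_apply_eq_zero {I : List Colour} {x : Colour} {α : Type} (l : List α)
    (c : α → ℤ) (g : α → Tr I x) (S' : Tr I x) (h : S' ∉ l.map g) :
    (l.map fun p => c p • gen (g p)).sum S' = 0 := by
  induction l with
  | nil => simp
  | cons r l ih =>
    simp only [List.map_cons, List.mem_cons, not_or] at h
    simp only [List.map_cons, List.sum_cons, Finsupp.add_apply, Finsupp.smul_apply, ih h.2]
    rw [gen, Finsupp.single_eq_of_ne h.1]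
    simp

theorem sum_smul_gen_apply {I : List Colour} {x : Colour} {α : Type} (l : List α)
    (c : α → ℤ) (g : α → Tr I x) (hl : (l.map g).Nodup) (p : α) (hp : p ∈ l) :
    (l.map fun p => c p • gen (g p)).sum (g p) = c p := by
  induction l with
  | nil => simp at hp
  | cons q l ih =>
    rw [List.map_cons, List.nodup_cons] at hl
    simp only [List.map_cons, List.sum_cons, Finsupp.add_apply, Finsupp.smul_apply]
    rcases List.mem_cons.1 hp with rfl | hp
    · rw [sum_smul_gen_apply_eq_zero l c g _ hl.1, gen, Finsupp.single_eq_same]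
      simp
    · rw [ih hl.2 hp, gen, Finsupp.single_eq_of_ne]
      · simp
      · intro h'
        exact hl.1 (h' ▸ List.mem_map_of_mem hp)

/-- Since different blow-ups give different trees, no coefficient collects more than one sign. -/
theorem blowUpSum_apply {I : List Colour} {x : Colour} {S S' : Tr I x} {s : ℤ}
    (h : (s, S'.1) ∈ S.1.blowUps) : blowUpSum S S' = s := by
  refine sum_smul_gen_apply S.1.blowUps.attach (fun p => p.1.1)
    (fun p => (⟨p.1.2, S.2.blowUp p.2⟩ : Tr I x)) ?_ ⟨_, h⟩ (List.mem_attach _ _)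
  have hn := S.blowUps_nodup
  rw [← List.attach_map_subtype_val S.1.blowUps, List.map_map] at hn
  exact List.Nodup.map_on (fun p hp q hq h => List.inj_on_of_nodup_map hn hp hq
    (congrArg Subtype.val h)) (List.Nodup.of_map _ hn)

theorem blowUpSum_apply_eq_zero {I : List Colour} {x : Colour} {S S' : Tr I x}
    (h : ¬ IsBlowUp S S') : blowUpSum S S' = 0 := by
  refine sum_smul_gen_apply_eq_zero S.1.blowUps.attach (fun p => p.1.1)
    (fun p => (⟨p.1.2, S.2.blowUp p.2⟩ : Tr I x)) S' fun h' => h ?_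
  obtain ⟨p, -, rfl⟩ := List.mem_map.1 h'
  exact ⟨p.1.1, p.2⟩


/-! ### Signed permutations of lists -/

/-- `SignedPerm s l l'`: the list `l'` arises from `l` by a sequence of adjacent transpositions
whose sign is `s`. -/
inductive SignedPerm {β : Type} : ℤ → List β → List β → Prop
  | refl (l : List β) : SignedPerm 1 l l
  | swap (x y : β) (l : List β) : SignedPerm (-1) (x :: y :: l) (y :: x :: l)
  | cons (x : β) {s : ℤ} {l l' : List β} : SignedPerm s l l' → SignedPerm s (x :: l) (x :: l')
  | trans {s t : ℤ} {l₁ l₂ l₃ : List β} : SignedPerm s l₁ l₂ → SignedPerm t l₂ l₃ →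
      SignedPerm (s * t) l₁ l₃

namespace SignedPerm

variable {β : Type} {s t : ℤ} {l l' : List β}

theorem perm (h : SignedPerm s l l') : l.Perm l' := by
  induction h with
  | refl l => exact .refl l
  | swap x y l => exact .swap y x l
  | cons x _ ih => exact ih.cons x
  | trans _ _ ih₁ ih₂ => exact ih₁.trans ih₂

theorem of_eq (h : SignedPerm s l l') (hst : s = t) : SignedPerm t l l' := hst ▸ h

theorem mul_self (h : SignedPerm s l l') : s * s = 1 := by
  induction h with
  | refl | swap => norm_num
  | cons _ _ ih => exact ih
  | trans _ _ ih₁ ih₂ => rw [mul_mul_mul_comm, ih₁, ih₂, one_mul]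

theorem append_right (h : SignedPerm s l l') (m : List β) : SignedPerm s (l ++ m) (l' ++ m) := by
  induction h with
  | refl => exact .refl _
  | swap x y l => exact .swap x y _
  | cons x _ ih => exact ih.cons x
  | trans _ _ ih₁ ih₂ => exact ih₁.trans ih₂

theorem append_left (h : SignedPerm s l l') (m : List β) : SignedPerm s (m ++ l) (m ++ l') := by
  induction m with
  | nil => exact h
  | cons x m ih => exact ih.cons x

/-- Moving an entry to the front. -/
theorem move (m : List β) (b : β) (l : List β) :
    SignedPerm (sgn m.length) (m ++ b :: l) (b :: (m ++ l)) := by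
  induction m with
  | nil => exact .refl _
  | cons x m ih =>
    refine ((ih.cons x).trans (.swap x b _)).of_eq ?_
    simp [sgn, pow_succ]

theorem append_move (h : SignedPerm s l (b :: l')) (m : List β) :
    SignedPerm (sgn m.length * s) (m ++ l) (b :: (m ++ l')) :=
  ((h.append_left m).trans (move m _ l')).of_eq (mul_comm _ _)

theorem cons_move (h : SignedPerm s l (b :: l')) (x : β) :
    SignedPerm (-s) (x :: l) (b :: x :: l') :=
  ((h.cons x).trans (.swap x _ _)).of_eq (by ring)

end SignedPerm

/-- The sign `-1` for two entries which are not in increasing order. -/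
def orderSign (x y : ℕ × ℕ) : ℤ := if Nat.pair y.1 y.2 < Nat.pair x.1 x.2 then -1 else 1

theorem orderSign_mul_self (x y : ℕ × ℕ) : orderSign x y * orderSign x y = 1 := by
  unfold orderSign
  split_ifs <;> norm_num

theorem orderSign_swap {x y : ℕ × ℕ} (h : x ≠ y) : orderSign y x = -orderSign x y := by
  have : Nat.pair x.1 x.2 ≠ Nat.pair y.1 y.2 := fun h' => h (by
    rw [Nat.pair_eq_pair] at h'
    exact Prod.ext h'.1 h'.2)
  unfold orderSign
  rcases lt_or_gt_of_ne this with h | h <;> simp [h, h.not_gt]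

/-- The sign of the permutation which sorts a list. -/
def sortSign : List (ℕ × ℕ) → ℤ
  | [] => 1
  | x :: l => (l.map (orderSign x)).prod * sortSign l

/-- Exchanging two neighbours changes exactly one factor of `sortSign`. The order defined through
`Nat.pair` serves only as some total order of the brackets. -/
theorem SignedPerm.sortSign_eq {s : ℤ} {l l' : List (ℕ × ℕ)} (h : SignedPerm s l l')
    (hl : l.Nodup) : sortSign l = s * sortSign l' := by
  induction h with
  | refl => simp
  | swap x y l =>
    have hne : x ≠ y := fun h => by simp [h] at hl
    simp only [sortSign, List.map_cons, List.prod_cons, orderSign_swap hne]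
    ring
  | cons x h ih =>
    rw [sortSign, sortSign, ih hl.of_cons, (h.perm.map _).prod_eq]
    ring
  | trans h₁ _ ih₁ ih₂ => rw [ih₁ hl, ih₂ (h₁.perm.nodup_iff.1 hl), mul_assoc]

theorem sortSign_mul_self (l : List (ℕ × ℕ)) : sortSign l * sortSign l = 1 := by
  induction l with
  | nil => simp [sortSign]
  | cons x l ih =>
    have : (l.map (orderSign x)).prod * (l.map (orderSign x)).prod = 1 := by
      clear ih
      induction l with
      | nil => simp
      | cons y l ih =>
        rw [List.map_cons, List.prod_cons, mul_mul_mul_comm, ih, orderSign_mul_self, one_mul]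
    rw [sortSign, mul_mul_mul_comm, this, ih, one_mul]

/-! ### Comparing two systems of signs -/

/-- The signs `u` are built by increasing rank: an element of rank `k + 1` takes the value dictated
by one chosen element which it covers in the blow-up order. Any other such element dictates the same
value, by comparing both with their common predecessor two ranks below. -/
theorem exists_gauge {X : Type*} [Finite X] (rank : X → ℕ) (cov : X → X → Prop) (r : X → X → ℤ)
    (hrank : ∀ S S', cov S S' → rank S' = rank S + 1)
    (hr : ∀ S S', cov S S' → r S S' * r S S' = 1)
    (hdiamond : ∀ S₁ S₂ S', cov S₁ S' → cov S₂ S' → S₁ ≠ S₂ →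
      ∃ S, cov S S₁ ∧ cov S S₂ ∧ r S₁ S' * r S S₁ = r S₂ S' * r S S₂) :
    ∃ u : X → ℤˣ, ∀ S S', cov S S' → (u S' : ℤ) = r S S' * u S := by
  classical
  have key : ∀ k : ℕ, ∃ u : X → ℤˣ, ∀ S S', rank S' ≤ k → cov S S' → (u S' : ℤ) = r S S' * u S := by
    intro k
    induction k with
    | zero =>
      refine ⟨1, fun S S' h hc => ?_⟩
      have := hrank S S' hc
      omega
    | succ k ih =>
      obtain ⟨u, hu⟩ := ih
      let runit : X → X → ℤˣ := fun S S' =>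
        if h : r S S' * r S S' = 1 then ⟨r S S', r S S', h, h⟩ else 1
      have hrunit : ∀ S S', cov S S' → (runit S S' : ℤ) = r S S' := by
        intro S S' h
        simp only [runit, dif_pos (hr S S' h)]
      -- Elements without predecessor keep their old value, which no condition constrains.
      refine ⟨fun S' => if h : rank S' = k + 1 ∧ ∃ S, cov S S' then
        runit h.2.choose S' * u h.2.choose else u S', fun S S' hS' hc => ?_⟩
      have hlow : ∀ S, rank S ≤ k → (if h : rank S = k + 1 ∧ ∃ R, cov R S then
          runit h.2.choose S * u h.2.choose else u S) = u S := by
        intro S hS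
        rw [dif_neg]
        omega
      have hrk := hrank S S' hc
      rcases Nat.lt_or_ge (rank S') (k + 1) with hlt | hge
      · dsimp only
        rw [hlow S' (by omega), hlow S (by omega)]
        exact hu S S' (by omega) hc
      · have hex : rank S' = k + 1 ∧ ∃ S, cov S S' := ⟨by omega, S, hc⟩
        dsimp only
        rw [hlow S (by omega), dif_pos hex, Units.val_mul, hrunit _ _ hex.2.choose_spec]
        by_cases heq : hex.2.choose = S
        · rw [heq]
        -- `R` lies under both the chosen predecessor and `S`, and the product of the two signs from
        -- `R` to `S'` is the same along both paths.
        · obtain ⟨R, h1, h2, h3⟩ := hdiamond _ _ _ hex.2.choose_spec hc heq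
          have hrk' := hrank _ _ hex.2.choose_spec
          rw [hu R _ (by omega) h1, hu R S (by omega) h2, ← mul_assoc, h3, mul_assoc]
  obtain ⟨N, hN⟩ := (Set.finite_range rank).bddAbove
  obtain ⟨u, hu⟩ := key N
  exact ⟨u, fun S S' => hu S S' (hN ⟨S', rfl⟩)⟩

/-! ### Trees encoded by simplicial complexes -/

/-- The simplices of the flag complex whose vertices satisfy `V` and whose edges satisfy `C`. -/
def IsSimplex {β : Type} (V : β → Prop) (C : β → β → Prop) (A : Finset β) : Prop :=
  (∀ b ∈ A, V b) ∧ ∀ b ∈ A, ∀ c ∈ A, C b c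

theorem IsSimplex.subset {β : Type} {V : β → Prop} {C : β → β → Prop} {A B : Finset β}
    (h : IsSimplex V C A) (hB : B ⊆ A) : IsSimplex V C B :=
  ⟨fun b hb => h.1 b (hB hb), fun b hb c hc => h.2 b (hB hb) c (hB hc)⟩

/-- A description of the elements below `T` by sets of brackets: `R S l` says that `l` is the list
of the brackets given by the neutral vertices of `S`, in the order of the vertices. A blow-up adds
a bracket `b`, which contributes a sign `κ b`, and every bracket compatible with those of `S` can
be added. -/
structure TreeModel {I : List Colour} {x : Colour} (T : Tr I x) (V : ℕ × ℕ → Prop)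
    (C : ℕ × ℕ → ℕ × ℕ → Prop) (R : PreTree → List (ℕ × ℕ) → Prop) (κ : ℕ × ℕ → ℤ) : Prop where
  sign : ∀ b, κ b * κ b = 1
  top : R T.1 []
  det : ∀ {S l l'}, R S l → R S l' → l = l'
  inj : ∀ {S S' l l'}, R S l → R S' l' → (∀ b, b ∈ l ↔ b ∈ l') → S = S'
  simplex : ∀ {S l}, R S l → IsSimplex V C l.toFinset
  blowUp : ∀ {S l p}, R S l → p ∈ S.blowUps →
    ∃ b l', R p.2 l' ∧ SignedPerm (κ b * p.1) l' (b :: l)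
  exists_blowUp : ∀ {S l b}, R S l → b ∉ l → IsSimplex V C (insert b l.toFinset) →
    ∃ p ∈ S.blowUps, ∃ l', R p.2 l' ∧ ∀ c, c ∈ l' ↔ c = b ∨ c ∈ l

namespace TreeModel

variable {I : List Colour} {x : Colour} {T : Tr I x} {V : ℕ × ℕ → Prop}
  {C : ℕ × ℕ → ℕ × ℕ → Prop} {R : PreTree → List (ℕ × ℕ) → Prop} {κ : ℕ × ℕ → ℤ}

/-- Were the bracket already present, the blow-up would have the same brackets and so be the same
tree, but it has one more neutral vertex. -/
theorem notMem (M : TreeModel T V C R κ) {S : PreTree} {l l' : List (ℕ × ℕ)} {b : ℕ × ℕ}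
    {p : ℤ × PreTree} (h : R S l) (hp : p ∈ S.blowUps) (h' : R p.2 l')
    (hl : ∀ c, c ∈ l' ↔ c = b ∨ c ∈ l) : b ∉ l := by
  intro hb
  have he : p.2 = S := M.inj h' h fun c => by
    rw [hl]
    exact ⟨by rintro (rfl | h) <;> assumption, Or.inr⟩
  have := S.blowUps_neutrals p hp
  rw [he] at this
  omega

theorem exists_list (M : TreeModel T V C R κ) (S : Set.Iic T) : ∃ l, R S.1.1 l ∧ l.Nodup := by
  obtain ⟨S, hS⟩ := S
  have hS' : Relation.ReflTransGen IsBlowUp T S := hS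
  induction hS' with
  | refl => exact ⟨[], M.top, List.nodup_nil⟩
  | tail h hb ih =>
    obtain ⟨l, hl, hn⟩ := ih h
    obtain ⟨s, hs⟩ := hb
    obtain ⟨b, l', hl', hp⟩ := M.blowUp hl hs
    refine ⟨l', hl', hp.perm.nodup_iff.2 (List.nodup_cons.2 ⟨?_, hn⟩)⟩
    exact M.notMem hl hs hl' fun c => by rw [hp.perm.mem_iff, List.mem_cons]

/-- The list of brackets of an element below `T`. -/
noncomputable def list (M : TreeModel T V C R κ) (S : Set.Iic T) : List (ℕ × ℕ) :=
  (M.exists_list S).choose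

/-- The set of brackets of an element below `T`. -/
noncomputable def brackets (M : TreeModel T V C R κ) (S : Set.Iic T) : Finset (ℕ × ℕ) :=
  (M.list S).toFinset

theorem rel_list (M : TreeModel T V C R κ) (S : Set.Iic T) : R S.1.1 (M.list S) :=
  (M.exists_list S).choose_spec.1

theorem nodup_list (M : TreeModel T V C R κ) (S : Set.Iic T) : (M.list S).Nodup :=
  (M.exists_list S).choose_spec.2

theorem brackets_injective (M : TreeModel T V C R κ) : Function.Injective M.brackets := by
  intro S S' h
  refine Subtype.ext (Subtype.ext (M.inj (M.rel_list S) (M.rel_list S') fun b => ?_))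
  rw [← List.mem_toFinset, ← List.mem_toFinset]
  exact Finset.ext_iff.1 h b

theorem isSimplex_brackets (M : TreeModel T V C R κ) (S : Set.Iic T) :
    IsSimplex V C (M.brackets S) := M.simplex (M.rel_list S)

/-- Up to the rescaling of generators by `sortSign`, the coefficient is that of exterior
multiplication by `κ b • b` from the left: `orderSign b c` counts the brackets which `b` has to
pass. -/
theorem brackets_of_isBlowUp (M : TreeModel T V C R κ) {S S' : Set.Iic T}
    (h : IsBlowUp S.1 S'.1) : ∃ b ∉ M.brackets S, M.brackets S' = insert b (M.brackets S) ∧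
      blowUpSum S.1 S'.1 = κ b * (∏ c ∈ M.brackets S, orderSign b c) *
        (sortSign (M.list S) * sortSign (M.list S')) := by
  obtain ⟨s, hs⟩ := h
  obtain ⟨b, l', hl', hp⟩ := M.blowUp (M.rel_list S) hs
  rw [← M.det (M.rel_list S') hl'] at hp
  refine ⟨b, ?_, ?_, ?_⟩
  · rw [brackets, List.mem_toFinset]
    exact M.notMem (M.rel_list S) hs (M.rel_list S') fun c => by
      rw [hp.perm.mem_iff, List.mem_cons]
  · ext c
    simp only [brackets, List.mem_toFinset, Finset.mem_insert, hp.perm.mem_iff, List.mem_cons]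
  · have h1 := hp.sortSign_eq (M.nodup_list S')
    rw [sortSign, ← List.prod_toFinset _ (M.nodup_list S)] at h1
    have h2 := sortSign_mul_self (M.list S)
    have h3 := hp.mul_self
    have h4 := M.sign b
    rw [blowUpSum_apply hs, brackets]
    have h5 : ∀ y, orderSign b y * orderSign b y = 1 := orderSign_mul_self b
    have h6 : (∏ c ∈ (M.list S).toFinset, orderSign b c) *
        (∏ c ∈ (M.list S).toFinset, orderSign b c) = 1 := by
      rw [← Finset.prod_mul_distrib]
      exact Finset.prod_eq_one fun c _ => h5 c
    rw [h1]
    generalize (∏ c ∈ (M.list S).toFinset, orderSign b c) = q at *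
    simp only at h3 ⊢
    -- All the signs involved square to one, so they can be inserted in pairs.
    calc s = s * (q * q) * (sortSign (M.list S) * sortSign (M.list S)) * (κ b * κ b) := by
          rw [h6, h2, h4]; ring
      _ = _ := by ring

theorem exists_isBlowUp (M : TreeModel T V C R κ) (S : Set.Iic T) {b : ℕ × ℕ}
    (hb : b ∉ M.brackets S) (h : IsSimplex V C (insert b (M.brackets S))) :
    ∃ S' : Set.Iic T, IsBlowUp S.1 S'.1 ∧ M.brackets S' = insert b (M.brackets S) := by
  rw [brackets, List.mem_toFinset] at hb
  obtain ⟨p, hp, l', hl', hmem⟩ := M.exists_blowUp (M.rel_list S) hb h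
  have hbl : IsBlowUp S.1 ⟨p.2, S.1.2.blowUp hp⟩ := ⟨p.1, hp⟩
  let S' : Set.Iic T := ⟨⟨p.2, S.1.2.blowUp hp⟩,
    Relation.ReflTransGen.tail (show Relation.ReflTransGen IsBlowUp T S.1 from S.2) hbl⟩
  refine ⟨S', hbl, ?_⟩
  ext c
  rw [brackets, M.det (M.rel_list S') hl']
  simp [brackets, hmem]

theorem isBlowUp_iff (M : TreeModel T V C R κ) {S S' : Set.Iic T} :
    IsBlowUp S.1 S'.1 ↔ ∃ b ∉ M.brackets S, M.brackets S' = insert b (M.brackets S) := by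
  constructor
  · intro h
    obtain ⟨b, h1, h2, -⟩ := M.brackets_of_isBlowUp h
    exact ⟨b, h1, h2⟩
  · rintro ⟨b, h1, h2⟩
    obtain ⟨S'', h3, h4⟩ := M.exists_isBlowUp S h1 (h2 ▸ M.isSimplex_brackets S')
    rwa [M.brackets_injective (h2.trans h4.symm)]

/-- Conversely to the evident direction, the missing brackets can be added one at a time, since
every subset of a simplex is a simplex. -/
theorem le_iff (M : TreeModel T V C R κ) {S S' : Set.Iic T} :
    S' ≤ S ↔ M.brackets S ⊆ M.brackets S' := by
  constructor
  · obtain ⟨S', hS'⟩ := S'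
    intro h
    have h' : Relation.ReflTransGen IsBlowUp S.1 S' := h
    clear h
    induction h' with
    | refl => exact subset_rfl
    | @tail S₁ S₂ h hb ih =>
      have h₁ : S₁ ≤ T := le_trans (show S₁ ≤ S.1 from h) S.2
      obtain ⟨b, -, h3, -⟩ := M.brackets_of_isBlowUp (S := ⟨S₁, h₁⟩) (S' := ⟨S₂, hS'⟩) hb
      rw [h3]
      exact (ih h₁).trans (Finset.subset_insert _ _)
  · intro h
    induction hk : (M.brackets S' \ M.brackets S).card generalizing S with
    | zero =>
      rw [Finset.card_eq_zero, Finset.sdiff_eq_empty_iff_subset] at hk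
      exact (M.brackets_injective (subset_antisymm h hk)).ge
    | succ k ih =>
      obtain ⟨b, hb⟩ := Finset.card_pos.1 (hk.symm ▸ Nat.succ_pos k :
        0 < (M.brackets S' \ M.brackets S).card)
      rw [Finset.mem_sdiff] at hb
      obtain ⟨S'', h1, h2⟩ := M.exists_isBlowUp S hb.2 ((M.isSimplex_brackets S').subset
        (Finset.insert_subset hb.1 h))
      refine (ih (S := S'') (h2 ▸ Finset.insert_subset hb.1 h) ?_).trans
        (Relation.ReflTransGen.single h1)
      rw [h2, Finset.sdiff_insert, Finset.card_erase_of_mem (Finset.mem_sdiff.2 hb), hk]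
      rfl

theorem exists_brackets_eq (M : TreeModel T V C R κ) (A : Finset (ℕ × ℕ))
    (hA : IsSimplex V C A) : ∃ S, M.brackets S = A := by
  induction A using Finset.induction_on with
  | empty =>
    refine ⟨⟨T, le_refl T⟩, ?_⟩
    rw [brackets, M.det (M.rel_list _) M.top, List.toFinset_nil]
  | insert b A hb ih =>
    obtain ⟨S, rfl⟩ := ih (hA.subset (Finset.subset_insert _ _))
    obtain ⟨S', -, h⟩ := M.exists_isBlowUp S hb hA
    exact ⟨S', h⟩

/-- Two blow-ups at different places anticommute. -/
theorem blowUpSum_mul (M : TreeModel T V C R κ) {S S₁ S₂ S' : Set.Iic T} (h₁ : IsBlowUp S.1 S₁.1)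
    (h₂ : IsBlowUp S.1 S₂.1) (k₁ : IsBlowUp S₁.1 S'.1) (k₂ : IsBlowUp S₂.1 S'.1) (hne : S₁ ≠ S₂) :
    blowUpSum S.1 S₁.1 * blowUpSum S₁.1 S'.1 =
      -(blowUpSum S.1 S₂.1 * blowUpSum S₂.1 S'.1) := by
  obtain ⟨b, hb, hb', eb⟩ := M.brackets_of_isBlowUp h₁
  obtain ⟨c, hc, hc', ec⟩ := M.brackets_of_isBlowUp h₂
  obtain ⟨c₁, hc₁, hc₁', ec₁⟩ := M.brackets_of_isBlowUp k₁
  obtain ⟨b₁, hb₁, hb₁', eb₁⟩ := M.brackets_of_isBlowUp k₂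
  have hbc : b ≠ c := by
    rintro rfl
    exact hne (M.brackets_injective (hb'.trans hc'.symm))
  rw [hb'] at hc₁ hc₁'
  rw [hc'] at hb₁ hb₁'
  have hcc : c₁ = c := by
    have : c ∈ insert c₁ (insert b (M.brackets S)) := by rw [← hc₁', hb₁']; simp
    simp only [Finset.mem_insert] at this
    rcases this with h | h | h
    · exact h.symm
    · exact absurd h.symm hbc
    · exact absurd h hc
  have hbb : b₁ = b := by
    have : b ∈ insert b₁ (insert c (M.brackets S)) := by rw [← hb₁', hc₁']; simp
    simp only [Finset.mem_insert] at this
    rcases this with h | h | h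
    · exact h.symm
    · exact absurd h hbc
    · exact absurd h hb
  subst hcc hbb
  -- Only the factor comparing `b` with `c` depends on which of the two is added first, and it
  -- changes sign.
  rw [eb, ec, ec₁, eb₁, hb', hc', Finset.prod_insert hb, Finset.prod_insert hc,
    orderSign_swap hbc]
  have e1 := sortSign_mul_self (M.list S₁)
  have e2 := sortSign_mul_self (M.list S₂)
  generalize sortSign (M.list S₁) = u₁ at *
  generalize sortSign (M.list S₂) = u₂ at *
  linear_combination (-orderSign b₁ c₁ * κ c₁ * κ b₁ * (∏ c ∈ M.brackets S, orderSign b₁ c) *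
    (∏ c ∈ M.brackets S, orderSign c₁ c) * sortSign (M.list S) * sortSign (M.list S')) * (e1 - e2)

/-- Two elements with a common blow-up are blow-ups of a common element. -/
theorem exists_common (M : TreeModel T V C R κ) {S₁ S₂ S' : Set.Iic T}
    (k₁ : IsBlowUp S₁.1 S'.1) (k₂ : IsBlowUp S₂.1 S'.1) (hne : S₁ ≠ S₂) :
    ∃ S : Set.Iic T, IsBlowUp S.1 S₁.1 ∧ IsBlowUp S.1 S₂.1 := by
  obtain ⟨b, hb, hb'⟩ := M.isBlowUp_iff.1 k₁
  obtain ⟨c, hc, hc'⟩ := M.isBlowUp_iff.1 k₂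
  have hbc : b ≠ c := by
    rintro rfl
    refine hne (M.brackets_injective ?_)
    rw [← Finset.erase_insert hb, ← hb', hc', Finset.erase_insert hc]
  have hc₁ : c ∈ M.brackets S₁ := by
    have : c ∈ insert b (M.brackets S₁) := by rw [← hb', hc']; simp
    exact (Finset.mem_insert.1 this).resolve_left hbc.symm
  have hb₂ : b ∈ M.brackets S₂ := by
    have : b ∈ insert c (M.brackets S₂) := by rw [← hc', hb']; simp
    exact (Finset.mem_insert.1 this).resolve_left hbc
  -- The common element has the brackets common to `S₁` and `S₂`.
  obtain ⟨S, hS⟩ := M.exists_brackets_eq ((M.brackets S₁).erase c)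
    ((M.isSimplex_brackets S₁).subset (Finset.erase_subset _ _))
  refine ⟨S, M.isBlowUp_iff.2 ⟨c, by simp [hS], by rw [hS, Finset.insert_erase hc₁]⟩,
    M.isBlowUp_iff.2 ⟨b, by simp [hS, hb], ?_⟩⟩
  rw [hS, ← Finset.erase_insert hc, ← hc', hb', Finset.erase_insert_of_ne hbc]

/-- Blow-ups which can be done one after the other can be exchanged. -/
theorem exists_exchange (M : TreeModel T V C R κ) {S S₁ S' : Set.Iic T}
    (h₁ : IsBlowUp S.1 S₁.1) (k₁ : IsBlowUp S₁.1 S'.1) :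
    ∃ S₂ : Set.Iic T, S₂ ≠ S₁ ∧ IsBlowUp S.1 S₂.1 ∧ IsBlowUp S₂.1 S'.1 ∧
      ∀ S₃ : Set.Iic T, IsBlowUp S.1 S₃.1 → IsBlowUp S₃.1 S'.1 → S₃ = S₁ ∨ S₃ = S₂ := by
  obtain ⟨b, hb, hb'⟩ := M.isBlowUp_iff.1 h₁
  obtain ⟨c, hc, hc'⟩ := M.isBlowUp_iff.1 k₁
  rw [hb'] at hc hc'
  simp only [Finset.mem_insert, not_or] at hc
  -- Adding the second bracket first gives the only other intermediate element.
  obtain ⟨S₂, hS₂⟩ := M.exists_brackets_eq (insert c (M.brackets S))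
    ((M.isSimplex_brackets S').subset (hc' ▸ Finset.insert_subset_insert _
      (Finset.subset_insert _ _)))
  refine ⟨S₂, ?_, M.isBlowUp_iff.2 ⟨c, hc.2, hS₂⟩, M.isBlowUp_iff.2 ⟨b, ?_, ?_⟩, ?_⟩
  · rintro rfl
    have : c ∈ insert b (M.brackets S) := by rw [← hb', hS₂]; simp
    simp [hc] at this
  · simp [hS₂, hb, Ne.symm hc.1]
  · rw [hc', hS₂, Finset.insert_comm]
  · intro S₃ h₃ k₃
    obtain ⟨d, hd, hd'⟩ := M.isBlowUp_iff.1 h₃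
    obtain ⟨e, -, he'⟩ := M.isBlowUp_iff.1 k₃
    have : d ∈ insert c (insert b (M.brackets S)) := by rw [← hc', he', hd']; simp
    simp only [Finset.mem_insert] at this
    rcases this with rfl | rfl | h
    · exact Or.inr (M.brackets_injective (hd'.trans hS₂.symm))
    · exact Or.inl (M.brackets_injective (hd'.trans hb'.symm))
    · exact absurd h hd

end TreeModel


/-! ### The subcomplex below an element -/

section Below

variable {I : List Colour} {x : Colour} (T : Tr I x)

/-- The basis of the subcomplex below `T` given by the elements below `T`. -/
noncomputable def belowBasis : Module.Basis (Set.Iic T) ℤ (below T) :=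
  Module.Basis.mk (v := belowGen T)
    (LinearIndependent.of_comp (below T).subtype
      ((Finsupp.linearIndependent_single_one ℤ (Tr I x)).comp _ Subtype.val_injective))
    (by
      rintro ⟨c, hc⟩ -
      induction hc using Submodule.span_induction with
      | mem c hc =>
        obtain ⟨S, hS, rfl⟩ := hc
        exact Submodule.subset_span ⟨⟨S, hS⟩, rfl⟩
      | zero => exact Submodule.zero_mem _
      | add a b ha hb ha' hb' => exact Submodule.add_mem _ ha' hb'
      | smul r a ha ha' => exact Submodule.smul_mem _ r ha')

theorem belowBasis_apply (S : Set.Iic T) : belowBasis T S = belowGen T S :=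
  Module.Basis.mk_apply _ _ S

/-- The matrix of the differential. -/
noncomputable def belowCoeff (S S' : Set.Iic T) : ℤ :=
  ((shift I x).negOnePow : ℤ) * blowUpSum S.1 S'.1

theorem belowDifferential_gen [Fintype (Set.Iic T)] (S : Set.Iic T) :
    belowDifferential T (belowGen T S) = ∑ S', belowCoeff T S S' • belowGen T S' := by
  classical
  apply Subtype.ext
  have h1 : (belowDifferential T (belowGen T S) : RBr I x) =
      ((shift I x).negOnePow : ℤ) • blowUpSum S.1 := by
    change differential I x (gen S.1) = _
    simp only [differential, gen, Finsupp.linearCombination_single, one_smul]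
  rw [h1]
  have h2 : ((∑ S', belowCoeff T S S' • belowGen T S' : below T) : RBr I x) =
      ∑ S' : Set.Iic T, belowCoeff T S S' • gen S'.1 := by
    rw [AddSubmonoidClass.coe_finsetSum]
    rfl
  rw [h2]
  refine Finsupp.ext fun R => ?_
  rw [Finsupp.smul_apply, Finsupp.finsetSum_apply, smul_eq_mul]
  by_cases hR : R ≤ T
  · rw [Finset.sum_eq_single (⟨R, hR⟩ : Set.Iic T)]
    · simp [belowCoeff, gen]
    · intro S' _ hne
      rw [Finsupp.smul_apply, gen, Finsupp.single_eq_of_ne, smul_zero]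
      rintro rfl
      exact hne rfl
    · intro h
      exact absurd (Finset.mem_univ _) h
  · rw [blowUpSum_apply_eq_zero, mul_zero, Finset.sum_eq_zero]
    · intro S' _
      rw [Finsupp.smul_apply, gen, Finsupp.single_eq_of_ne, smul_zero]
      rintro rfl
      exact hR S'.2
    · intro hb
      exact hR ((show R ≤ S.1 from Relation.ReflTransGen.single hb).trans S.2)

end Below

-- The square of the differential and the comparison with cellular chains

namespace TreeModel

variable {I : List Colour} {x : Colour} {T : Tr I x} {V : ℕ × ℕ → Prop}
  {C : ℕ × ℕ → ℕ × ℕ → Prop} {R : PreTree → List (ℕ × ℕ) → Prop} {κ : ℕ × ℕ → ℤ}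

theorem negOnePow_mul_self (k : ℤ) : (k.negOnePow : ℤ) * (k.negOnePow : ℤ) = 1 := by
  rw [← Units.val_mul, Int.units_mul_self, Units.val_one]

theorem belowCoeff_eq_zero {S S' : Set.Iic T} (h : ¬ IsBlowUp S.1 S'.1) :
    belowCoeff T S S' = 0 := by
  rw [belowCoeff, blowUpSum_apply_eq_zero h, mul_zero]

theorem belowCoeff_mul (M : TreeModel T V C R κ) {S S₁ S₂ S' : Set.Iic T}
    (h₁ : IsBlowUp S.1 S₁.1) (h₂ : IsBlowUp S.1 S₂.1) (k₁ : IsBlowUp S₁.1 S'.1)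
    (k₂ : IsBlowUp S₂.1 S'.1) (hne : S₁ ≠ S₂) :
    belowCoeff T S S₁ * belowCoeff T S₁ S' = -(belowCoeff T S S₂ * belowCoeff T S₂ S') := by
  unfold belowCoeff
  rw [mul_mul_mul_comm, M.blowUpSum_mul h₁ h₂ k₁ k₂ hne]
  ring

theorem belowCoeff_mul_self (M : TreeModel T V C R κ) {S S' : Set.Iic T}
    (h : IsBlowUp S.1 S'.1) : belowCoeff T S S' * belowCoeff T S S' = 1 := by
  obtain ⟨s, hs⟩ := id h
  obtain ⟨b, l', hl', hp⟩ := M.blowUp (M.rel_list S) hs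
  have h1 := hp.mul_self
  have h2 := M.sign b
  rw [belowCoeff, mul_mul_mul_comm, negOnePow_mul_self, one_mul, blowUpSum_apply hs]
  simp only at h1
  linear_combination h1 - s * s * h2

/-- Paths of two blow-ups with given ends come in pairs with opposite signs. -/
theorem belowDifferential_comp (M : TreeModel T V C R κ) [Finite (Set.Iic T)] :
    belowDifferential T ∘ₗ belowDifferential T = 0 := by
  classical
  have := Fintype.ofFinite (Set.Iic T)
  refine (belowBasis T).ext fun S => ?_
  rw [belowBasis_apply, LinearMap.comp_apply, belowDifferential_gen, map_sum]
  simp only [map_smul, belowDifferential_gen, Finset.smul_sum, smul_smul]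
  rw [Finset.sum_comm, LinearMap.zero_apply]
  refine Finset.sum_eq_zero fun S' _ => ?_
  rw [← Finset.sum_smul]
  convert zero_smul ℤ _
  by_cases h : ∃ S₁ : Set.Iic T, IsBlowUp S.1 S₁.1 ∧ IsBlowUp S₁.1 S'.1
  · obtain ⟨S₁, h₁, k₁⟩ := h
    obtain ⟨S₂, hne, h₂, k₂, huniq⟩ := M.exists_exchange h₁ k₁
    rw [← Finset.sum_subset (Finset.subset_univ {S₁, S₂}), Finset.sum_pair hne.symm,
      M.belowCoeff_mul h₁ h₂ k₁ k₂ hne.symm, neg_add_cancel]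
    intro S₃ _ h3
    by_contra h0
    have h₃ : IsBlowUp S.1 S₃.1 := by
      by_contra h'
      exact h0 (by rw [belowCoeff_eq_zero h', zero_mul])
    have k₃ : IsBlowUp S₃.1 S'.1 := by
      by_contra h'
      exact h0 (by rw [belowCoeff_eq_zero h', mul_zero])
    rcases huniq S₃ h₃ k₃ with rfl | rfl <;> simp at h3
  · refine Finset.sum_eq_zero fun S₁ _ => ?_
    by_cases h₁ : IsBlowUp S.1 S₁.1
    · rw [belowCoeff_eq_zero fun k₁ => h ⟨S₁, h₁, k₁⟩, mul_zero]
    · rw [belowCoeff_eq_zero h₁, zero_mul]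

/-- The elements below `T` correspond to the simplices. -/
noncomputable def equiv (M : TreeModel T V C R κ) : Set.Iic T ≃ {A // IsSimplex V C A} :=
  Equiv.ofBijective (fun S => ⟨M.brackets S, M.isSimplex_brackets S⟩)
    ⟨fun _ _ h => M.brackets_injective (congrArg Subtype.val h), fun A => by
      obtain ⟨S, hS⟩ := M.exists_brackets_eq A.1 A.2
      exact ⟨S, Subtype.ext hS⟩⟩

theorem degree_le_of_le {S S' : Tr I x} (h : S' ≤ S) : S'.degree ≤ S.degree := by
  have h' : Relation.ReflTransGen IsBlowUp S S' := h
  clear h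
  induction h' with
  | refl => exact le_rfl
  | tail _ hb ih =>
    have := hb.degree
    omega

/-- Every blow-up lowers the degree by one, so a difference of one leaves room for a single blow-up.
-/
theorem _root_.RelBrace.isBlowUp_of_le {S S' : Tr I x} (h : S' ≤ S)
    (hd : S.degree = S'.degree + 1) : IsBlowUp S S' := by
  have h' : Relation.ReflTransGen IsBlowUp S S' := h
  rcases Relation.ReflTransGen.cases_head h' with rfl | ⟨S₁, h1, h2⟩
  · omega
  · rcases Relation.ReflTransGen.cases_head h2 with rfl | ⟨S₂, h3, h4⟩
    · exact h1
    · have := h1.degree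
      have := h3.degree
      have := degree_le_of_le (show S' ≤ S₂ from h4)
      omega

/-- Along a blow-up the dimension falls by at least one and the degree by exactly one. Descending
from `T`, where they agree, bounds the dimension by the degree; continuing down to degree zero,
where the dimension is not negative, gives the opposite bound. -/
theorem dim_eq_degree {E : Type*} [NormedAddCommGroup E] [NormedSpace ℝ E]
    [FiniteDimensional ℝ E] {P : Set E} (hP : P.Nonempty)
    (hdim : (Module.finrank ℝ (vectorSpan ℝ P) : ℤ) = T.degree) (e : Set.Iic T ≃o Face P)
    (S : Set.Iic T) : S.1.degree = (e S).dim := by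
  have hlt : ∀ {S S' : Set.Iic T}, IsBlowUp S.1 S'.1 → (e S').dim < (e S).dim := by
    intro S S' h
    refine Face.dim_lt (e.lt_iff_lt.2 (lt_of_le_not_ge ?_ fun h' => ?_))
    · exact Relation.ReflTransGen.single h
    · have := h.degree
      have := degree_le_of_le (show S.1 ≤ S'.1 from h')
      omega
  -- An isomorphism of posets matches the largest elements.
  have htop : e ⟨T, le_refl T⟩ = topFace hP := by
    refine le_antisymm (Face.subset _) ?_
    obtain ⟨S, hS⟩ := e.surjective (topFace hP)
    rw [← hS]
    exact e.le_iff_le.2 S.2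
  refine le_antisymm ?_ ?_
  -- An element of positive degree has a blow-up, so the induction reaches degree zero.
  · have key : ∀ k : ℕ, ∀ S : Set.Iic T, S.1.degree = k → (k : ℤ) ≤ (e S).dim := by
      intro k
      induction k with
      | zero => intro S _; simp
      | succ k ih =>
        intro S hS
        obtain ⟨S', hb⟩ := S.1.exists_isBlowUp (by rw [hS]; positivity)
        let S'' : Set.Iic T := ⟨S',
          (show S' ≤ S.1 from Relation.ReflTransGen.single hb).trans S.2⟩
        have h1 := hlt (S := S) (S' := S'') hb
        have h2 := hb.degree
        have h3 := ih S'' (by change S'.degree = k; push_cast at hS; omega)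
        push_cast
        omega
    have h0 := S.1.degree_nonneg.1
    have := key S.1.degree.toNat S (by omega)
    omega
  · obtain ⟨S, hS⟩ := S
    have hS' : Relation.ReflTransGen IsBlowUp T S := hS
    induction hS' with
    | refl =>
      rw [htop]
      exact hdim.le
    | @tail S₁ S₂ h hb ih =>
      have h1 := hlt (S := ⟨S₁, h⟩) (S' := ⟨S₂, hS⟩) hb
      have h2 := hb.degree
      have h3 := ih h
      simp only at h3 ⊢
      omega

/-- With degrees equal to dimensions, blow-ups are exactly the pairs of a face and a facet. The
product of tree coefficient and incidence number then satisfies the hypotheses of `exists_gauge`,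
with the number of brackets as rank. -/
theorem givesCellularChains (M : TreeModel T V C R κ) {E : Type*} [NormedAddCommGroup E]
    [NormedSpace ℝ E] [FiniteDimensional ℝ E] {P : Set E} (hP : P.Nonempty)
    (hdim : (Module.finrank ℝ (vectorSpan ℝ P) : ℤ) = T.degree)
    (hfin : Finite {A : Finset (ℕ × ℕ) // IsSimplex V C A})
    (g : Face P ≃ {A : Finset (ℕ × ℕ) // IsSimplex V C A})
    (hg : ∀ F G, F ≤ G ↔ (g G).1 ⊆ (g F).1) : GivesCellularChains T P := by
  classical
  have : Finite (Set.Iic T) := Finite.of_equiv _ M.equiv.symm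
  have : Finite (Face P) := Finite.of_equiv _ g.symm
  have := Fintype.ofFinite (Set.Iic T)
  have := Fintype.ofFinite (Face P)
  refine ⟨M.belowDifferential_comp, fun o => ?_⟩
  let e : Set.Iic T ≃o Face P :=
    { toEquiv := M.equiv.trans g.symm
      map_rel_iff' := fun {S S'} => by
        rw [hg, M.le_iff]
        simp [equiv]
        exact Iff.rfl }
  have hdeg := dim_eq_degree hP hdim e
  have hstep : ∀ {S S' : Set.Iic T}, IsBlowUp S.1 S'.1 →
      e S' ≤ e S ∧ (e S).dim = (e S').dim + 1 := by
    intro S S' h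
    refine ⟨e.le_iff_le.2 (Relation.ReflTransGen.single h), ?_⟩
    have h1 := h.degree
    rw [hdeg, hdeg] at h1
    exact_mod_cast h1
  have hinc : ∀ {S S' : Set.Iic T}, ¬ IsBlowUp S.1 S'.1 → incidence o (e S) (e S') = 0 := by
    intro S S' h
    rw [incidence, dif_neg]
    rintro ⟨h1, h2⟩
    refine h (isBlowUp_of_le (e.le_iff_le.1 h1) ?_)
    rw [hdeg, hdeg, h2]
    push_cast
    rfl
  have hinc2 : ∀ {S S' : Set.Iic T}, IsBlowUp S.1 S'.1 →
      incidence o (e S) (e S') * incidence o (e S) (e S') = 1 := by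
    intro S S' h
    obtain ⟨h1, h2⟩ := hstep h
    exact Int.isUnit_mul_self (incidence_isUnit o h1 h2)
  obtain ⟨u, hu⟩ := exists_gauge (X := Set.Iic T) (fun S => (M.brackets S).card)
    (fun S S' => IsBlowUp S.1 S'.1) (fun S S' => belowCoeff T S S' * incidence o (e S) (e S'))
    (fun S S' h => by
      obtain ⟨b, hb, hb'⟩ := M.isBlowUp_iff.1 h
      rw [hb', Finset.card_insert_of_notMem hb])
    (fun S S' h => by rw [mul_mul_mul_comm, M.belowCoeff_mul_self h, hinc2 h, one_mul])
    (fun S₁ S₂ S' k₁ k₂ hne => by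
      obtain ⟨S, h₁, h₂⟩ := M.exists_common k₁ k₂ hne
      refine ⟨S, h₁, h₂, ?_⟩
      have e1 := M.belowCoeff_mul h₁ h₂ k₁ k₂ hne
      have e2 := incidence_diamond o (hstep h₁).1 (hstep h₂).1 (hstep k₁).1 (hstep k₂).1
        (fun h => hne (e.injective h)) (hstep h₁).2 (hstep h₂).2 (hstep k₁).2 (hstep k₂).2
      calc _ = (belowCoeff T S S₁ * belowCoeff T S₁ S') *
            (incidence o (e S) (e S₁) * incidence o (e S₁) (e S')) := by ring
        _ = _ := by rw [e1, e2]; ring)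
  -- The basis elements are rescaled by the signs `u`, then reindexed by the faces.
  let B := (belowBasis T).unitsSMul u
  have hB : ∀ S, B S = u S • belowGen T S := fun S => by
    rw [Module.Basis.unitsSMul_apply, belowBasis_apply]
  let Φ : below T ≃ₗ[ℤ] (Face P →₀ ℤ) := B.repr ≪≫ₗ Finsupp.domLCongr e.toEquiv
  have hΦ : ∀ S, Φ (belowGen T S) = Finsupp.single (e S) (u S : ℤ) := by
    intro S
    have h1 : belowGen T S = (u S : ℤ) • B S := by
      rw [hB, Units.smul_def, smul_smul, ← Units.val_mul, Int.units_mul_self, Units.val_one,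
        one_smul]
    rw [h1, map_smul]
    simp [Φ]
  refine ⟨e, Φ, fun c => ?_, fun S => ⟨hdeg S, u S, hΦ S⟩⟩
  have hmaps : Φ.toLinearMap ∘ₗ belowDifferential T =
      cellularBoundary o ∘ₗ Φ.toLinearMap := by
    refine (belowBasis T).ext fun S => ?_
    rw [belowBasis_apply, LinearMap.comp_apply, LinearMap.comp_apply, LinearEquiv.coe_coe, hΦ,
      belowDifferential_gen, map_sum, cellularBoundary, Finsupp.linearCombination_single,
      finsum_eq_sum_of_fintype, ← e.toEquiv.sum_comp, Finset.smul_sum]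
    refine Finset.sum_congr rfl fun S' _ => ?_
    rw [map_smul, hΦ]
    simp only [Finsupp.smul_single, smul_eq_mul, mul_one]
    congr 1
    by_cases h : IsBlowUp S.1 S'.1
    · rw [hu S S' h]
      -- The sign `u S'` is the coefficient times the incidence number times `u S`, and the
      -- coefficient squares to one.
      linear_combination (incidence o (e S) (e S') * u S) * M.belowCoeff_mul_self h
    · have := hinc h
      rw [belowCoeff_eq_zero h, zero_mul]
      change 0 = _ * incidence o (e S) (e S')
      rw [this, mul_zero]
  exact LinearMap.congr_fun hmaps c

end TreeModel

/-! ### Forests of neutral vertices and leaves -/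

/-- Two intervals of letters, given by their first letter and the letter after their last one, are
nested or disjoint. -/
def Laminar (b c : ℕ × ℕ) : Prop :=
  b.2 ≤ c.1 ∨ c.2 ≤ b.1 ∨ (b.1 ≤ c.1 ∧ c.2 ≤ b.2) ∨ (c.1 ≤ b.1 ∧ b.2 ≤ c.2)

/-- `PlainForest a L c l`: the forest `L` has neutral vertices with at least two inputs, and its
leaves are closed and labelled `a, …, c - 1` from left to right; `l` is the list of the intervals
of leaves above the neutral vertices, in the order of the vertices. -/
inductive PlainForest : ℕ → List RTree → ℕ → List (ℕ × ℕ) → Prop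
  | nil (a : ℕ) : PlainForest a [] a []
  | leaf {a c : ℕ} {L : List RTree} {l : List (ℕ × ℕ)} : PlainForest (a + 1) L c l →
      PlainForest a (.closed a [] :: L) c l
  | node {a b c : ℕ} {K L : List RTree} {k l : List (ℕ × ℕ)} : 2 ≤ K.length →
      PlainForest a K b k → PlainForest b L c l →
      PlainForest a (.neutral K :: L) c ((a, b) :: (k ++ l))

namespace PlainForest

variable {a c x y : ℕ} {L : List RTree} {l : List (ℕ × ℕ)}

theorem add_length_le (h : PlainForest a L c l) : a + L.length ≤ c := by
  induction h with
  | nil => simp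
  | leaf _ ih => simp only [List.length_cons]; omega
  | node _ _ _ ih₁ ih₂ => simp only [List.length_cons]; omega

theorem le (h : PlainForest a L c l) : a ≤ c := by
  have := h.add_length_le
  omega

theorem eq_nil (h : PlainForest a L a l) : L = [] := by
  have := h.add_length_le
  exact List.eq_nil_of_length_eq_zero (by omega)

/-- A neutral vertex has at least two inputs and each of them carries a leaf, whence the `2`. -/
theorem bounds (h : PlainForest a L c l) : ∀ b ∈ l, a ≤ b.1 ∧ b.1 + 2 ≤ b.2 ∧ b.2 ≤ c := by
  induction h with
  | nil => simp
  | leaf h ih =>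
    intro b hb
    have := ih b hb
    omega
  | node hK h₁ h₂ ih₁ ih₂ =>
    intro b hb
    have := h₁.add_length_le
    have := h₂.le
    rw [List.mem_cons, List.mem_append] at hb
    rcases hb with rfl | hb | hb
    · simp only
      omega
    · have := ih₁ b hb
      omega
    · have := ih₂ b hb
      omega

theorem length_eq (h : PlainForest a L c l) : l.length = forestNeutrals L := by
  induction h with
  | nil => rfl
  | leaf _ ih => simpa [forestNeutrals, RTree.neutrals] using ih
  | node _ _ _ ih₁ ih₂ => simp [forestNeutrals, RTree.neutrals, ih₁, ih₂]; omega

theorem le_of_mem_labels (h : PlainForest a L c l) : ∀ i ∈ forestLabels L, a ≤ i := by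
  induction h with
  | nil => simp [forestLabels]
  | leaf _ ih =>
    intro i hi
    simp only [forestLabels, RTree.labels, Multiset.mem_add, Multiset.mem_cons,
      Multiset.notMem_zero, or_false] at hi
    rcases hi with rfl | hi
    · exact le_rfl
    · have := ih i hi
      omega
  | node _ h₁ _ ih₁ ih₂ =>
    intro i hi
    simp only [forestLabels, RTree.labels, Multiset.mem_add] at hi
    rcases hi with hi | hi
    · exact ih₁ i hi
    · exact h₁.le.trans (ih₂ i hi)

theorem append {b : ℕ} {M : List RTree} {m : List (ℕ × ℕ)} (h : PlainForest a L b l)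
    (h' : PlainForest b M c m) : PlainForest a (L ++ M) c (l ++ m) := by
  induction h with
  | nil => exact h'
  | leaf _ ih => exact .leaf (ih h')
  | node hK h₁ _ _ ih => simpa using PlainForest.node hK h₁ (ih h')

theorem split {A B : List RTree} (h : PlainForest a (A ++ B) c l) :
    ∃ b m n, l = m ++ n ∧ PlainForest a A b m ∧ PlainForest b B c n := by
  induction A generalizing a l with
  | nil => exact ⟨a, [], l, rfl, .nil a, h⟩
  | cons t A ih =>
    cases h with
    | leaf h =>
      obtain ⟨b, m, n, rfl, h₁, h₂⟩ := ih h
      exact ⟨b, m, n, rfl, .leaf h₁, h₂⟩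
    | node hK h h' =>
      obtain ⟨b, m, n, rfl, h₁, h₂⟩ := ih h'
      exact ⟨b, _, n, by simp, .node hK h h₁, h₂⟩

theorem det {c' : ℕ} {l' : List (ℕ × ℕ)} (h : PlainForest a L c l) (h' : PlainForest a L c' l') :
    c = c' ∧ l = l' := by
  induction h generalizing c' l' with
  | nil => cases h'; exact ⟨rfl, rfl⟩
  | leaf _ ih =>
    cases h' with
    | leaf h' => exact ih h'
  | node _ _ _ ih₁ ih₂ =>
    cases h' with
    | node _ h₁ h₂ =>
      obtain ⟨rfl, rfl⟩ := ih₁ h₁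
      obtain ⟨rfl, rfl⟩ := ih₂ h₂
      exact ⟨rfl, rfl⟩

theorem whole_notMem (h : PlainForest a L c l) (hL : 2 ≤ L.length) : (a, c) ∉ l := by
  intro hm
  cases h with
  | nil => simp at hL
  | leaf h =>
    have := h.bounds _ hm
    simp only at this
    omega
  | node hK h₁ h₂ =>
    have e1 := h₁.add_length_le
    have e2 := h₂.add_length_le
    simp only [List.length_cons] at hL
    simp only [List.mem_cons, Prod.mk.injEq, List.mem_append] at hm
    rcases hm with hm | hm | hm
    · omega
    · have := h₁.bounds _ hm
      simp only at this
      omega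
    · have := h₂.bounds _ hm
      simp only at this
      omega

/-- A bracket starts at `a` precisely if the first tree is not a leaf, and the longest such bracket
is that of its root. Once the first tree is delimited, the position of a bracket tells whether it
belongs to this tree or to the rest. -/
theorem inj {L' : List RTree} {l' : List (ℕ × ℕ)} (h : PlainForest a L c l)
    (h' : PlainForest a L' c l') (hl : ∀ b, b ∈ l ↔ b ∈ l') : L = L' := by
  induction h generalizing L' l' with
  | nil => exact h'.eq_nil.symm
  | leaf h ih =>
    cases h' with
    | nil => exact absurd h.le (by omega)
    | leaf h' => rw [ih h' hl]
    | node =>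
      have := h.bounds _ ((hl _).2 List.mem_cons_self)
      simp only at this
      omega
  | node hK h₁ h₂ ih₁ ih₂ =>
    rename_i a b c K L k l
    cases h' with
    | nil =>
      have := h₁.add_length_le
      have := h₂.le
      omega
    | leaf h' =>
      have := h'.bounds _ ((hl _).1 List.mem_cons_self)
      simp only at this
      omega
    | node hK' h₁' h₂' =>
      rename_i b' K' L' k' l'
      have e1 := h₁.add_length_le
      have e1' := h₁'.add_length_le
      have hb : b ≤ b' := by
        have := (hl _).1 List.mem_cons_self
        simp only [List.mem_cons, Prod.mk.injEq, List.mem_append] at this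
        rcases this with hm | hm | hm
        · omega
        · exact (h₁'.bounds _ hm).2.2
        · have := h₂'.bounds _ hm
          simp only at this
          omega
      have hb' : b' ≤ b := by
        have := (hl _).2 List.mem_cons_self
        simp only [List.mem_cons, Prod.mk.injEq, List.mem_append] at this
        rcases this with hm | hm | hm
        · omega
        · exact (h₁.bounds _ hm).2.2
        · have := h₂.bounds _ hm
          simp only at this
          omega
      obtain rfl := le_antisymm hb hb'
      have n1 := h₁.whole_notMem hK
      have n1' := h₁'.whole_notMem hK'
      simp only [List.mem_cons, List.mem_append] at hl
      rw [ih₁ h₁' fun d => ?_, ih₂ h₂' fun d => ?_]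
      · constructor
        · intro hd
          have := h₂.bounds d hd
          rcases (hl d).1 (Or.inr (Or.inr hd)) with rfl | h | h
          · simp only at this; omega
          · have := h₁'.bounds d h; omega
          · exact h
        · intro hd
          have := h₂'.bounds d hd
          rcases (hl d).2 (Or.inr (Or.inr hd)) with rfl | h | h
          · simp only at this; omega
          · have := h₁.bounds d h; omega
          · exact h
      · constructor
        · intro hd
          have := h₁.bounds d hd
          rcases (hl d).1 (Or.inr (Or.inl hd)) with rfl | h | h
          · exact absurd hd n1
          · exact h
          · have := h₂'.bounds d h; omega
        · intro hd
          have := h₁'.bounds d hd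
          rcases (hl d).2 (Or.inr (Or.inl hd)) with rfl | h | h
          · exact absurd hd n1'
          · exact h
          · have := h₂.bounds d h; omega

theorem laminar (h : PlainForest a L c l) : ∀ b ∈ l, ∀ d ∈ l, Laminar b d := by
  induction h with
  | nil => simp
  | leaf _ ih => exact ih
  | node hK h₁ h₂ ih₁ ih₂ =>
    intro b hb d hd
    have e1 := h₁.le
    rw [List.mem_cons, List.mem_append] at hb hd
    unfold Laminar
    rcases hb with rfl | hb | hb <;> rcases hd with rfl | hd | hd
    · simp
    · have := h₁.bounds d hd; simp only; omega
    · have := h₂.bounds d hd; simp only; omega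
    · have := h₁.bounds b hb; simp only; omega
    · exact ih₁ b hb d hd
    · have := h₁.bounds b hb; have := h₂.bounds d hd; omega
    · have := h₂.bounds b hb; simp only; omega
    · have := h₁.bounds d hd; have := h₂.bounds b hb; omega
    · exact ih₂ b hb d hd

/-! #### Blow-ups -/

/-- Grouping consecutive trees of a forest under a new neutral vertex. -/
theorem group {A B C : List RTree} (h : PlainForest a (A ++ (B ++ C)) c l) (hB : 2 ≤ B.length) :
    ∃ b l', PlainForest a (A ++ .neutral B :: C) c l' ∧
      SignedPerm (sgn (forestNeutrals A)) l' (b :: l) := by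
  obtain ⟨x, lA, m, rfl, hA, h⟩ := h.split
  obtain ⟨y, lB, lC, rfl, hB', hC⟩ := h.split
  refine ⟨(x, y), _, hA.append (.node hB hB' hC), ?_⟩
  rw [← hA.length_eq]
  exact SignedPerm.move _ _ _

theorem _root_.RelBrace.blowUps_leaf (a : ℕ) : (RTree.closed a []).blowUps = [] := by
  simp [RTree.blowUps, closedRootBlowUps, forestBlowUps, cuts₃, cuts₂]

/-- The new bracket reaches the front by passing one bracket for each neutral vertex that comes
before the new one; the Koszul sign counts the same vertices, so plain forests need no factor `κ`.
-/
theorem blowUp (h : PlainForest a L c l) : ∀ p ∈ forestBlowUps L,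
    ∃ b l', PlainForest a p.2 c l' ∧ SignedPerm p.1 l' (b :: l) := by
  induction h with
  | nil => simp [forestBlowUps]
  | leaf h ih =>
    intro p hp
    simp only [forestBlowUps, blowUps_leaf, List.map_nil, List.nil_append, List.mem_map] at hp
    obtain ⟨q, hq, rfl⟩ := hp
    obtain ⟨b, l', h', hs⟩ := ih q hq
    exact ⟨b, l', .leaf h', hs.of_eq (by simp [sgn, RTree.neutrals, forestNeutrals])⟩
  | node hK h₁ h₂ ih₁ ih₂ =>
    rename_i a b c K L k l
    intro p hp
    simp only [forestBlowUps, RTree.blowUps, neutralRootBlowUps, List.mem_append, List.mem_map,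
      List.mem_filter, mem_cuts₃, decide_eq_true_eq] at hp
    rcases hp with ⟨_, ⟨q, ⟨hq, hl⟩, rfl⟩ | ⟨q, hq, rfl⟩, rfl⟩ | ⟨q, hq, rfl⟩
    · subst hq
      obtain ⟨d, k', h', hs⟩ := h₁.group hl.1
      refine ⟨d, _, .node ?_ h' h₂, (hs.cons_move (a, b)).append_right l⟩
      simp at hl ⊢
      omega
    · obtain ⟨d, k', h', hs⟩ := ih₁ q hq
      refine ⟨d, _, .node ?_ h' h₂, (hs.cons_move (a, b)).append_right l⟩
      rwa [(forestBlowUps_spec _ q hq).2.1]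
    · obtain ⟨d, l', h', hs⟩ := ih₂ q hq
      refine ⟨d, _, .node hK h₁ h', (hs.append_move ((a, b) :: k)).of_eq ?_⟩
      simp [h₁.length_eq, RTree.neutrals]

/-- A position which is interior to no bracket lies between two consecutive trees. -/
theorem exists_split (h : PlainForest a L c l) (hax : a ≤ x) (hxc : x ≤ c)
    (hx : ∀ b ∈ l, ¬(b.1 < x ∧ x < b.2)) :
    ∃ A B m n, L = A ++ B ∧ l = m ++ n ∧ PlainForest a A x m ∧ PlainForest x B c n := by
  induction h with
  | nil a =>
    obtain rfl := le_antisymm hax hxc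
    exact ⟨[], [], [], [], rfl, rfl, .nil _, .nil _⟩
  | leaf h ih =>
    rename_i a c L l
    rcases hax.eq_or_lt with rfl | hax
    · exact ⟨[], _, [], _, rfl, rfl, .nil _, .leaf h⟩
    · obtain ⟨A, B, m, n, rfl, rfl, hA, hB⟩ := ih hax hxc hx
      exact ⟨_, B, m, n, rfl, rfl, .leaf hA, hB⟩
  | node hK h₁ h₂ ih₁ ih₂ =>
    rename_i a b c K L k l
    rcases hax.eq_or_lt with rfl | hax
    · exact ⟨[], _, [], _, rfl, rfl, .nil _, .node hK h₁ h₂⟩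
    · have hbx : b ≤ x := by
        have := hx (a, b) List.mem_cons_self
        simp only at this
        omega
      obtain ⟨A, B, m, n, rfl, rfl, hA, hB⟩ := ih₂ hbx hxc fun d hd => hx d (by simp [hd])
      exact ⟨.neutral K :: A, B, (a, b) :: (k ++ m), n, rfl, by simp, .node hK h₁ hA, hB⟩

/-- The interval of leaves `[x, y)` consists of the leaves of at least two consecutive trees of the
forest, which can be grouped under a new neutral vertex. -/
def Groups (a : ℕ) (L : List RTree) (c : ℕ) (l : List (ℕ × ℕ)) (x y : ℕ) : Prop :=
  ∃ A B C, L = A ++ (B ++ C) ∧ 2 ≤ B.length ∧ (A = [] → C = [] → x = a ∧ y = c) ∧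
    ∃ l', PlainForest a (A ++ .neutral B :: C) c l' ∧ ∀ b, b ∈ l' ↔ b = (x, y) ∨ b ∈ l

/-- An interval that starts with the first tree and goes beyond it ends between two trees, since it
crosses no bracket; the trees it covers are grouped. -/
theorem groups_start {b : ℕ} {t : RTree} {M : List RTree} {k m : List (ℕ × ℕ)}
    (ht : PlainForest x [t] b k) (hM : PlainForest b M c m) (hby : b < y) (hyc : y ≤ c)
    (hm : ∀ d ∈ m, Laminar (x, y) d) : Groups x (t :: M) c (k ++ m) x y := by
  have hxb := ht.add_length_le
  simp only [List.length_singleton] at hxb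
  obtain ⟨B, C, m₁, m₂, rfl, rfl, hB, hC⟩ := hM.exists_split hby.le hyc fun d hd => by
    have h1 := hm d hd
    have h2 := hM.bounds d hd
    unfold Laminar at h1
    simp only at h1
    omega
  have hlen : 2 ≤ (t :: B).length := by
    cases B with
    | nil => cases hB; omega
    | cons => simp
  refine ⟨[], t :: B, C, rfl, hlen, ?_, _, .node hlen (ht.append hB) hC, ?_⟩
  · rintro - rfl
    cases hC
    exact ⟨rfl, rfl⟩
  · intro d
    simp

theorem Groups.cons {b : ℕ} {t : RTree} {M : List RTree} {k m : List (ℕ × ℕ)}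
    (ht : PlainForest a [t] b k) (h : Groups b M c m x y) : Groups a (t :: M) c (k ++ m) x y := by
  obtain ⟨A, B, C, rfl, hB, -, l', h', hl'⟩ := h
  refine ⟨t :: A, B, C, rfl, hB, by simp, _, ht.append h', fun d => ?_⟩
  simp only [List.mem_append, hl']
  tauto

/-- An interval compatible with those of a forest is either the set of leaves of consecutive trees
of the forest or can be obtained from a blow-up. -/
theorem exists_blowUp (h : PlainForest a L c l) (hax : a ≤ x) (hxy : x + 2 ≤ y) (hyc : y ≤ c)
    (hl : ∀ b ∈ l, Laminar (x, y) b) (hn : (x, y) ∉ l) :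
    Groups a L c l x y ∨
    ∃ p ∈ forestBlowUps L, ∃ l', PlainForest a p.2 c l' ∧ ∀ b, b ∈ l' ↔ b = (x, y) ∨ b ∈ l := by
  have tail : ∀ {a b c : ℕ} {t : RTree} {M : List RTree} {k m : List (ℕ × ℕ)},
      PlainForest a [t] b k → (∃ p ∈ forestBlowUps M, ∃ l', PlainForest b p.2 c l' ∧
        ∀ b, b ∈ l' ↔ b = (x, y) ∨ b ∈ m) →
      ∃ p ∈ forestBlowUps (t :: M), ∃ l', PlainForest a p.2 c l' ∧
        ∀ b, b ∈ l' ↔ b = (x, y) ∨ b ∈ k ++ m := by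
    rintro a b c t M k m ht ⟨p, hp, l', h', hl'⟩
    refine ⟨(sgn t.neutrals * p.1, t :: p.2), ?_, _, ht.append h', fun d => ?_⟩
    · rw [forestBlowUps, List.mem_append]
      exact Or.inr (List.mem_map.2 ⟨p, hp, rfl⟩)
    · simp only [List.mem_append, hl']
      tauto
  induction h with
  | nil => omega
  | leaf h ih =>
    rename_i a c L l
    have ht : PlainForest a [.closed a []] (a + 1) [] := .leaf (.nil _)
    rcases hax.eq_or_lt with hax' | hax'
    · subst hax'
      exact Or.inl (groups_start ht h (by omega) hyc hl)
    · exact (ih hax' hyc hl hn).imp (Groups.cons ht) (tail ht)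
  | node hK h₁ h₂ ih₁ ih₂ =>
    rename_i a b c K L k l
    have ht : PlainForest a [.neutral K] b ((a, b) :: k) := by
      simpa using PlainForest.node hK h₁ (.nil b)
    simp only [List.mem_cons, List.mem_append, not_or, Prod.mk.injEq] at hl hn
    rcases Nat.lt_or_ge x b with hxb | hbx
    · rcases Nat.lt_or_ge b y with hby | hyb
      · have h1 := hl (a, b) (Or.inl rfl)
        unfold Laminar at h1
        simp only at h1
        -- The interval meets the first tree without being contained in it, so it contains that
        -- tree.
        have hax' : a = x := by omega
        subst hax'
        exact Or.inl (groups_start ht h₂ hby hyc fun d hd => hl d (Or.inr (Or.inr hd)))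
      · right
        obtain ⟨s, K', k', hs, hK', h', hk'⟩ : ∃ s K' k',
            (s, RTree.neutral K') ∈ (RTree.neutral K).blowUps ∧ 2 ≤ K'.length ∧
              PlainForest a K' b k' ∧ ∀ b, b ∈ k' ↔ b = (x, y) ∨ b ∈ k := by
          rcases ih₁ hax hyb (fun d hd => hl d (Or.inr (Or.inl hd))) hn.2.1 with
            ⟨A, B, C, rfl, hB, hwhole, k', h', hk'⟩ | ⟨p, hp, k', h', hk'⟩
          · refine ⟨-sgn (forestNeutrals A), A ++ .neutral B :: C, k', ?_, ?_, h', hk'⟩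
            · rw [RTree.blowUps, neutralRootBlowUps, List.mem_append, List.mem_map]
              refine Or.inl ⟨(A, B, C), List.mem_filter.2 ⟨mem_cuts₃.2 rfl, ?_⟩, rfl⟩
              simp only [List.length_append, decide_eq_true_eq]
              refine ⟨hB, ?_⟩
              -- Grouping all inputs of the vertex is not a blow-up, but it would only repeat the
              -- bracket `(a, b)` already present.
              by_contra hlt
              exact hn.1 (hwhole (List.eq_nil_of_length_eq_zero (by omega))
                (List.eq_nil_of_length_eq_zero (by omega)))
            · simp only [List.length_append, List.length_cons]
              by_contra hlt
              exact hn.1 (hwhole (List.eq_nil_of_length_eq_zero (by omega))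
                (List.eq_nil_of_length_eq_zero (by omega)))
          · refine ⟨-p.1, p.2, k', ?_, by rwa [(forestBlowUps_spec _ p hp).2.1], h', hk'⟩
            rw [RTree.blowUps, List.mem_append]
            exact Or.inr (List.mem_map.2 ⟨p, hp, rfl⟩)
        refine ⟨(s, .neutral K' :: L), ?_, _, .node hK' h' h₂, fun d => ?_⟩
        · rw [forestBlowUps, List.mem_append]
          exact Or.inl (List.mem_map.2 ⟨_, hs, rfl⟩)
        · simp only [List.mem_cons, List.mem_append, hk']
          rw [or_assoc, or_left_comm]
    · have := (ih₂ hbx hyc (fun d hd => hl d (Or.inr (Or.inr hd))) hn.2.2).imp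
        (Groups.cons ht) (tail ht)
      simpa using this

end PlainForest

theorem mem_forestBlowUps_append {L M : List RTree} {p : ℤ × List RTree} :
    p ∈ forestBlowUps (L ++ M) ↔ (∃ q ∈ forestBlowUps L, p = (q.1, q.2 ++ M)) ∨
      ∃ q ∈ forestBlowUps M, p = (sgn (forestNeutrals L) * q.1, L ++ q.2) := by
  induction L generalizing p with
  | nil => simp [forestBlowUps, forestNeutrals, sgn]
  | cons t L ih =>
    simp only [List.cons_append, forestBlowUps, List.mem_append, List.mem_map, ih,
      forestNeutrals]
    constructor
    · rintro (⟨q, hq, rfl⟩ | ⟨_, ⟨q, hq, rfl⟩ | ⟨q, hq, rfl⟩, rfl⟩)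
      · exact Or.inl ⟨_, Or.inl ⟨q, hq, rfl⟩, rfl⟩
      · exact Or.inl ⟨_, Or.inr ⟨q, hq, rfl⟩, rfl⟩
      · exact Or.inr ⟨q, hq, by simp [sgn, pow_add, mul_assoc]⟩
    · rintro (⟨_, ⟨q, hq, rfl⟩ | ⟨q, hq, rfl⟩, rfl⟩ | ⟨q, hq, rfl⟩)
      · exact Or.inl ⟨q, hq, rfl⟩
      · exact Or.inr ⟨_, Or.inl ⟨q, hq, rfl⟩, rfl⟩
      · exact Or.inr ⟨_, Or.inr ⟨q, hq, rfl⟩, by simp [sgn, pow_add, mul_assoc]⟩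


/-! ### Words of neutral square-rooted trees -/

/-- The interval of letters belonging to a neutral square-shaped root over the leaves `[s, e)`:
either it ends with an additional last letter `k - 1`, or it starts with an additional first letter
`k`. -/
def squareBracket (right : Bool) (k s e : ℕ) : ℕ × ℕ := if right then (s, k) else (k, e)

/-- The sign of a bracket in a word. -/
def sideSign (right : Bool) (k : ℕ) (b : ℕ × ℕ) : ℤ := if right = false ∧ b.1 = k then -1 else 1

/-- Words of plain trees with neutral square-shaped roots, as in `PlainForest`. -/
inductive SquareWord (right : Bool) (k : ℕ) : ℕ → List STree → ℕ → List (ℕ × ℕ) → Prop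
  | nil (a : ℕ) : SquareWord right k a [] a []
  | cons {a b c : ℕ} {L : List RTree} {W : List STree} {l m : List (ℕ × ℕ)} : L ≠ [] →
      PlainForest a L b l → SquareWord right k b W c m →
      SquareWord right k a (.neutral L :: W) c (squareBracket right k a b :: (l ++ m))

/-- The additional letter lies outside of the interval of leaves. -/
def OutsideLetter (right : Bool) (k a c : ℕ) : Prop := if right then c < k else k < a

theorem PlainForest.lt_of_ne_nil {a c : ℕ} {L : List RTree} {l : List (ℕ × ℕ)}
    (h : PlainForest a L c l) (hL : L ≠ []) : a < c := by
  have := h.add_length_le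
  have := List.length_pos_of_ne_nil hL
  omega

theorem PlainForest.ne_nil_of_lt {a c : ℕ} {L : List RTree} {l : List (ℕ × ℕ)}
    (h : PlainForest a L c l) (hac : a < c) : L ≠ [] := by
  rintro rfl
  cases h
  omega

theorem mem_wordBlowUps_append {V W : List STree} {p : ℤ × List STree} :
    p ∈ wordBlowUps (V ++ W) ↔ (∃ q ∈ wordBlowUps V, p = (q.1, q.2 ++ W)) ∨
      ∃ q ∈ wordBlowUps W, p = (sgn (V.map STree.neutrals).sum * q.1, V ++ q.2) := by
  induction V generalizing p with
  | nil => simp [wordBlowUps, sgn]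
  | cons S V ih =>
    simp only [List.cons_append, wordBlowUps, List.mem_append, List.mem_map, ih,
      List.map_cons, List.sum_cons]
    constructor
    · rintro (⟨q, hq, rfl⟩ | ⟨_, ⟨q, hq, rfl⟩ | ⟨q, hq, rfl⟩, rfl⟩)
      · exact Or.inl ⟨_, Or.inl ⟨q, hq, rfl⟩, by simp⟩
      · exact Or.inl ⟨_, Or.inr ⟨q, hq, rfl⟩, rfl⟩
      · exact Or.inr ⟨q, hq, by simp [sgn, pow_add, mul_assoc]⟩
    · rintro (⟨_, ⟨q, hq, rfl⟩ | ⟨q, hq, rfl⟩, rfl⟩ | ⟨q, hq, rfl⟩)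
      · exact Or.inl ⟨q, hq, by simp⟩
      · exact Or.inr ⟨_, Or.inl ⟨q, hq, rfl⟩, rfl⟩
      · exact Or.inr ⟨_, Or.inr ⟨q, hq, rfl⟩, by simp [sgn, pow_add, mul_assoc]⟩

namespace SquareWord

variable {right : Bool} {k a c x y : ℕ} {W : List STree} {l : List (ℕ × ℕ)}

theorem le (h : SquareWord right k a W c l) : a ≤ c := by
  induction h with
  | nil => exact le_rfl
  | cons _ h₁ _ ih => exact h₁.le.trans ih

theorem eq_nil (h : SquareWord right k a W a l) : W = [] ∧ l = [] := by
  cases h with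
  | nil => exact ⟨rfl, rfl⟩
  | cons hL h₁ h₂ =>
    have := h₁.lt_of_ne_nil hL
    have := h₂.le
    omega

theorem length_eq (h : SquareWord right k a W c l) :
    l.length = (W.map STree.neutrals).sum := by
  induction h with
  | nil => rfl
  | cons _ h₁ _ ih => simp [STree.neutrals, h₁.length_eq, ih]; omega

theorem append {b : ℕ} {V : List STree} {m : List (ℕ × ℕ)} (h : SquareWord right k a W b l)
    (h' : SquareWord right k b V c m) : SquareWord right k a (W ++ V) c (l ++ m) := by
  induction h with
  | nil => exact h'
  | cons hL h₁ _ ih => simpa using SquareWord.cons hL h₁ (ih h')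

theorem det {c' : ℕ} {l' : List (ℕ × ℕ)} (h : SquareWord right k a W c l)
    (h' : SquareWord right k a W c' l') : c = c' ∧ l = l' := by
  induction h generalizing c' l' with
  | nil => cases h'; exact ⟨rfl, rfl⟩
  | cons _ h₁ _ ih =>
    cases h' with
    | cons _ h₁' h₂' =>
      obtain ⟨rfl, rfl⟩ := h₁.det h₁'
      obtain ⟨rfl, rfl⟩ := ih h₂'
      exact ⟨rfl, rfl⟩

/-- Three kinds of brackets occur: intervals of leaves, and those that reach an additional letter on
the right or on the left. -/
theorem bounds (h : SquareWord right k a W c l) (hk : OutsideLetter right k a c) :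
    ∀ b ∈ l, b.1 + 2 ≤ b.2 ∧ ((a ≤ b.1 ∧ b.2 ≤ c) ∨
      (right = true ∧ b.2 = k ∧ a ≤ b.1 ∧ b.1 < c) ∨
      (right = false ∧ b.1 = k ∧ a < b.2 ∧ b.2 ≤ c)) := by
  induction h with
  | nil => simp
  | cons hL h₁ h₂ ih =>
    intro d hd
    have e1 := h₁.lt_of_ne_nil hL
    have e2 := h₂.le
    rw [List.mem_cons, List.mem_append] at hd
    cases right <;> simp only [OutsideLetter, squareBracket, if_true, if_false, reduceCtorEq,
      Bool.false_eq_true, true_and, false_and, or_false, false_or] at hk hd ih ⊢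
    · rcases hd with rfl | hd | hd
      · simp only [true_and]; omega
      · have := h₁.bounds d hd; omega
      · have := ih (by omega) d hd; omega
    · rcases hd with rfl | hd | hd
      · simp only [true_and]; omega
      · have := h₁.bounds d hd; omega
      · have := ih (by omega) d hd; omega

theorem bounds_right (h : SquareWord true k a W c l) (hk : c < k) :
    ∀ b ∈ l, b.1 + 2 ≤ b.2 ∧ a ≤ b.1 ∧ b.1 < c ∧ (b.2 ≤ c ∨ b.2 = k) := by
  intro b hb
  have := h.bounds (by simpa [OutsideLetter] using hk) b hb
  simp only [reduceCtorEq, true_and, false_and, or_false] at this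
  omega

theorem bounds_left (h : SquareWord false k a W c l) (hk : k < a) :
    ∀ b ∈ l, b.1 + 2 ≤ b.2 ∧ a < b.2 ∧ b.2 ≤ c ∧ (a ≤ b.1 ∨ b.1 = k) := by
  intro b hb
  have := h.bounds (by simpa [OutsideLetter] using hk) b hb
  simp only [true_and, false_and, false_or, Bool.false_eq_true] at this
  omega

theorem first_mem (h : SquareWord true k a W c l) (hac : a < c) : (a, k) ∈ l := by
  cases h with
  | nil => omega
  | cons => simp [squareBracket]

theorem last_mem (h : SquareWord false k a W c l) (hac : a < c) : (k, c) ∈ l := by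
  induction h with
  | nil => omega
  | cons _ h₁ h₂ ih =>
    rename_i a b c L W l m
    rcases h₂.le.eq_or_lt with rfl | hlt
    · simp [squareBracket]
    · simp [ih hlt]

/-- If the first tree of the primed word ended later, the word without primes would have a root
bracket at the boundary `b` which the other word cannot have: `(k, b)` of its first tree, or `(b,
k)` of its second. -/
theorem first_le_first (hk : OutsideLetter right k a c)
    {b b' : ℕ} {L L' : List RTree} {V V' : List STree} {m m' n n' : List (ℕ × ℕ)} (hL : L ≠ [])
    (h₁ : PlainForest a L b m) (h₂ : SquareWord right k b V c n)
    (h₁' : PlainForest a L' b' m') (h₂' : SquareWord right k b' V' c n')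
    (hl : ∀ d, d = squareBracket right k a b ∨ d ∈ m ++ n →
      d = squareBracket right k a b' ∨ d ∈ m' ++ n') : b' ≤ b := by
  by_contra hlt
  rw [not_le] at hlt
  have e1 := h₁.lt_of_ne_nil hL
  have e2 := h₂'.le
  cases right
  · simp only [OutsideLetter, squareBracket, Bool.false_eq_true, if_false, List.mem_append]
      at hk hl
    rcases hl _ (Or.inl rfl) with hd | hd | hd
    · simp only [Prod.mk.injEq] at hd; omega
    · have := h₁'.bounds _ hd; simp only at this; omega
    · have := h₂'.bounds_left (by omega) _ hd; simp only at this; omega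
  · simp only [OutsideLetter, squareBracket, if_true, List.mem_append] at hk hl
    rcases hl _ (Or.inr (Or.inr (h₂.first_mem (by omega)))) with hd | hd | hd
    · simp only [Prod.mk.injEq] at hd; omega
    · have := h₁'.bounds _ hd; simp only at this; omega
    · have := h₂'.bounds_right (by omega) _ hd; simp only at this; omega

/-- Root brackets determine where the first tree ends. After that, bounds tell apart the first root,
the brackets in the first tree, and the rest of the word. -/
theorem inj {W' : List STree} {l' : List (ℕ × ℕ)} (h : SquareWord right k a W c l)
    (hk : OutsideLetter right k a c) (h' : SquareWord right k a W' c l')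
    (hl : ∀ b, b ∈ l ↔ b ∈ l') : W = W' := by
  induction h generalizing W' l' with
  | nil => exact h'.eq_nil.1.symm
  | cons hL h₁ h₂ ih =>
    rename_i a b c L W l m
    have e1 := h₁.lt_of_ne_nil hL
    have e2 := h₂.le
    cases h' with
    | nil => omega
    | cons hL' h₁' h₂' =>
      rename_i b' L' W' l' m'
      simp only [List.mem_cons] at hl
      obtain rfl : b = b' := le_antisymm
        (first_le_first hk hL' h₁' h₂' h₁ h₂ fun d => (hl d).2)
        (first_le_first hk hL h₁ h₂ h₁' h₂' fun d => (hl d).1)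
      have hk' : OutsideLetter right k b c := by
        cases right <;> simp only [OutsideLetter, Bool.false_eq_true, if_false, if_true] at hk ⊢ <;>
          omega
      have hsep : ∀ {l m : List (ℕ × ℕ)} {L : List RTree} {W : List STree},
          PlainForest a L b l → SquareWord right k b W c m → ∀ d,
            (d ∈ l → d ≠ squareBracket right k a b ∧ d ∉ m) ∧
            (d ∈ m → d ≠ squareBracket right k a b) := by
        intro l m L W h₁ h₂ d
        refine ⟨fun hd => ?_, fun hd => ?_⟩
        · have g1 := h₁.bounds d hd
          refine ⟨?_, fun hd' => ?_⟩
          · rintro rfl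
            cases right <;> simp only [OutsideLetter, squareBracket, Bool.false_eq_true, if_false,
              if_true] at hk g1 <;> omega
          · cases right <;> simp only [OutsideLetter, Bool.false_eq_true, if_false, if_true] at hk
            · have := h₂.bounds_left (by omega) d hd'; omega
            · have := h₂.bounds_right hk d hd'; omega
        · rintro rfl
          cases right <;> simp only [OutsideLetter, squareBracket, Bool.false_eq_true, if_false,
              if_true] at hk hd
          · have := h₂.bounds_left (by omega) _ hd; simp only at this; omega
          · have := h₂.bounds_right hk _ hd; simp only at this; omega
      simp only [List.mem_append] at hl
      rw [h₁.inj h₁' fun d => ⟨fun hd => ?_, fun hd => ?_⟩,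
        ih hk' h₂' fun d => ⟨fun hd => ?_, fun hd => ?_⟩]
      · exact (((hl d).1 (Or.inr (Or.inr hd))).resolve_left ((hsep h₁ h₂ d).2 hd)).resolve_left
          fun h => ((hsep h₁' h₂ d).1 h).2 hd
      · exact (((hl d).2 (Or.inr (Or.inr hd))).resolve_left ((hsep h₁' h₂' d).2 hd)).resolve_left
          fun h => ((hsep h₁ h₂' d).1 h).2 hd
      · exact (((hl d).1 (Or.inr (Or.inl hd))).resolve_left ((hsep h₁ h₂' d).1 hd).1).resolve_right
          ((hsep h₁ h₂' d).1 hd).2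
      · exact (((hl d).2 (Or.inr (Or.inl hd))).resolve_left ((hsep h₁' h₂ d).1 hd).1).resolve_right
          ((hsep h₁' h₂ d).1 hd).2

theorem laminar (h : SquareWord right k a W c l) (hk : OutsideLetter right k a c) :
    ∀ b ∈ l, ∀ d ∈ l, Laminar b d := by
  induction h with
  | nil => simp
  | cons hL h₁ h₂ ih =>
    rename_i a b c L W l m
    have e1 := h₁.lt_of_ne_nil hL
    have e2 := h₂.le
    intro d hd f hf
    rw [List.mem_cons, List.mem_append] at hd hf
    have hlam := h₁.laminar
    cases right <;> simp only [OutsideLetter, squareBracket, Bool.false_eq_true, if_false,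
      if_true] at hk hd hf ih
    · have g1 := h₁.bounds
      have g2 := h₂.bounds_left (by omega)
      unfold Laminar
      rcases hd with rfl | hd | hd <;> rcases hf with rfl | hf | hf
      · simp
      · have := g1 f hf; simp only; omega
      · have := g2 f hf; simp only; omega
      · have := g1 d hd; simp only; omega
      · exact hlam d hd f hf
      · have := g1 d hd; have := g2 f hf; omega
      · have := g2 d hd; simp only; omega
      · have := g2 d hd; have := g1 f hf; omega
      · exact ih (by omega) d hd f hf
    · have g1 := h₁.bounds
      have g2 := h₂.bounds_right hk
      unfold Laminar
      rcases hd with rfl | hd | hd <;> rcases hf with rfl | hf | hf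
      · simp
      · have := g1 f hf; simp only; omega
      · have := g2 f hf; simp only; omega
      · have := g1 d hd; simp only; omega
      · exact hlam d hd f hf
      · have := g1 d hd; have := g2 f hf; omega
      · have := g2 d hd; simp only; omega
      · have := g2 d hd; have := g1 f hf; omega
      · exact ih (by omega) d hd f hf

/-! #### Blow-ups -/

theorem sideSign_of_le {b : ℕ × ℕ} (hk : OutsideLetter right k a c) (hb : a ≤ b.1) :
    sideSign right k b = 1 := by
  rw [sideSign, if_neg]
  rintro ⟨rfl, h⟩
  simp only [OutsideLetter, Bool.false_eq_true, if_false] at hk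
  omega

/-- A cut adds one root bracket. With the letter on the right it is that of the second tree, and it
passes `l` and the first root bracket. With the letter on the left it is that of the first tree,
already in front, and the old root bracket passes `l` instead. The two signs are opposite, which is
what `sideSign` records. -/
theorem cut {b : ℕ} (d : ℕ) {L : List RTree} {l : List (ℕ × ℕ)} (l' m : List (ℕ × ℕ))
    (h₁ : PlainForest a L b l) : ∃ f, SignedPerm (sideSign right k f * -sgn (forestNeutrals L))
      (squareBracket right k a b :: (l ++ (squareBracket right k b d :: (l' ++ m))))
      (f :: squareBracket right k a d :: ((l ++ l') ++ m)) ∧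
      f = if right then (b, k) else (k, b) := by
  refine ⟨_, ?_, rfl⟩
  have hmove := (SignedPerm.move l (squareBracket right k b d) (l' ++ m)).cons
    (squareBracket right k a b)
  rw [h₁.length_eq] at hmove
  rw [List.append_assoc]
  cases right
  · simpa [sideSign, squareBracket] using hmove
  · simpa [sideSign, squareBracket] using hmove.trans (.swap _ _ _)

theorem blowUp (h : SquareWord right k a W c l) (hk : OutsideLetter right k a c) :
    ∀ p ∈ wordBlowUps W, ∃ b l', SquareWord right k a p.2 c l' ∧
      SignedPerm (sideSign right k b * p.1) l' (b :: l) := by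
  induction h with
  | nil => simp [wordBlowUps]
  | cons hL h₁ h₂ ih =>
    rename_i a b c L W l m
    have e1 := h₁.le
    have hk' : OutsideLetter right k b c := by
      cases right <;> simp only [OutsideLetter, Bool.false_eq_true, if_false, if_true] at hk ⊢ <;>
        omega
    have hside : ∀ {L' : List RTree} {l' : List (ℕ × ℕ)} {d : ℕ × ℕ} {s : ℤ},
        PlainForest a L' b l' → SignedPerm s l' (d :: l) → sideSign right k d = 1 := by
      intro L' l' d s h' hs
      exact sideSign_of_le hk (h'.bounds d (hs.perm.mem_iff.2 List.mem_cons_self)).1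
    intro p hp
    simp only [wordBlowUps, STree.blowUps, List.mem_append, List.mem_map, List.mem_filter,
      mem_cuts₃, mem_cuts₂, decide_eq_true_eq] at hp
    rcases hp with ⟨_, (⟨q, ⟨hq, hlen⟩, rfl⟩ | ⟨q, ⟨hq, hlen⟩, rfl⟩) | ⟨q, hq, rfl⟩, rfl⟩ |
      ⟨q, hq, rfl⟩
    · subst hq
      obtain ⟨d, l', h', hs⟩ := h₁.group hlen
      refine ⟨d, _, .cons (by simp) h' h₂, ((hs.cons_move _).append_right m).of_eq ?_⟩
      rw [hside h' hs, one_mul]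
    · subst hq
      obtain ⟨e, l₁, l₂, rfl, g₁, g₂⟩ := h₁.split
      have n1 : q.1 ≠ [] := List.ne_nil_of_length_pos hlen.1
      have n2 : q.2 ≠ [] := List.ne_nil_of_length_pos hlen.2
      obtain ⟨f, hf, -⟩ := cut b l₂ m g₁
      exact ⟨f, _, .cons n1 g₁ (.cons n2 g₂ h₂), hf⟩
    · obtain ⟨d, l', h', hs⟩ := h₁.blowUp q hq
      refine ⟨d, _, .cons ?_ h' h₂, ((hs.cons_move _).append_right m).of_eq ?_⟩
      · rw [← List.length_pos_iff, (forestBlowUps_spec _ q hq).2.1]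
        exact List.length_pos_of_ne_nil hL
      · rw [hside h' hs, one_mul]
    · obtain ⟨d, l', h', hs⟩ := ih hk' q hq
      refine ⟨d, _, .cons hL h₁ h', (hs.append_move (squareBracket right k a b :: l)).of_eq ?_⟩
      simp only [List.length_cons, h₁.length_eq, STree.neutrals]
      ring

theorem exists_tail {b : ℕ} {S : STree} {k₁ m : List (ℕ × ℕ)} {f : ℕ × ℕ}
    (hS : SquareWord right k a [S] b k₁)
    (h : ∃ p ∈ wordBlowUps W, ∃ l', SquareWord right k b p.2 c l' ∧ ∀ d, d ∈ l' ↔ d = f ∨ d ∈ m) :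
    ∃ p ∈ wordBlowUps (S :: W), ∃ l', SquareWord right k a p.2 c l' ∧
      ∀ d, d ∈ l' ↔ d = f ∨ d ∈ k₁ ++ m := by
  obtain ⟨p, hp, l', h', hl'⟩ := h
  refine ⟨(sgn S.neutrals * p.1, S :: p.2), ?_, _, hS.append h', fun d => ?_⟩
  · rw [wordBlowUps, List.mem_append]
    exact Or.inr (List.mem_map.2 ⟨p, hp, rfl⟩)
  · simp only [List.mem_append, hl']
    rw [or_left_comm]

theorem exists_head {b : ℕ} {S : STree} {V : List STree} {k₁ k₂ m : List (ℕ × ℕ)} {f : ℕ × ℕ}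
    {s : ℤ} (hV : (s, V) ∈ S.blowUps) (hV' : SquareWord right k a V b k₂)
    (hk₂ : ∀ d, d ∈ k₂ ↔ d = f ∨ d ∈ k₁) (h : SquareWord right k b W c m) :
    ∃ p ∈ wordBlowUps (S :: W), ∃ l', SquareWord right k a p.2 c l' ∧
      ∀ d, d ∈ l' ↔ d = f ∨ d ∈ k₁ ++ m := by
  refine ⟨(s, V ++ W), ?_, _, hV'.append h, fun d => ?_⟩
  · rw [wordBlowUps, List.mem_append]
    exact Or.inl (List.mem_map.2 ⟨_, hV, rfl⟩)
  · simp only [List.mem_append, hk₂]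
    rw [or_assoc]

/-- A bracket without the additional letter lies over a single tree of the word, where a round
vertex is added. -/
theorem exists_blowUp_round (h : SquareWord right k a W c l) (hk : OutsideLetter right k a c)
    (hax : a ≤ x) (hxy : x + 2 ≤ y) (hyc : y ≤ c) (hl : ∀ b ∈ l, Laminar (x, y) b)
    (hn : (x, y) ∉ l) : ∃ p ∈ wordBlowUps W, ∃ l', SquareWord right k a p.2 c l' ∧
      ∀ d, d ∈ l' ↔ d = (x, y) ∨ d ∈ l := by
  induction h with
  | nil => omega
  | cons hL h₁ h₂ ih =>
    rename_i a b c L W l m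
    have e1 := h₁.le
    have hS : SquareWord right k a [.neutral L] b (squareBracket right k a b :: l) := by
      simpa using SquareWord.cons hL h₁ (.nil b)
    have hk' : OutsideLetter right k b c := by
      cases right <;> simp only [OutsideLetter, Bool.false_eq_true, if_false, if_true] at hk ⊢ <;>
        omega
    simp only [List.mem_cons, List.mem_append, not_or] at hl hn
    rcases Nat.lt_or_ge x b with hxb | hbx
    · rcases Nat.lt_or_ge b y with hby | hyb
      -- An interval across the boundary `b` of two trees would cross the root bracket ending there
      -- (left letter) or starting there (right letter).
      · exfalso
        cases right <;> simp only [OutsideLetter, squareBracket, Bool.false_eq_true, if_false,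
          if_true] at hk hl
        · have := hl (k, b) (Or.inl rfl)
          simp only [Laminar] at this
          omega
        · have := hl (b, k) (Or.inr (Or.inr (h₂.first_mem (by omega))))
          simp only [Laminar] at this
          omega
      · rw [← List.cons_append]
        rcases h₁.exists_blowUp hax hxy hyb (fun d hd => hl d (Or.inr (Or.inl hd))) hn.2.1 with
          ⟨A, B, C, rfl, hB, -, k', h', hk'⟩ | ⟨p, hp, k', h', hk'⟩
        · refine exists_head (s := -sgn (forestNeutrals A))
            (V := [.neutral (A ++ .neutral B :: C)]) ?_ (.cons (by simp) h' (.nil b)) ?_ h₂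
          · simp only [STree.blowUps, List.mem_append, List.mem_map, List.mem_filter]
            refine Or.inl (Or.inl ⟨(A, B, C), ⟨mem_cuts₃.2 rfl, ?_⟩, rfl⟩)
            simpa using hB
          · intro d
            simp only [List.append_nil, List.mem_cons, hk']
            rw [or_left_comm]
        · refine exists_head (s := -p.1) (V := [.neutral p.2]) ?_ (.cons ?_ h' (.nil b)) ?_ h₂
          · simp only [STree.blowUps, List.mem_append, List.mem_map]
            exact Or.inr ⟨p, hp, rfl⟩
          · rw [← List.length_pos_iff, (forestBlowUps_spec _ p hp).2.1]
            exact List.length_pos_of_ne_nil hL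
          · intro d
            simp only [List.append_nil, List.mem_cons, hk']
            rw [or_left_comm]
    · exact exists_tail hS (ih hk' hbx hyc (fun d hd => hl d (Or.inr (Or.inr hd))) hn.2.2)

/-- A bracket with the additional letter prescribes a place `x` where the word is to be cut;
compatibility says that no round vertex stands in the way. -/
theorem exists_blowUp_cut (h : SquareWord right k a W c l) (hk : OutsideLetter right k a c)
    (hax : a < x) (hxc : x < c) (hl : ∀ b ∈ l, Laminar (if right then (x, k) else (k, x)) b)
    (hn : (if right then (x, k) else (k, x)) ∉ l) :
    ∃ p ∈ wordBlowUps W, ∃ l', SquareWord right k a p.2 c l' ∧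
      ∀ d, d ∈ l' ↔ d = (if right then (x, k) else (k, x)) ∨ d ∈ l := by
  induction h with
  | nil => omega
  | cons hL h₁ h₂ ih =>
    rename_i a b c L W l m
    have e1 := h₁.le
    have e2 := h₂.le
    have hS : SquareWord right k a [.neutral L] b (squareBracket right k a b :: l) := by
      simpa using SquareWord.cons hL h₁ (.nil b)
    have hk' : OutsideLetter right k b c := by
      cases right <;> simp only [OutsideLetter, Bool.false_eq_true, if_false, if_true] at hk ⊢ <;>
        omega
    simp only [List.mem_cons, List.mem_append, not_or] at hl hn
    rcases lt_trichotomy x b with hxb | rfl | hbx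
    · obtain ⟨A, B, l₁, l₂, rfl, rfl, hA, hB⟩ := h₁.exists_split hax.le hxb.le fun d hd => by
        have h3 := hl d (Or.inr (Or.inl hd))
        have h4 := h₁.bounds d hd
        cases right <;> simp only [OutsideLetter, Laminar, Bool.false_eq_true, if_false,
          if_true] at hk h3 <;> omega
      have nA := hA.ne_nil_of_lt hax
      have nB := hB.ne_nil_of_lt hxb
      rw [← List.cons_append]
      obtain ⟨f, hf, hf'⟩ := cut b l₂ [] hA
      refine exists_head (s := -sgn (forestNeutrals A)) (V := [.neutral A, .neutral B]) ?_
        (.cons nA hA (.cons nB hB (.nil b))) ?_ h₂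
      · simp only [STree.blowUps, List.mem_append, List.mem_map, List.mem_filter]
        refine Or.inl (Or.inr ⟨(A, B), ⟨mem_cuts₂.2 rfl, ?_⟩, rfl⟩)
        simpa using ⟨List.length_pos_of_ne_nil nA, List.length_pos_of_ne_nil nB⟩
      · intro d
        rw [hf.perm.mem_iff, hf']
        simp
    -- If the word is already divided at `x`, the bracket belongs to a root.
    · exfalso
      cases right <;> simp only [squareBracket, Bool.false_eq_true, if_false, if_true] at hn
      · exact hn.1 trivial
      · exact hn.2.2 (h₂.first_mem hxc)
    · exact exists_tail hS (ih hk' hbx hxc (fun d hd => hl d (Or.inr (Or.inr hd))) hn.2.2)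

end SquareWord

-- Forests of leaves and brackets of a word of letters

theorem leaves_succ (a k : ℕ) : leaves a (k + 1) = .closed (a + 1) [] :: leaves (a + 1) k := by
  simp only [leaves, List.range_succ_eq_map, List.map_cons, List.map_map, Nat.zero_add]
  congr 1
  refine List.map_congr_left fun i _ => ?_
  simp only [Function.comp_apply, Nat.succ_eq_add_one]
  congr 1
  omega

theorem plainForest_leaves (a k : ℕ) : PlainForest (a + 1) (leaves a k) (a + 1 + k) [] := by
  induction k generalizing a with
  | zero => exact .nil _
  | succ k ih =>
    rw [leaves_succ]
    have := ih (a + 1)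
    rw [show a + 1 + 1 + k = a + 1 + (k + 1) by omega] at this
    exact .leaf this

/-- The brackets of a word of `m` letters `1, …, m`: the intervals with at least two letters, but
not all of them. -/
def PathVertex (m : ℕ) (b : ℕ × ℕ) : Prop :=
  1 ≤ b.1 ∧ b.1 + 2 ≤ b.2 ∧ b.2 ≤ m + 1 ∧ ¬(b.1 = 1 ∧ b.2 = m + 1)

/-! ### The elements below `G` -/

/-- The words below `G n`, with the intervals of all roots and vertices except the first root. -/
def GRel (n : ℕ) (S : PreTree) (l : List (ℕ × ℕ)) : Prop :=
  ∃ W, S = .word W ∧ SquareWord true (n + 3) 1 W (n + 2) ((1, n + 3) :: l)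

theorem SignedPerm.exists_of_perm {β : Type} {l m : List β} (h : l.Perm m) :
    ∃ s, SignedPerm s l m := by
  induction h with
  | nil => exact ⟨1, .refl _⟩
  | cons x _ ih => exact ih.imp fun _ h => h.cons x
  | swap x y l => exact ⟨-1, .swap y x l⟩
  | trans _ _ ih₁ ih₂ =>
    obtain ⟨s, hs⟩ := ih₁
    obtain ⟨t, ht⟩ := ih₂
    exact ⟨s * t, hs.trans ht⟩

/-- Without repetitions the two lists determine the sign through `sortSign`. This permits the
cancellation of a common first entry. -/
theorem SignedPerm.sign_unique {s t : ℤ} {l m : List (ℕ × ℕ)} (h : SignedPerm s l m)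
    (h' : SignedPerm t l m) (hl : l.Nodup) : s = t := by
  have h1 := (h.sortSign_eq hl).symm.trans (h'.sortSign_eq hl)
  have h2 := sortSign_mul_self m
  linear_combination sortSign m * h1 + (t - s) * h2

theorem PlainForest.nodup {a c : ℕ} {L : List RTree} {l : List (ℕ × ℕ)}
    (h : PlainForest a L c l) : l.Nodup := by
  induction h with
  | nil => exact List.nodup_nil
  | leaf _ ih => exact ih
  | node hK h₁ h₂ ih₁ ih₂ =>
    have e1 := h₁.add_length_le
    rw [List.nodup_cons, List.mem_append, List.nodup_append']
    refine ⟨?_, ih₁, ih₂, fun d hd hd' => ?_⟩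
    · rintro (hd | hd)
      · exact h₁.whole_notMem hK hd
      · have := h₂.bounds _ hd
        simp only at this
        omega
    · have := h₁.bounds d hd
      have := h₂.bounds d hd'
      omega

theorem SquareWord.exists_cons {k a c : ℕ} {W : List STree} {l : List (ℕ × ℕ)}
    (h : SquareWord true k a W c l) (hac : a < c) : ∃ l', l = (a, k) :: l' := by
  cases h with
  | nil => omega
  | cons => exact ⟨_, rfl⟩

theorem SquareWord.whole_notMem {k a c : ℕ} {W : List STree} {l : List (ℕ × ℕ)}
    (h : SquareWord true k a W c ((a, k) :: l)) (hk : c < k) : (a, k) ∉ l := by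
  generalize hm : (a, k) :: l = m at h
  cases h with
  | nil => simp at hm
  | cons hL h₁ h₂ =>
    obtain ⟨-, rfl⟩ := List.cons.inj hm
    have e1 := h₁.lt_of_ne_nil hL
    have e2 := h₂.le
    rw [List.mem_append]
    rintro (hd | hd)
    · have := h₁.bounds _ hd
      simp only at this
      omega
    · have := h₂.bounds_right hk _ hd
      simp only at this
      omega

theorem SquareWord.nodup {k a c : ℕ} {W : List STree} {l : List (ℕ × ℕ)}
    (h : SquareWord true k a W c l) (hk : c < k) : l.Nodup := by
  induction h with
  | nil => exact List.nodup_nil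
  | cons hL h₁ h₂ ih =>
    have e2 := h₂.le
    refine List.nodup_cons.2 ⟨(SquareWord.cons hL h₁ h₂).whole_notMem hk, ?_⟩
    refine List.nodup_append'.2 ⟨h₁.nodup, ih hk, fun d hd hd' => ?_⟩
    have := h₁.bounds d hd
    have := h₂.bounds_right hk d hd'
    omega

/-- The bracket of the first root is the whole word. It heads every list and is dropped; a new
bracket moved to the front would have to pass it, hence the constant factor `-1`. -/
theorem treeModel_G (n : ℕ) :
    TreeModel (G n) (PathVertex (n + 2)) Laminar (GRel n) (fun _ => -1) where
  sign _ := by norm_num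
  top := ⟨_, rfl, by
    have := plainForest_leaves 0 (n + 1)
    rw [show 0 + 1 + (n + 1) = n + 2 by omega] at this
    exact .cons (by simp [leaves_succ]) this (.nil _)⟩
  det := by
    rintro S l l' ⟨W, rfl, h⟩ ⟨W', hW, h'⟩
    obtain rfl : W = W' := by simpa using hW
    exact (List.cons.inj (h.det h').2).2
  inj := by
    rintro S S' l l' ⟨W, rfl, h⟩ ⟨W', rfl, h'⟩ hl
    rw [h.inj (by simp [OutsideLetter]) h' fun b => by simp [hl]]
  simplex := by
    rintro S l ⟨W, rfl, h⟩
    have hout : OutsideLetter true (n + 3) 1 (n + 2) := by simp [OutsideLetter]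
    refine ⟨fun b hb => ?_, fun b hb c hc => ?_⟩
    · rw [List.mem_toFinset] at hb
      have h1 := h.bounds_right (by omega) b (by simp [hb])
      refine ⟨by omega, by omega, by omega, fun h2 => ?_⟩
      obtain rfl : b = (1, n + 3) := Prod.ext h2.1 h2.2
      exact h.whole_notMem (by omega) hb
    · rw [List.mem_toFinset] at hb hc
      exact h.laminar hout b (by simp [hb]) c (by simp [hc])
  blowUp := by
    rintro S l p ⟨W, rfl, h⟩ hp
    simp only [PreTree.blowUps, List.mem_map] at hp
    obtain ⟨q, hq, rfl⟩ := hp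
    obtain ⟨b, l', h', hs⟩ := h.blowUp (by simp [OutsideLetter]) q hq
    obtain ⟨l', rfl⟩ := h'.exists_cons (by omega)
    refine ⟨b, l', ⟨_, rfl, h'⟩, ?_⟩
    have hn := h'.nodup (by omega)
    -- The new bracket is put back behind the whole word, which costs a sign, so that the common
    -- first entry can be cancelled.
    have hs' := hs.trans (.swap _ _ _)
    obtain ⟨z, hz⟩ := SignedPerm.exists_of_perm (List.perm_cons _ |>.1 hs'.perm)
    exact hz.of_eq (((hz.cons (1, n + 3)).sign_unique hs' hn).trans (by simp [sideSign]))
  exists_blowUp := by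
    rintro S l b ⟨W, rfl, h⟩ hb hsimp
    have hout : OutsideLetter true (n + 3) 1 (n + 2) := by simp [OutsideLetter]
    obtain ⟨v1, v2, v3, v4⟩ := hsimp.1 b (by simp)
    have hlam : ∀ d ∈ (1, n + 3) :: l, Laminar b d := by
      intro d hd
      rcases List.mem_cons.1 hd with rfl | hd
      · exact Or.inr (Or.inr (Or.inr ⟨v1, v3⟩))
      · exact hsimp.2 b (by simp) d (by simp [hd])
    have hn : b ∉ (1, n + 3) :: l := by
      rw [List.mem_cons]
      rintro (rfl | hd)
      · exact v4 ⟨rfl, rfl⟩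
      · exact hb hd
    obtain ⟨p, hp, l', h', hl'⟩ : ∃ p ∈ wordBlowUps W, ∃ l',
        SquareWord true (n + 3) 1 p.2 (n + 2) l' ∧ ∀ d, d ∈ l' ↔ d = b ∨ d ∈ (1, n + 3) :: l := by
      obtain ⟨x, y⟩ := b
      simp only at v1 v2 v3 v4
      -- A bracket ending with the additional letter is a cut; any other is a new round vertex.
      rcases v3.eq_or_lt with rfl | hy
      · exact h.exists_blowUp_cut hout (x := x) (by omega) (by omega) hlam hn
      · exact h.exists_blowUp_round hout v1 v2 (by omega) hlam hn
    obtain ⟨l', rfl⟩ := h'.exists_cons (by omega)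
    refine ⟨(p.1, .word p.2), List.mem_map.2 ⟨p, hp, rfl⟩, l', ⟨_, rfl, h'⟩, fun c => ?_⟩
    have hnm := h'.whole_notMem (by omega)
    have hnm2 := h.whole_notMem (by omega)
    have := hl' c
    by_cases hc : c = (1, n + 3)
    · subst hc
      have : (1, n + 3) ≠ b := fun h => hn (by simp [h])
      simp [hnm, hnm2, this]
    · simpa [hc] using this

/-! ### The elements below `Γ` -/

/-- The words below `Gam n`: a word of neutral trees to the left of the tree with open root, and
one to the right. The letters are the leaves `2, …, n + 1` and additional letters `1` on the left
and `n + 2` on the right. -/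
def GamRel (n : ℕ) (S : PreTree) (l : List (ℕ × ℕ)) : Prop :=
  ∃ X L Y s e l₁ l₂ l₃, S = .word (X ++ .opened 1 L :: Y) ∧ SquareWord false 1 2 X s l₁ ∧
    PlainForest s L e l₂ ∧ SquareWord true (n + 3) e Y (n + 2) l₃ ∧ l = l₁ ++ (l₂ ++ l₃)

/-- The displayed entry is the first one with the property `P` in both lists, so it determines the
decomposition. -/
theorem append_cons_inj {α : Type} {P : α → Prop} {A A' C C' : List α} {t t' : α}
    (h : A ++ t :: C = A' ++ t' :: C') (ht : P t) (ht' : P t') (hA : ∀ s ∈ A, ¬ P s)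
    (hA' : ∀ s ∈ A', ¬ P s) : A = A' ∧ t = t' ∧ C = C' := by
  induction A generalizing A' with
  | nil =>
    cases A' with
    | nil => simpa using h
    | cons s A' =>
      obtain ⟨rfl, -⟩ := List.cons.inj h
      exact absurd ht (hA' _ (by simp))
  | cons r A ih =>
    cases A' with
    | nil =>
      obtain ⟨rfl, -⟩ := List.cons.inj h
      exact absurd ht' (hA _ (by simp))
    | cons s A' =>
      obtain ⟨rfl, h'⟩ := List.cons.inj h
      obtain ⟨rfl, h2⟩ := ih h' (fun s hs => hA s (List.mem_cons_of_mem _ hs))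
        fun s hs => hA' s (List.mem_cons_of_mem _ hs)
      exact ⟨rfl, h2⟩

theorem SquareWord.not_opened {right : Bool} {k a c : ℕ} {W : List STree} {l : List (ℕ × ℕ)}
    (h : SquareWord right k a W c l) : ∀ S ∈ W, ¬ ∃ i L, S = STree.opened i L := by
  induction h with
  | nil => simp
  | cons _ _ _ ih =>
    intro S hS
    rcases List.mem_cons.1 hS with rfl | hS
    · simp
    · exact ih S hS

theorem mem_wordBlowUps_left {X W : List STree} {q : ℤ × List STree} (h : q ∈ wordBlowUps X) :
    (q.1, q.2 ++ W) ∈ wordBlowUps (X ++ W) :=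
  mem_wordBlowUps_append.2 (Or.inl ⟨q, h, rfl⟩)

theorem mem_wordBlowUps_right {X Y : List STree} {S : STree} {q : ℤ × List STree}
    (h : q ∈ wordBlowUps Y) : ∃ z, (z, X ++ S :: q.2) ∈ wordBlowUps (X ++ S :: Y) := by
  refine ⟨_, mem_wordBlowUps_append.2 (Or.inr ⟨(sgn S.neutrals * q.1, S :: q.2), ?_, rfl⟩)⟩
  rw [wordBlowUps, List.mem_append]
  exact Or.inr (List.mem_map.2 ⟨q, h, rfl⟩)

theorem mem_wordBlowUps_middle {X Y : List STree} {S : STree} {q : ℤ × List STree}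
    (h : q ∈ S.blowUps) : ∃ z, (z, X ++ (q.2 ++ Y)) ∈ wordBlowUps (X ++ S :: Y) := by
  refine ⟨_, mem_wordBlowUps_append.2 (Or.inr ⟨(q.1, q.2 ++ Y), ?_, rfl⟩)⟩
  rw [wordBlowUps, List.mem_append]
  exact Or.inl (List.mem_map.2 ⟨q, h, rfl⟩)

/-- Brackets through the left letter occur only in the left part and end by `s`, while `(1, s')` is
among them as soon as the left part of the other word is not empty. -/
theorem gamRel_inj_left {n s s' e : ℕ} {X Y : List STree} {L : List RTree}
    {l₁ l₂ l₃ l₁' l' : List (ℕ × ℕ)} {X' : List STree} (hX : SquareWord false 1 2 X s l₁)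
    (hL : PlainForest s L e l₂) (hY : SquareWord true (n + 3) e Y (n + 2) l₃)
    (hX' : SquareWord false 1 2 X' s' l₁')
    (h : ∀ b ∈ l₁' ++ l', b ∈ l₁ ++ (l₂ ++ l₃)) : s' ≤ s := by
  by_contra hlt
  have e1 := hX.le
  have e2 := hL.le
  have := h _ (List.mem_append_left _ (hX'.last_mem (by omega)))
  simp only [List.mem_append] at this
  rcases this with hd | hd | hd
  · have := hX.bounds_left (by omega) _ hd; simp only at this; omega
  · have := hL.bounds _ hd; simp only at this; omega
  · have := hY.bounds_right (by omega) _ hd; simp only at this; omega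

theorem gamRel_inj_right {n s e e' : ℕ} {X Y : List STree} {L : List RTree}
    {l₁ l₂ l₃ l₃' l' : List (ℕ × ℕ)} {Y' : List STree} (hX : SquareWord false 1 2 X s l₁)
    (hL : PlainForest s L e l₂) (hY : SquareWord true (n + 3) e Y (n + 2) l₃)
    (hY' : SquareWord true (n + 3) e' Y' (n + 2) l₃')
    (h : ∀ b ∈ l' ++ l₃', b ∈ l₁ ++ (l₂ ++ l₃)) : e ≤ e' := by
  by_contra hlt
  have e1 := hX.le
  have e2 := hL.le
  have e3 := hY.le
  have := h _ (List.mem_append_right _ (hY'.first_mem (by omega)))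
  simp only [List.mem_append] at this
  rcases this with hd | hd | hd
  · have := hX.bounds_left (by omega) _ hd; simp only at this; omega
  · have := hL.bounds _ hd; simp only at this; omega
  · have := hY.bounds_right (by omega) _ hd; simp only at this; omega

/-- Reading the word from left to right gives the brackets of the left part, of the open tree and of
the right part. A new bracket passes those before it; only brackets starting with the left letter
need a correcting sign. -/
theorem GamRel.blowUp {n : ℕ} {S : PreTree} {l : List (ℕ × ℕ)} {p : ℤ × PreTree}
    (h : GamRel n S l) (hp : p ∈ S.blowUps) :
    ∃ b l', GamRel n p.2 l' ∧ SignedPerm (sideSign false 1 b * p.1) l' (b :: l) := by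
  revert h hp
  rintro ⟨X, L, Y, s, e, l₁, l₂, l₃, rfl, hX, hL, hY, rfl⟩ hp
  have e1 := hX.le
  have e2 := hL.le
  have hside : ∀ {b : ℕ × ℕ}, s ≤ b.1 → sideSign false 1 b = 1 := by
    intro b hb
    rw [sideSign, if_neg]
    omega
  have hsideL : ∀ {L' : List RTree} {l' m : List (ℕ × ℕ)} {b : ℕ × ℕ} {z : ℤ} {e : ℕ},
      PlainForest s L' e l' → SignedPerm z l' (b :: m) → sideSign false 1 b = 1 :=
    fun h' hs => hside (h'.bounds _ (hs.perm.mem_iff.2 List.mem_cons_self)).1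
  simp only [PreTree.blowUps, List.mem_map, mem_wordBlowUps_append] at hp
  obtain ⟨_, ⟨q, hq, rfl⟩ | ⟨q, hq, rfl⟩, rfl⟩ := hp
  · obtain ⟨b, l', h', hs⟩ := hX.blowUp (by simp [OutsideLetter]) q hq
    exact ⟨b, _, ⟨_, _, _, _, _, _, _, _, rfl, h', hL, hY, rfl⟩, hs.append_right _⟩
  · simp only [wordBlowUps, List.mem_append, List.mem_map, STree.blowUps, List.mem_filter,
      mem_cuts₃, mem_cuts₂, decide_eq_true_eq] at hq
    rw [← hX.length_eq]
    rcases hq with ⟨_, ((⟨q, ⟨rfl, hlen⟩, rfl⟩ | ⟨q, ⟨rfl, hlen⟩, rfl⟩) |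
      ⟨q, ⟨rfl, hlen⟩, rfl⟩) | ⟨q, hq, rfl⟩, rfl⟩ | ⟨q, hq, rfl⟩
    · obtain ⟨b, l', h', hs⟩ := hL.group hlen
      refine ⟨b, _, ⟨_, _, _, _, _, _, _, _, rfl, hX, h', hY, rfl⟩,
        ((hs.append_right l₃).append_move l₁).of_eq ?_⟩
      rw [hsideL h' hs, one_mul]
    · obtain ⟨m, l₂, l₂', rfl, g₁, g₂⟩ := hL.split
      refine ⟨(m, n + 3), l₁ ++ (l₂ ++ ((m, n + 3) :: (l₂' ++ l₃))),
        ⟨X, q.1, .neutral q.2 :: Y, _, _, _, _, _, rfl, hX, g₁,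
          .cons (List.ne_nil_of_length_pos hlen) g₂ hY, rfl⟩, ?_⟩
      have hs := (SignedPerm.move l₂ (m, n + 3) (l₂' ++ l₃)).append_move l₁
      rw [hside g₁.le, one_mul, List.append_assoc, ← g₁.length_eq]
      exact hs
    · obtain ⟨m, l₂, l₂', rfl, g₁, g₂⟩ := hL.split
      refine ⟨(1, m), (l₁ ++ ((1, m) :: (l₂ ++ []))) ++ (l₂' ++ l₃),
        ⟨X ++ [.neutral q.1], q.2, Y, _, _, _, _, _, by simp,
          hX.append (.cons (List.ne_nil_of_length_pos hlen) g₁ (.nil _)), g₂, hY, rfl⟩, ?_⟩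
      -- The sign `-1` of this kind of cut is cancelled by `sideSign`, the new bracket starting with
      -- the letter `1`.
      have hs := SignedPerm.move l₁ (1, m) (l₂ ++ (l₂' ++ l₃))
      simpa [sideSign] using hs
    · obtain ⟨b, l', h', hs⟩ := hL.blowUp q hq
      refine ⟨b, _, ⟨_, _, _, _, _, _, _, _, rfl, hX, h', hY, rfl⟩,
        ((hs.append_right l₃).append_move l₁).of_eq ?_⟩
      rw [hsideL h' hs, one_mul]
    · obtain ⟨b, l', h', hs⟩ := hY.blowUp (by simp [OutsideLetter]) q hq
      have hb : sideSign false 1 b = 1 := by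
        refine hside (e2.trans (h'.bounds_right (by omega) _
          (hs.perm.mem_iff.2 List.mem_cons_self)).2.1)
      refine ⟨b, _, ⟨_, _, _, _, _, _, _, _, rfl, hX, hL, h', rfl⟩,
        ((hs.append_move l₂).append_move l₁).of_eq ?_⟩
      rw [hb]
      simp [sideSign, STree.neutrals, hL.length_eq]

theorem GamRel.exists_blowUp {n : ℕ} {S : PreTree} {l : List (ℕ × ℕ)} {b : ℕ × ℕ}
    (h : GamRel n S l) (hb : b ∉ l)
    (hsimp : IsSimplex (PathVertex (n + 2)) Laminar (insert b l.toFinset)) :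
    ∃ p ∈ S.blowUps, ∃ l', GamRel n p.2 l' ∧ ∀ c, c ∈ l' ↔ c = b ∨ c ∈ l := by
  revert h hb hsimp
  rintro ⟨X, L, Y, s, e, l₁, l₂, l₃, rfl, hX, hL, hY, rfl⟩ hb hsimp
  obtain ⟨v1, v2, v3, v4⟩ := hsimp.1 b (by simp)
  have hlam : ∀ d ∈ l₁ ++ (l₂ ++ l₃), Laminar b d := fun d hd =>
    hsimp.2 b (by simp) d (Finset.mem_insert_of_mem (List.mem_toFinset.2 hd))
  have e1 := hX.le
  have e2 := hL.le
  have e3 := hY.le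
  have hlam1 : ∀ d ∈ l₁, Laminar b d := fun d hd => hlam d (by simp [hd])
  have hlam2 : ∀ d ∈ l₂, Laminar b d := fun d hd => hlam d (by simp [hd])
  have hlam3 : ∀ d ∈ l₃, Laminar b d := fun d hd => hlam d (by simp [hd])
  simp only [List.mem_append, not_or] at hb
  obtain ⟨hb1, hb2, hb3⟩ := hb
  -- it suffices to blow up one of the three parts
  have left : (∃ p ∈ wordBlowUps X, ∃ l', SquareWord false 1 2 p.2 s l' ∧
      ∀ d, d ∈ l' ↔ d = b ∨ d ∈ l₁) → ∃ p ∈ (PreTree.word (X ++ .opened 1 L :: Y)).blowUps,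
      ∃ l', GamRel n p.2 l' ∧ ∀ c, c ∈ l' ↔ c = b ∨ c ∈ l₁ ++ (l₂ ++ l₃) := by
    rintro ⟨p, hp, l', h', hl'⟩
    refine ⟨_, List.mem_map.2 ⟨_, mem_wordBlowUps_left hp, rfl⟩, _,
      ⟨_, _, _, _, _, _, _, _, rfl, h', hL, hY, rfl⟩, fun d => ?_⟩
    simp only [List.mem_append, hl', or_assoc]
  have right : (∃ p ∈ wordBlowUps Y, ∃ l', SquareWord true (n + 3) e p.2 (n + 2) l' ∧
      ∀ d, d ∈ l' ↔ d = b ∨ d ∈ l₃) → ∃ p ∈ (PreTree.word (X ++ .opened 1 L :: Y)).blowUps,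
      ∃ l', GamRel n p.2 l' ∧ ∀ c, c ∈ l' ↔ c = b ∨ c ∈ l₁ ++ (l₂ ++ l₃) := by
    rintro ⟨p, hp, l', h', hl'⟩
    obtain ⟨z, hz⟩ := mem_wordBlowUps_right (X := X) (S := .opened 1 L) hp
    refine ⟨_, List.mem_map.2 ⟨_, hz, rfl⟩, _,
      ⟨_, _, _, _, _, _, _, _, rfl, hX, hL, h', rfl⟩, fun d => ?_⟩
    simp only [List.mem_append, hl', or_left_comm]
  have middle : ∀ {q : ℤ × List STree} {X' L' Y' s' e' l₁' l₂' l₃'},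
      q ∈ (STree.opened 1 L).blowUps → X ++ (q.2 ++ Y) = X' ++ .opened 1 L' :: Y' →
      SquareWord false 1 2 X' s' l₁' → PlainForest s' L' e' l₂' →
      SquareWord true (n + 3) e' Y' (n + 2) l₃' →
      (∀ d, (d ∈ l₁' ∨ d ∈ l₂' ∨ d ∈ l₃') ↔ d = b ∨ d ∈ l₁ ∨ d ∈ l₂ ∨ d ∈ l₃) →
      ∃ p ∈ (PreTree.word (X ++ .opened 1 L :: Y)).blowUps,
      ∃ l', GamRel n p.2 l' ∧ ∀ c, c ∈ l' ↔ c = b ∨ c ∈ l₁ ++ (l₂ ++ l₃) := by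
    intro q X' L' Y' s' e' l₁' l₂' l₃' hq hV hX' hL' hY' hmem
    obtain ⟨z, hz⟩ := mem_wordBlowUps_middle (X := X) (Y := Y) hq
    refine ⟨_, List.mem_map.2 ⟨_, hz, rfl⟩, _,
      ⟨X', L', Y', s', e', l₁', l₂', l₃', by rw [hV], hX', hL', hY', rfl⟩, fun d => ?_⟩
    simp only [List.mem_append, hmem]
  obtain ⟨x, y⟩ := b
  simp only at v1 v2 v3 v4
  -- The largest brackets of the left and of the right part, present when these parts are not empty,
  -- keep the new bracket from crossing their boundary.
  have hs : 2 < s → (1, s) ∈ l₁ := hX.last_mem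
  have he : e < n + 2 → (e, n + 3) ∈ l₃ := hY.first_mem
  have hs' : 2 < s → Laminar (x, y) (1, s) := fun h => hlam1 _ (hs h)
  have he' : e < n + 2 → Laminar (x, y) (e, n + 3) := fun h => hlam3 _ (he h)
  simp only [Laminar] at hs' he'
  -- A bracket with the left letter cuts off a neutral tree on the left, one with the right letter
  -- cuts off a neutral tree on the right, and any other adds a round vertex in one of the three
  -- parts. Both letters together would give the whole word.
  rcases v1.eq_or_lt with rfl | hx
  · rcases lt_trichotomy y s with hys | rfl | hys
    · exact left (hX.exists_blowUp_cut (by simp [OutsideLetter]) (by omega) hys hlam1 hb1)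
    · exact absurd (hs (by omega)) hb1
    · have hye : y ≤ e := by omega
      obtain ⟨A, B, m₁, m₂, rfl, rfl, hA, hB⟩ := hL.exists_split hys.le hye fun d hd => by
        have h3 := hlam2 d hd
        have h4 := hL.bounds d hd
        simp only [Laminar] at h3
        omega
      have nA := hA.ne_nil_of_lt hys
      refine middle (q := (-1, [.neutral A, .opened 1 B])) (X' := X ++ [.neutral A]) ?_ (by simp)
        (hX.append (.cons nA hA (.nil _))) hB hY fun d => ?_
      · simp only [STree.blowUps, List.mem_append, List.mem_map, List.mem_filter]
        refine Or.inl (Or.inr ⟨(A, B), ⟨mem_cuts₂.2 rfl, ?_⟩, rfl⟩)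
        simpa using Nat.succ_le_of_lt (List.length_pos_of_ne_nil nA)
      · simp only [List.mem_append, List.mem_cons, List.append_nil, squareBracket,
          Bool.false_eq_true, if_false, or_assoc, or_left_comm]
  · rcases v3.eq_or_lt with rfl | hy
    · rcases lt_trichotomy e x with hex | rfl | hex
      · exact right (hY.exists_blowUp_cut (by simp [OutsideLetter]) hex (by omega) hlam3 hb3)
      · exact absurd (he (by omega)) hb3
      · have hsx : s ≤ x := by omega
        obtain ⟨A, B, m₁, m₂, rfl, rfl, hA, hB⟩ := hL.exists_split hsx hex.le fun d hd => by
          have h3 := hlam2 d hd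
          have h4 := hL.bounds d hd
          simp only [Laminar] at h3
          omega
        have nB := hB.ne_nil_of_lt hex
        refine middle (q := (sgn (forestNeutrals A), [.opened 1 A, .neutral B]))
          (Y' := .neutral B :: Y) ?_ (by simp) hX hA (.cons nB hB hY) fun d => ?_
        · simp only [STree.blowUps, List.mem_append, List.mem_map, List.mem_filter]
          refine Or.inl (Or.inl (Or.inr ⟨(A, B), ⟨mem_cuts₂.2 rfl, ?_⟩, rfl⟩))
          simpa using Nat.succ_le_of_lt (List.length_pos_of_ne_nil nB)
        · simp only [List.mem_append, List.mem_cons, squareBracket, if_true, or_assoc,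
            or_left_comm]
    · rcases Nat.lt_or_ge s y with hsy | hys
      · rcases Nat.lt_or_ge x e with hxe | hex
        · have hsx : s ≤ x := by omega
          have hye : y ≤ e := by omega
          rcases hL.exists_blowUp hsx v2 hye hlam2 hb2 with
            ⟨A, B, C, rfl, hB, -, k', h', hk'⟩ | ⟨p, hp, k', h', hk'⟩
          · refine middle (q := (sgn (forestNeutrals A), [.opened 1 (A ++ .neutral B :: C)])) ?_
              rfl hX h' hY fun d => ?_
            · simp only [STree.blowUps, List.mem_append, List.mem_map, List.mem_filter]
              refine Or.inl (Or.inl (Or.inl ⟨(A, B, C), ⟨mem_cuts₃.2 rfl, ?_⟩, rfl⟩))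
              simpa using hB
            · simp only [hk', or_assoc, or_left_comm]
          · refine middle (q := (p.1, [.opened 1 p.2])) ?_ rfl hX h' hY fun d => ?_
            · simp only [STree.blowUps, List.mem_append, List.mem_map]
              exact Or.inr ⟨p, hp, rfl⟩
            · simp only [hk', or_assoc, or_left_comm]
        · exact right (hY.exists_blowUp_round (by simp [OutsideLetter]) hex v2 (by omega)
            hlam3 hb3)
      · exact left (hX.exists_blowUp_round (by simp [OutsideLetter]) hx v2 hys hlam1 hb1)

theorem treeModel_Gam (n : ℕ) :
    TreeModel (Gam n) (PathVertex (n + 2)) Laminar (GamRel n) (sideSign false 1) where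
  sign b := by
    unfold sideSign
    split_ifs <;> norm_num
  top := by
    have := plainForest_leaves 1 n
    rw [show 1 + 1 + n = n + 2 by omega] at this
    exact ⟨[], leaves 1 n, [], 2, n + 2, [], [], [], rfl, .nil _, this, .nil _, rfl⟩
  det := by
    rintro S l l' ⟨X, L, Y, s, e, l₁, l₂, l₃, rfl, hX, hL, hY, rfl⟩
      ⟨X', L', Y', s', e', l₁', l₂', l₃', hS, hX', hL', hY', rfl⟩
    obtain ⟨rfl, h2, rfl⟩ := append_cons_inj (P := fun S => ∃ i L, S = STree.opened i L)
      (by simpa using hS) ⟨1, L, rfl⟩ ⟨1, L', rfl⟩ hX.not_opened hX'.not_opened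
    obtain rfl : L = L' := by simpa using h2
    obtain ⟨rfl, rfl⟩ := hX.det hX'
    obtain ⟨rfl, rfl⟩ := hL.det hL'
    obtain ⟨-, rfl⟩ := hY.det hY'
    rfl
  inj := by
    rintro S S' l l' ⟨X, L, Y, s, e, l₁, l₂, l₃, rfl, hX, hL, hY, rfl⟩
      ⟨X', L', Y', s', e', l₁', l₂', l₃', rfl, hX', hL', hY', rfl⟩ hl
    -- The boundaries of the open tree are recovered first; then bounds distribute the brackets over
    -- the three parts.
    obtain rfl : s = s' := le_antisymm
      (gamRel_inj_left hX' hL' hY' hX fun b hb => (hl b).1 hb)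
      (gamRel_inj_left hX hL hY hX' fun b hb => (hl b).2 hb)
    obtain rfl : e = e' := le_antisymm
      (gamRel_inj_right (l' := l₁' ++ l₂') hX hL hY hY' fun b hb => (hl b).2 (by simpa using hb))
      (gamRel_inj_right (l' := l₁ ++ l₂) hX' hL' hY' hY fun b hb => (hl b).1 (by simpa using hb))
    have e1 := hX.le
    have e2 := hL.le
    have e3 := hY.le
    simp only [List.mem_append] at hl
    have b1 := hX.bounds_left (by omega)
    have b1' := hX'.bounds_left (by omega)
    have b2 := hL.bounds
    have b2' := hL'.bounds
    have b3 := hY.bounds_right (by omega)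
    have b3' := hY'.bounds_right (by omega)
    have key : ∀ {m₁ m₂ m₃ m₁' m₂' m₃' : List (ℕ × ℕ)},
        (∀ b ∈ m₁, b.1 + 2 ≤ b.2 ∧ 2 < b.2 ∧ b.2 ≤ s ∧ (2 ≤ b.1 ∨ b.1 = 1)) →
        (∀ b ∈ m₂, s ≤ b.1 ∧ b.1 + 2 ≤ b.2 ∧ b.2 ≤ e) →
        (∀ b ∈ m₃, b.1 + 2 ≤ b.2 ∧ e ≤ b.1 ∧ b.1 < n + 2 ∧ (b.2 ≤ n + 2 ∨ b.2 = n + 3)) →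
        (∀ b ∈ m₁', b.1 + 2 ≤ b.2 ∧ 2 < b.2 ∧ b.2 ≤ s ∧ (2 ≤ b.1 ∨ b.1 = 1)) →
        (∀ b ∈ m₂', s ≤ b.1 ∧ b.1 + 2 ≤ b.2 ∧ b.2 ≤ e) →
        (∀ b ∈ m₃', b.1 + 2 ≤ b.2 ∧ e ≤ b.1 ∧ b.1 < n + 2 ∧ (b.2 ≤ n + 2 ∨ b.2 = n + 3)) →
        (∀ b, b ∈ m₁ ∨ b ∈ m₂ ∨ b ∈ m₃ → b ∈ m₁' ∨ b ∈ m₂' ∨ b ∈ m₃') →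
        ∀ b, (b ∈ m₁ → b ∈ m₁') ∧ (b ∈ m₂ → b ∈ m₂') ∧ (b ∈ m₃ → b ∈ m₃') := by
      intro m₁ m₂ m₃ m₁' m₂' m₃' b1 b2 b3 b1' b2' b3' h b
      refine ⟨fun hb => ?_, fun hb => ?_, fun hb => ?_⟩
      · have g := b1 b hb
        rcases h b (Or.inl hb) with h | h | h
        · exact h
        · have := b2' b h; omega
        · have := b3' b h; omega
      · have g := b2 b hb
        rcases h b (Or.inr (Or.inl hb)) with h | h | h
        · have := b1' b h; omega
        · exact h
        · have := b3' b h; omega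
      · have g := b3 b hb
        rcases h b (Or.inr (Or.inr hb)) with h | h | h
        · have := b1' b h; omega
        · have := b2' b h; omega
        · exact h
    have k1 := key b1 b2 b3 b1' b2' b3' fun b => (hl b).1
    have k2 := key b1' b2' b3' b1 b2 b3 fun b => (hl b).2
    rw [hX.inj (by simp [OutsideLetter]) hX' fun b => ⟨(k1 b).1, (k2 b).1⟩,
      hL.inj hL' fun b => ⟨(k1 b).2.1, (k2 b).2.1⟩,
      hY.inj (by simp [OutsideLetter]) hY' fun b => ⟨(k1 b).2.2, (k2 b).2.2⟩]
  simplex := by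
    rintro S l ⟨X, L, Y, s, e, l₁, l₂, l₃, rfl, hX, hL, hY, rfl⟩
    have e1 := hX.le
    have e2 := hL.le
    have e3 := hY.le
    have b1 := hX.bounds_left (by omega)
    have b2 := hL.bounds
    have b3 := hY.bounds_right (by omega)
    have c1 := hX.laminar (by simp [OutsideLetter])
    have c2 := hL.laminar
    have c3 := hY.laminar (by simp [OutsideLetter])
    refine ⟨fun b hb => ?_, fun b hb c hc => ?_⟩
    · simp only [List.mem_toFinset, List.mem_append] at hb
      unfold PathVertex
      rcases hb with hb | hb | hb
      · have := b1 b hb; omega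
      · have := b2 b hb; omega
      · have := b3 b hb; omega
    · simp only [List.mem_toFinset, List.mem_append] at hb hc
      rcases hb with hb | hb | hb <;> rcases hc with hc | hc | hc
      · exact c1 b hb c hc
      · have := b1 b hb; have := b2 c hc; exact Or.inl (by omega)
      · have := b1 b hb; have := b3 c hc; exact Or.inl (by omega)
      · have := b2 b hb; have := b1 c hc; exact Or.inr (Or.inl (by omega))
      · exact c2 b hb c hc
      · have := b2 b hb; have := b3 c hc; exact Or.inl (by omega)
      · have := b3 b hb; have := b1 c hc; exact Or.inr (Or.inl (by omega))
      · have := b3 b hb; have := b2 c hc; exact Or.inr (Or.inl (by omega))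
      · exact c3 b hb c hc
  blowUp := GamRel.blowUp
  exists_blowUp := GamRel.exists_blowUp


/-! ### Trees with a marked closed vertex -/

/-- Trees with a closed vertex labelled `1`, all of whose other closed vertices are leaves labelled
`a, …, c - 1`. A neutral vertex below the marked one contributes the pair `(e, s)`, where `[s, e)`
is the interval of leaves in the direction of the marked vertex; it stands for the arc formed by
the other leaves and the root. -/
inductive MarkedTree : ℕ → RTree → ℕ → List (ℕ × ℕ) → Prop
  | core {a c : ℕ} {L : List RTree} {l : List (ℕ × ℕ)} : PlainForest a L c l →
      MarkedTree a (.closed 1 L) c l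
  | node {a s e c : ℕ} {A C : List RTree} {t : RTree} {l₁ l₂ l₃ : List (ℕ × ℕ)} :
      A ≠ [] ∨ C ≠ [] → PlainForest a A s l₁ → MarkedTree s t e l₂ → PlainForest e C c l₃ →
      MarkedTree a (.neutral (A ++ t :: C)) c ((e, s) :: (l₁ ++ (l₂ ++ l₃)))

/-- An interval of leaves is nested in or disjoint from an arc containing the root. -/
def Apart (b d : ℕ × ℕ) : Prop := b.2 ≤ d.2 ∨ d.1 ≤ b.1 ∨ (d.2 ≤ b.1 ∧ b.2 ≤ d.1)

/-- Compatibility of arcs; the arcs containing the root are the pairs `b` with `b.2 ≤ b.1`. -/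
def ArcCompatible (b d : ℕ × ℕ) : Prop :=
  if b.1 < b.2 then if d.1 < d.2 then Laminar b d else Apart b d
  else if d.1 < d.2 then Apart d b else (b.2 ≤ d.2 ∧ d.1 ≤ b.1) ∨ (d.2 ≤ b.2 ∧ b.1 ≤ d.1)

/-- The arcs for a marked tree with leaves `a, …, c - 1`: intervals of at least two leaves and
complements of intervals which do not contain all leaves. -/
def ArcVertex (a c : ℕ) (b : ℕ × ℕ) : Prop :=
  (a ≤ b.1 ∧ b.1 + 2 ≤ b.2 ∧ b.2 ≤ c) ∨ (b.2 ≤ b.1 ∧ a ≤ b.2 ∧ b.1 ≤ c ∧ b.1 + a < c + b.2)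

/-- The sign of an arc. -/
def arcSign (b : ℕ × ℕ) : ℤ := if b.2 ≤ b.1 then -1 else 1

/-- For a block `Y` of the inputs of a spine vertex, the branch `t` towards the marked vertex lies
after the block, in it, or before it. -/
theorem three_cuts {α : Type} {X Y Z A C : List α} {t : α} (h : X ++ (Y ++ Z) = A ++ t :: C) :
    (∃ A₂, A = X ++ (Y ++ A₂) ∧ Z = A₂ ++ t :: C) ∨
    (∃ A₂ C₁, A = X ++ A₂ ∧ Y = A₂ ++ t :: C₁ ∧ C = C₁ ++ Z) ∨
    ∃ C₁, X = A ++ t :: C₁ ∧ C = C₁ ++ (Y ++ Z) := by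
  rcases List.append_eq_append_iff.1 h with ⟨A', rfl, h'⟩ | ⟨C', rfl, h'⟩
  · rcases List.append_eq_append_iff.1 h' with ⟨A₂, rfl, h''⟩ | ⟨C', rfl, h''⟩
    · exact Or.inl ⟨A₂, rfl, h''⟩
    · cases C' with
      | nil => exact Or.inl ⟨[], by simp, by simpa using h''.symm⟩
      | cons u C' =>
        obtain ⟨rfl, rfl⟩ := List.cons.inj h''
        exact Or.inr (Or.inl ⟨A', C', rfl, rfl, rfl⟩)
  · cases C' with
    | nil =>
      cases Y with
      | nil => exact Or.inl ⟨[], by simp, by simpa using h'.symm⟩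
      | cons u Y =>
        obtain ⟨rfl, rfl⟩ := List.cons.inj h'
        exact Or.inr (Or.inl ⟨[], Y, by simp, rfl, rfl⟩)
    | cons u C' =>
      obtain ⟨rfl, rfl⟩ := List.cons.inj h'
      exact Or.inr (Or.inr ⟨C', rfl, rfl⟩)

theorem mem_forestLabels {L : List RTree} {t : RTree} (ht : t ∈ L) {i : ℕ} (hi : i ∈ t.labels) :
    i ∈ forestLabels L := by
  obtain ⟨A, B, rfl⟩ := List.append_of_mem ht
  rw [forestLabels_append, forestLabels, Multiset.mem_add, Multiset.mem_add]
  exact Or.inr (Or.inl hi)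

theorem PlainForest.arcVertex {a c : ℕ} {L : List RTree} {l : List (ℕ × ℕ)}
    (h : PlainForest a L c l) : ∀ b ∈ l, b.1 < b.2 := fun b hb => by
  have := h.bounds b hb
  omega

namespace MarkedTree

variable {a c x y : ℕ} {t : RTree} {l : List (ℕ × ℕ)}

theorem le (h : MarkedTree a t c l) : a ≤ c := by
  induction h with
  | core h => exact h.le
  | node _ h₁ _ h₃ ih => exact h₁.le.trans (ih.trans h₃.le)

theorem length_eq (h : MarkedTree a t c l) : l.length = t.neutrals := by
  induction h with
  | core h => exact h.length_eq
  | node _ h₁ _ h₃ ih =>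
    simp [RTree.neutrals, forestNeutrals_append, forestNeutrals, h₁.length_eq, h₃.length_eq, ih]

theorem bounds (h : MarkedTree a t c l) : ∀ b ∈ l, ArcVertex a c b := by
  induction h with
  | core h => exact fun b hb => Or.inl (h.bounds b hb)
  | node hne h₁ h₂ h₃ ih =>
    intro b hb
    have e1 := h₁.le
    have e2 := h₂.le
    have e3 := h₃.le
    unfold ArcVertex at ih ⊢
    simp only [List.mem_cons, List.mem_append] at hb
    rcases hb with rfl | hb | hb | hb
    · right
      rcases hne with hne | hne
      · have := h₁.lt_of_ne_nil hne; simp only; omega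
      · have := h₃.lt_of_ne_nil hne; simp only; omega
    · have := h₁.bounds b hb; omega
    · have := ih b hb; omega
    · have := h₃.bounds b hb; omega

theorem one_mem_labels (h : MarkedTree a t c l) : 1 ∈ t.labels := by
  induction h with
  | core => simp [RTree.labels]
  | node _ _ _ _ ih => simp [RTree.labels, forestLabels_append, forestLabels, ih]

/-- As `2 ≤ a`, the label `1` does not occur in the plain forests, so the branch containing it is
the one towards the marked vertex. -/
theorem det {c' : ℕ} {l' : List (ℕ × ℕ)} (h : MarkedTree a t c l) (ha : 2 ≤ a)
    (h' : MarkedTree a t c' l') : c = c' ∧ l = l' := by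
  induction h generalizing c' l' with
  | core h =>
    cases h' with
    | core h' => exact h.det h'
  | node _ h₁ h₂ h₃ ih =>
    generalize hu : RTree.neutral _ = u at h'
    cases h' with
    | core => simp at hu
    | node _ h₁' h₂' h₃' =>
      have hno : ∀ {a s : ℕ} {A : List RTree} {l : List (ℕ × ℕ)}, 2 ≤ a → PlainForest a A s l →
          ∀ t ∈ A, ¬ 1 ∈ t.labels := by
        intro a s A l ha h t ht h1
        have := h.le_of_mem_labels 1 (mem_forestLabels ht h1)
        omega
      obtain ⟨rfl, rfl, rfl⟩ := append_cons_inj (P := fun t : RTree => 1 ∈ t.labels)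
        (RTree.neutral.inj hu) h₂.one_mem_labels h₂'.one_mem_labels (hno ha h₁) (hno ha h₁')
      obtain ⟨rfl, rfl⟩ := h₁.det h₁'
      obtain ⟨rfl, rfl⟩ := ih (ha.trans h₁.le) h₂'
      obtain ⟨rfl, rfl⟩ := h₃.det h₃'
      exact ⟨rfl, rfl⟩

theorem not_core {L : List RTree} {b : ℕ × ℕ} (h : PlainForest a L c l) (hb : b.2 ≤ b.1) :
    b ∉ l := fun hb' => by
  have := h.bounds b hb'
  omega

/-- How the arcs of a tree are distributed over the parts of the tree. -/
theorem separated {s e : ℕ} {A C A' C' : List RTree} {t' : RTree}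
    {l₁ l₂ l₃ l₁' l₂' l₃' : List (ℕ × ℕ)} (h₁ : PlainForest a A s l₁) (h₂ : MarkedTree s t e l₂)
    (h₃ : PlainForest e C c l₃) (h₁' : PlainForest a A' s l₁') (h₂' : MarkedTree s t' e l₂')
    (h₃' : PlainForest e C' c l₃')
    (h : ∀ b, b ∈ (e, s) :: (l₁ ++ (l₂ ++ l₃)) → b ∈ (e, s) :: (l₁' ++ (l₂' ++ l₃'))) (b : ℕ × ℕ) :
    (b ∈ l₁ → b ∈ l₁') ∧ (b ∈ l₂ → b ∈ l₂') ∧ (b ∈ l₃ → b ∈ l₃') := by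
  have e2 := h₂.le
  simp only [List.mem_cons, List.mem_append] at h
  have g2 := h₂.bounds b
  have g2' := h₂'.bounds b
  unfold ArcVertex at g2 g2'
  have g1 := h₁.bounds b
  have g1' := h₁'.bounds b
  have g3 := h₃.bounds b
  have g3' := h₃'.bounds b
  refine ⟨fun hb => ?_, fun hb => ?_, fun hb => ?_⟩
  · have := g1 hb
    rcases h b (Or.inr (Or.inl hb)) with rfl | h | h | h
    · simp only at this; omega
    · exact h
    · have := g2' h; omega
    · have := g3' h; omega
  · have := g2 hb
    rcases h b (Or.inr (Or.inr (Or.inl hb))) with rfl | h | h | h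
    · simp only at this; omega
    · have := g1' h; omega
    · exact h
    · have := g3' h; omega
  · have := g3 hb
    rcases h b (Or.inr (Or.inr (Or.inr hb))) with rfl | h | h | h
    · simp only at this; omega
    · have := g1' h; omega
    · have := g2' h; omega
    · exact h

/-- The spine arcs are nested and the root contributes the smallest one, which is therefore
determined. Its ends delimit the three parts of the tree. -/
theorem inj {t' : RTree} {l' : List (ℕ × ℕ)} (h : MarkedTree a t c l) (h' : MarkedTree a t' c l')
    (hl : ∀ b, b ∈ l ↔ b ∈ l') : t = t' := by
  induction h generalizing t' l' with
  | core h =>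
    cases h' with
    | core h' => rw [h.inj h' hl]
    | node _ _ h₂' =>
      exact absurd ((hl _).2 List.mem_cons_self) (not_core h h₂'.le)
  | node hne h₁ h₂ h₃ ih =>
    cases h' with
    | core h' => exact absurd ((hl _).1 List.mem_cons_self) (not_core h' h₂.le)
    | node hne' h₁' h₂' h₃' =>
      rename_i a s e c A C t l₁ l₂ l₃ s' e' A' C' t' l₁' l₂' l₃'
      have e2 := h₂.le
      have e2' := h₂'.le
      have k1 := (hl (e, s)).1 List.mem_cons_self
      have k2 := (hl (e', s')).2 List.mem_cons_self
      simp only [List.mem_cons, List.mem_append, not_core (b := (e', s')) h₁ e2',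
        not_core (b := (e', s')) h₃ e2', not_core (b := (e, s)) h₁' e2,
        not_core (b := (e, s)) h₃' e2, Prod.mk.injEq, false_or, or_false] at k1 k2
      obtain ⟨rfl, rfl⟩ : e = e' ∧ s = s' := by
        rcases k1 with k1 | k1
        · exact k1
        · rcases k2 with k2 | k2
          · exact ⟨k2.1.symm, k2.2.symm⟩
          -- If each root arc came from a spine vertex higher up in the other tree, each would
          -- enclose strictly fewer leaves than the other.
          · have := h₂'.bounds _ k1
            have := h₂.bounds _ k2
            simp only [ArcVertex] at *
            omega
      have s1 := separated h₁ h₂ h₃ h₁' h₂' h₃' fun b => (hl b).1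
      have s2 := separated h₁' h₂' h₃' h₁ h₂ h₃ fun b => (hl b).2
      rw [h₁.inj h₁' fun b => ⟨(s1 b).1, (s2 b).1⟩, ih h₂' fun b => ⟨(s1 b).2.1, (s2 b).2.1⟩,
        h₃.inj h₃' fun b => ⟨(s1 b).2.2, (s2 b).2.2⟩]

theorem _root_.RelBrace.ArcCompatible.symm {b d : ℕ × ℕ} (h : ArcCompatible b d) :
    ArcCompatible d b := by
  unfold ArcCompatible Laminar at *
  split_ifs at * <;> first | assumption | omega

theorem compatible (h : MarkedTree a t c l) : ∀ b ∈ l, ∀ d ∈ l, ArcCompatible b d := by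
  induction h with
  | core h =>
    intro b hb d hd
    rw [ArcCompatible, if_pos (h.arcVertex b hb), if_pos (h.arcVertex d hd)]
    exact h.laminar b hb d hd
  | node hne h₁ h₂ h₃ ih =>
    rename_i a s e c A C t l₁ l₂ l₃
    have e2 := h₂.le
    have g1 := h₁.bounds
    have g2 := h₂.bounds
    have g3 := h₃.bounds
    -- the cases in which the second arc comes from the same part or a later one
    have key : ∀ b d : ℕ × ℕ, (b = (e, s) ∧ (d = (e, s) ∨ d ∈ l₁ ∨ d ∈ l₂ ∨ d ∈ l₃)) ∨
        (b ∈ l₁ ∧ (d ∈ l₁ ∨ d ∈ l₂ ∨ d ∈ l₃)) ∨ (b ∈ l₂ ∧ (d ∈ l₂ ∨ d ∈ l₃)) ∨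
        (b ∈ l₃ ∧ d ∈ l₃) → ArcCompatible b d := by
      rintro b d (⟨rfl, rfl | hd | hd | hd⟩ | ⟨hb, hd | hd | hd⟩ | ⟨hb, hd | hd⟩ | ⟨hb, hd⟩)
      · rw [ArcCompatible, if_neg (by simpa using e2), if_neg (by simpa using e2)]
        simp
      · have := g1 d hd
        simp only [ArcCompatible, Apart]
        split_ifs <;> omega
      · have := g2 d hd
        simp only [ArcCompatible, Apart, ArcVertex] at *
        split_ifs <;> omega
      · have := g3 d hd
        simp only [ArcCompatible, Apart]
        split_ifs <;> omega
      · rw [ArcCompatible, if_pos (h₁.arcVertex b hb), if_pos (h₁.arcVertex d hd)]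
        exact h₁.laminar b hb d hd
      · have := g1 b hb
        have := g2 d hd
        simp only [ArcCompatible, Apart, Laminar, ArcVertex] at *
        split_ifs <;> omega
      · have := g1 b hb
        have := g3 d hd
        simp only [ArcCompatible, Apart, Laminar]
        split_ifs <;> omega
      · exact ih b hb d hd
      · have := g2 b hb
        have := g3 d hd
        simp only [ArcCompatible, Apart, Laminar, ArcVertex] at *
        split_ifs <;> omega
      · rw [ArcCompatible, if_pos (h₃.arcVertex b hb), if_pos (h₃.arcVertex d hd)]
        exact h₃.laminar b hb d hd
    intro b hb d hd
    simp only [List.mem_cons, List.mem_append] at hb hd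
    rcases hb with hb | hb | hb | hb <;> rcases hd with hd | hd | hd | hd <;>
      -- Compatibility is symmetric, so the remaining cases follow by exchanging the arcs.
      first
      | (refine key b d ?_; simp only [hb, hd, eq_self, true_and, true_or, or_true]; done)
      | (refine (key d b ?_).symm; simp only [hb, hd, eq_self, true_and, true_or, or_true])

/-! #### Blow-ups -/

theorem arcSign_plain {L : List RTree} {l m : List (ℕ × ℕ)} {b : ℕ × ℕ} {z : ℤ}
    (h : PlainForest a L c l) (hs : SignedPerm z l (b :: m)) : arcSign b = 1 := by
  rw [arcSign, if_neg]
  have := h.bounds b (hs.perm.mem_iff.2 List.mem_cons_self)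
  omega

/-- A block without the marked branch is grouped as in a plain forest. For a block with it, the new
upper vertex inherits the old arc `(e, s)` and the lower one gets the new arc `(y, x)`, already in
front; it is the old arc that passes `m₁`. Hence the factor `arcSign`. -/
theorem blowUp_root {s e : ℕ} {A C X Y Z : List RTree} {l₁ l₂ l₃ : List (ℕ × ℕ)}
    (hne : A ≠ [] ∨ C ≠ []) (h₁ : PlainForest a A s l₁) (h₂ : MarkedTree s t e l₂)
    (h₃ : PlainForest e C c l₃) (h : X ++ (Y ++ Z) = A ++ t :: C) (hY : 2 ≤ Y.length)
    (hXZ : Y.length < (A ++ t :: C).length) :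
    ∃ b l', MarkedTree a (.neutral (X ++ .neutral Y :: Z)) c l' ∧
      SignedPerm (arcSign b * -sgn (forestNeutrals X)) l' (b :: (e, s) :: (l₁ ++ (l₂ ++ l₃))) := by
  rcases three_cuts h with ⟨A₂, rfl, rfl⟩ | ⟨A₂, C₁, rfl, rfl, rfl⟩ | ⟨C₁, rfl, rfl⟩
  · obtain ⟨b, l', h', hs⟩ := h₁.group hY
    refine ⟨b, (e, s) :: (l' ++ (l₂ ++ l₃)), ?_, ((hs.append_right _).cons_move _).of_eq ?_⟩
    · simpa using MarkedTree.node (A := X ++ .neutral Y :: A₂) (by simp) h' h₂ h₃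
    · rw [arcSign_plain h' hs, one_mul]
  · obtain ⟨x, m₁, m₂, rfl, hX, hA⟩ := h₁.split
    obtain ⟨y, n₁, n₂, rfl, hC, hZ⟩ := h₃.split
    refine ⟨(y, x), (y, x) :: (m₁ ++ ((e, s) :: (m₂ ++ (l₂ ++ n₁)) ++ n₂)), ?_, ?_⟩
    · refine MarkedTree.node ?_ hX (.node ?_ hA h₂ hC) hZ
      · rw [← List.length_pos_iff, ← List.length_pos_iff]
        simp at hXZ
        omega
      · rw [← List.length_pos_iff, ← List.length_pos_iff]
        simp at hY
        omega
    · have hs := (SignedPerm.move m₁ (e, s) (m₂ ++ (l₂ ++ n₁) ++ n₂)).cons (y, x)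
      have hle : x ≤ y := hA.le.trans (h₂.le.trans hC.le)
      rw [hX.length_eq] at hs
      simpa [arcSign, hle] using hs
  · obtain ⟨b, l', h', hs⟩ := h₃.group hY
    refine ⟨b, (e, s) :: (l₁ ++ (l₂ ++ l')), ?_,
      (((hs.append_move l₂).append_move l₁).cons_move _).of_eq ?_⟩
    · simpa using MarkedTree.node (C := C₁ ++ .neutral Y :: Z) (by simp) h₁ h₂ h'
    · rw [arcSign_plain h' hs, h₁.length_eq, h₂.length_eq, forestNeutrals_append, forestNeutrals]
      simp only [sgn, pow_add]
      ring

theorem blowUp (h : MarkedTree a t c l) : ∀ p ∈ t.blowUps, ∃ b l', MarkedTree a p.2 c l' ∧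
    SignedPerm (arcSign b * p.1) l' (b :: l) := by
  induction h with
  | core h =>
    intro p hp
    simp only [RTree.blowUps, closedRootBlowUps, List.mem_append, List.mem_map, List.mem_filter,
      mem_cuts₃, decide_eq_true_eq] at hp
    rcases hp with (⟨q, ⟨rfl, hl⟩, rfl⟩ | ⟨q, ⟨rfl, hl⟩, rfl⟩) | ⟨q, hq, rfl⟩
    · obtain ⟨x, l₁, m, rfl, hA, h⟩ := h.split
      obtain ⟨y, l₂, l₃, rfl, hB, hC⟩ := h.split
      -- The new neutral root comes first in the order of the vertices, so nothing has to move and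
      -- `arcSign` cancels the sign `-1` of the blow-up.
      refine ⟨(y, x), _, .node ?_ hA (.core hB) hC, (SignedPerm.refl _).of_eq ?_⟩
      · rw [← List.length_pos_iff, ← List.length_pos_iff]
        omega
      · simp [arcSign, hB.le]
    · obtain ⟨b, l', h', hs⟩ := h.group hl
      exact ⟨b, l', .core h', hs.of_eq (by rw [arcSign_plain h' hs, one_mul])⟩
    · obtain ⟨b, l', h', hs⟩ := h.blowUp q hq
      exact ⟨b, l', .core h', hs.of_eq (by rw [arcSign_plain h' hs, one_mul])⟩
  | node hne h₁ h₂ h₃ ih =>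
    rename_i a s e c A C t l₁ l₂ l₃
    intro p hp
    simp only [RTree.blowUps, neutralRootBlowUps, List.mem_append, List.mem_map, List.mem_filter,
      mem_cuts₃, decide_eq_true_eq, mem_forestBlowUps_append] at hp
    rcases hp with ⟨q, ⟨hq, hlen⟩, rfl⟩ | ⟨_, ⟨q, hq, rfl⟩ | ⟨q, hq, rfl⟩, rfl⟩
    · exact blowUp_root hne h₁ h₂ h₃ hq hlen.1 hlen.2
    · obtain ⟨b, l', h', hs⟩ := h₁.blowUp q hq
      refine ⟨b, _, .node ?_ h' h₂ h₃, ((hs.append_right _).cons_move _).of_eq ?_⟩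
      · rwa [← List.length_pos_iff, (forestBlowUps_spec _ q hq).2.1, List.length_pos_iff]
      · rw [arcSign_plain h' hs, one_mul]
    · simp only [forestBlowUps, List.mem_append, List.mem_map] at hq
      rcases hq with ⟨q, hq, rfl⟩ | ⟨q, hq, rfl⟩
      · obtain ⟨b, l', h', hs⟩ := ih q hq
        refine ⟨b, _, .node hne h₁ h' h₃,
          (((hs.append_right l₃).append_move l₁).cons_move _).of_eq ?_⟩
        rw [h₁.length_eq]
        ring
      · obtain ⟨b, l', h', hs⟩ := h₃.blowUp q hq
        refine ⟨b, _, .node ?_ h₁ h₂ h',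
          (((hs.append_move l₂).append_move l₁).cons_move _).of_eq ?_⟩
        · refine hne.imp_right fun hC => ?_
          rwa [← List.length_pos_iff, (forestBlowUps_spec _ q hq).2.1, List.length_pos_iff]
        · rw [arcSign_plain h' hs, h₁.length_eq, h₂.length_eq]
          ring

theorem mem_blowUps_group {X Y Z : List RTree} {L : List RTree} (h : X ++ (Y ++ Z) = L)
    (hY : 2 ≤ Y.length) (hXZ : X ≠ [] ∨ Z ≠ []) :
    ∃ z, (z, RTree.neutral (X ++ .neutral Y :: Z)) ∈ (RTree.neutral L).blowUps := by
  subst h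
  refine ⟨-sgn (forestNeutrals X), ?_⟩
  rw [RTree.blowUps, neutralRootBlowUps, List.mem_append, List.mem_map]
  refine Or.inl ⟨(X, Y, Z), List.mem_filter.2 ⟨mem_cuts₃.2 rfl, ?_⟩, rfl⟩
  rw [← List.length_pos_iff, ← List.length_pos_iff] at hXZ
  simp only [List.length_append, decide_eq_true_eq]
  omega

theorem mem_blowUps_forest {L : List RTree} {p : ℤ × List RTree} (hp : p ∈ forestBlowUps L) :
    ∃ z, (z, RTree.neutral p.2) ∈ (RTree.neutral L).blowUps := by
  refine ⟨-p.1, ?_⟩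
  rw [RTree.blowUps, List.mem_append]
  exact Or.inr (List.mem_map.2 ⟨p, hp, rfl⟩)

/-- By compatibility with the root arc, the interval lies to the left of the marked branch, to the
right of it, or within it. -/
theorem exists_blowUp_plain (h : MarkedTree a t c l) (hax : a ≤ x) (hxy : x + 2 ≤ y) (hyc : y ≤ c)
    (hl : ∀ b ∈ l, ArcCompatible (x, y) b) (hn : (x, y) ∉ l) :
    ∃ p ∈ t.blowUps, ∃ l', MarkedTree a p.2 c l' ∧ ∀ d, d ∈ l' ↔ d = (x, y) ∨ d ∈ l := by
  have hlam : ∀ {a c : ℕ} {L : List RTree} {m : List (ℕ × ℕ)}, PlainForest a L c m →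
      (∀ b ∈ m, ArcCompatible (x, y) b) → ∀ b ∈ m, Laminar (x, y) b := by
    intro a c L m h hm b hb
    have := hm b hb
    rwa [ArcCompatible, if_pos (show x < y by omega), if_pos (h.arcVertex b hb)] at this
  induction h with
  | core h =>
    rcases h.exists_blowUp hax hxy hyc (hlam h hl) hn with
      ⟨A, B, C, rfl, hB, -, k', h', hk'⟩ | ⟨p, hp, k', h', hk'⟩
    · refine ⟨(sgn (forestNeutrals A), .closed 1 (A ++ .neutral B :: C)), ?_, k', .core h', hk'⟩
      simp only [RTree.blowUps, closedRootBlowUps, List.mem_append, List.mem_map, List.mem_filter]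
      refine Or.inl (Or.inr ⟨(A, B, C), ⟨mem_cuts₃.2 rfl, ?_⟩, rfl⟩)
      simpa using hB
    · refine ⟨(p.1, .closed 1 p.2), ?_, k', .core h', hk'⟩
      rw [RTree.blowUps, List.mem_append]
      exact Or.inr (List.mem_map.2 ⟨p, hp, rfl⟩)
  | node hne h₁ h₂ h₃ ih =>
    rename_i a s e c A C t l₁ l₂ l₃
    have e2 := h₂.le
    simp only [List.mem_cons, List.mem_append, not_or] at hl hn
    have hse := hl (e, s) (Or.inl rfl)
    rw [ArcCompatible, if_pos (show x < y by omega), if_neg (by simpa using e2)] at hse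
    rcases hse with hys | hex | ⟨hsx, hye⟩
    · rcases h₁.exists_blowUp hax hxy hys (hlam h₁ fun d hd => hl d (Or.inr (Or.inl hd))) hn.2.1
        with ⟨X, Y, Z, rfl, hY, -, k', h', hk'⟩ | ⟨p, hp, k', h', hk'⟩
      · obtain ⟨z, hz⟩ := mem_blowUps_group (X := X) (Y := Y) (Z := Z ++ t :: C)
          (L := X ++ (Y ++ Z) ++ t :: C) (by simp) hY (by simp)
        refine ⟨_, hz, (e, s) :: (k' ++ (l₂ ++ l₃)), ?_, fun d => ?_⟩
        · simpa using MarkedTree.node (A := X ++ .neutral Y :: Z) (by simp) h' h₂ h₃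
        · simp only [List.mem_cons, List.mem_append, hk', or_assoc, or_left_comm]
      · obtain ⟨z, hz⟩ := mem_blowUps_forest
          (mem_forestBlowUps_append.2 (Or.inl ⟨p, hp, rfl⟩) :
            (p.1, p.2 ++ t :: C) ∈ forestBlowUps (A ++ t :: C))
        refine ⟨_, hz, (e, s) :: (k' ++ (l₂ ++ l₃)), .node ?_ h' h₂ h₃, fun d => ?_⟩
        · rwa [← List.length_pos_iff, (forestBlowUps_spec _ p hp).2.1, List.length_pos_iff]
        · simp only [List.mem_cons, List.mem_append, hk', or_assoc, or_left_comm]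
    · rcases h₃.exists_blowUp hex hxy hyc
          (hlam h₃ fun d hd => hl d (Or.inr (Or.inr (Or.inr hd)))) hn.2.2.2
        with ⟨X, Y, Z, rfl, hY, -, k', h', hk'⟩ | ⟨p, hp, k', h', hk'⟩
      · obtain ⟨z, hz⟩ := mem_blowUps_group (X := A ++ t :: X) (Y := Y) (Z := Z)
          (L := A ++ t :: (X ++ (Y ++ Z))) (by simp) hY (by simp)
        refine ⟨_, hz, (e, s) :: (l₁ ++ (l₂ ++ k')), ?_, fun d => ?_⟩
        · simpa using MarkedTree.node (C := X ++ .neutral Y :: Z) (by simp) h₁ h₂ h'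
        · simp only [List.mem_cons, List.mem_append, hk', or_left_comm]
      · have hp' : (sgn (forestNeutrals A) * (sgn t.neutrals * p.1), A ++ t :: p.2) ∈
            forestBlowUps (A ++ t :: C) := by
          refine mem_forestBlowUps_append.2 (Or.inr ⟨(sgn t.neutrals * p.1, t :: p.2), ?_, rfl⟩)
          rw [forestBlowUps, List.mem_append]
          exact Or.inr (List.mem_map.2 ⟨p, hp, rfl⟩)
        obtain ⟨z, hz⟩ := mem_blowUps_forest hp'
        refine ⟨_, hz, (e, s) :: (l₁ ++ (l₂ ++ k')), .node ?_ h₁ h₂ h', fun d => ?_⟩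
        · refine hne.imp_right fun hC => ?_
          rwa [← List.length_pos_iff, (forestBlowUps_spec _ p hp).2.1, List.length_pos_iff]
        · simp only [List.mem_cons, List.mem_append, hk', or_left_comm]
    · obtain ⟨p, hp, k', h', hk'⟩ := ih hsx hye (fun d hd => hl d (Or.inr (Or.inr (Or.inl hd))))
        hn.2.2.1
      have hp' : (sgn (forestNeutrals A) * p.1, A ++ p.2 :: C) ∈ forestBlowUps (A ++ t :: C) := by
        refine mem_forestBlowUps_append.2 (Or.inr ⟨(p.1, p.2 :: C), ?_, rfl⟩)
        rw [forestBlowUps, List.mem_append]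
        exact Or.inl (List.mem_map.2 ⟨p, hp, rfl⟩)
      obtain ⟨z, hz⟩ := mem_blowUps_forest hp'
      refine ⟨_, hz, (e, s) :: (l₁ ++ (k' ++ l₃)), .node hne h₁ h' h₃, fun d => ?_⟩
      simp only [List.mem_cons, List.mem_append, hk', or_assoc, or_left_comm]

/-- The new vertex is put on the spine at the place given by the order of the nested spine arcs:
just below the first spine vertex whose arc contains the new one, or just below the closed vertex.
-/
theorem exists_blowUp_spine (h : MarkedTree a t c l) (hyx : y ≤ x) (hay : a ≤ y) (hxc : x ≤ c)
    (hlt : x + a < c + y) (hl : ∀ b ∈ l, ArcCompatible (x, y) b) (hn : (x, y) ∉ l) :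
    ∃ p ∈ t.blowUps, ∃ l', MarkedTree a p.2 c l' ∧ ∀ d, d ∈ l' ↔ d = (x, y) ∨ d ∈ l := by
  have hapart : ∀ {a c : ℕ} {L : List RTree} {m : List (ℕ × ℕ)}, PlainForest a L c m →
      (∀ b ∈ m, ArcCompatible (x, y) b) → ∀ b ∈ m, Apart b (x, y) := by
    intro a c L m h hm b hb
    have := hm b hb
    rwa [ArcCompatible, if_neg (show ¬ x < y by omega), if_pos (h.arcVertex b hb)] at this
  induction h with
  | core h =>
    have hap := hapart h hl
    unfold Apart at hap
    obtain ⟨A, L, l₁, m, rfl, rfl, hA, h⟩ := h.exists_split hay (hyx.trans hxc) fun d hd => by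
      have h1 := hap d hd
      simp only at h1
      omega
    obtain ⟨B, C, l₂, l₃, rfl, rfl, hB, hC⟩ := h.exists_split hyx hxc fun d hd => by
      have h1 := hap d (by simp [hd])
      have h2 := h.bounds d hd
      simp only at h1
      omega
    have hne : A ≠ [] ∨ C ≠ [] := by
      by_contra hcon
      simp only [not_or, not_not] at hcon
      obtain ⟨rfl, rfl⟩ := hcon
      cases hA
      cases hC
      omega
    refine ⟨(-1, .neutral (A ++ .closed 1 B :: C)), ?_, _, .node hne hA (.core hB) hC, fun d => ?_⟩
    · simp only [RTree.blowUps, closedRootBlowUps, List.mem_append, List.mem_map, List.mem_filter]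
      refine Or.inl (Or.inl ⟨(A, B, C), ⟨mem_cuts₃.2 rfl, ?_⟩, rfl⟩)
      rw [← List.length_pos_iff, ← List.length_pos_iff] at hne
      simp only [decide_eq_true_eq]
      omega
    · simp
  | node hne h₁ h₂ h₃ ih =>
    rename_i a s e c A C t l₁ l₂ l₃
    have e2 := h₂.le
    simp only [List.mem_cons, List.mem_append, not_or] at hl hn
    have hse := hl (e, s) (Or.inl rfl)
    rw [ArcCompatible, if_neg (show ¬ x < y by omega), if_neg (by simpa using e2)] at hse
    simp only at hse
    simp only [Prod.mk.injEq] at hn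
    -- Either the new arc contains that of the root and the new vertex goes into the branch, or it
    -- is contained in it and the new vertex becomes the root.
    by_cases hin : s ≤ y ∧ x ≤ e
    · obtain ⟨p, hp, k', h', hk'⟩ := ih hin.1 hin.2 (by omega)
        (fun d hd => hl d (Or.inr (Or.inr (Or.inl hd)))) hn.2.2.1
      have hp' : (sgn (forestNeutrals A) * p.1, A ++ p.2 :: C) ∈ forestBlowUps (A ++ t :: C) := by
        refine mem_forestBlowUps_append.2 (Or.inr ⟨(p.1, p.2 :: C), ?_, rfl⟩)
        rw [forestBlowUps, List.mem_append]
        exact Or.inl (List.mem_map.2 ⟨p, hp, rfl⟩)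
      obtain ⟨z, hz⟩ := mem_blowUps_forest hp'
      refine ⟨_, hz, (e, s) :: (l₁ ++ (k' ++ l₃)), .node hne h₁ h' h₃, fun d => ?_⟩
      simp only [List.mem_cons, List.mem_append, hk', or_assoc, or_left_comm]
    · have hys : y ≤ s := by omega
      have hex : e ≤ x := by omega
      have hap1 := hapart h₁ fun d hd => hl d (Or.inr (Or.inl hd))
      have hap3 := hapart h₃ fun d hd => hl d (Or.inr (Or.inr (Or.inr hd)))
      unfold Apart at hap1 hap3
      obtain ⟨A₁, A₂, m₁, m₂, rfl, rfl, hA₁, hA₂⟩ := h₁.exists_split hay hys fun d hd => by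
        have h1 := hap1 d hd
        have h2 := h₁.bounds d hd
        simp only at h1
        omega
      obtain ⟨C₁, C₂, n₁, n₂, rfl, rfl, hC₁, hC₂⟩ := h₃.exists_split hex hxc fun d hd => by
        have h1 := hap3 d hd
        have h2 := h₃.bounds d hd
        simp only at h1
        omega
      have hout : A₁ ≠ [] ∨ C₂ ≠ [] := by
        by_contra hcon
        simp only [not_or, not_not] at hcon
        obtain ⟨rfl, rfl⟩ := hcon
        cases hA₁
        cases hC₂
        omega
      -- Otherwise the new arc would be that of the root, which is already present.
      have hinn : A₂ ≠ [] ∨ C₁ ≠ [] := by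
        by_contra hcon
        simp only [not_or, not_not] at hcon
        obtain ⟨rfl, rfl⟩ := hcon
        cases hA₂
        cases hC₁
        exact hn.1 ⟨rfl, rfl⟩
      obtain ⟨z, hz⟩ := mem_blowUps_group (X := A₁) (Y := A₂ ++ t :: C₁) (Z := C₂)
        (L := A₁ ++ A₂ ++ t :: (C₁ ++ C₂)) (by simp)
        (by
          rw [← List.length_pos_iff, ← List.length_pos_iff] at hinn
          simp only [List.length_append, List.length_cons]
          omega) hout
      refine ⟨_, hz, _, .node hout hA₁ (.node hinn hA₂ h₂ hC₁) hC₂, fun d => ?_⟩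
      simp only [List.mem_cons, List.mem_append, or_assoc, or_left_comm]

end MarkedTree

/-- The trees below `M n`. -/
def MRel (n : ℕ) (S : PreTree) (l : List (ℕ × ℕ)) : Prop :=
  ∃ t, S = .tree t ∧ MarkedTree 2 t (n + 2) l

theorem treeModel_M (n : ℕ) :
    TreeModel (M n) (ArcVertex 2 (n + 2)) ArcCompatible (MRel n) arcSign where
  sign b := by
    unfold arcSign
    split_ifs <;> norm_num
  top := by
    have := plainForest_leaves 1 n
    rw [show 1 + 1 + n = n + 2 by omega] at this
    exact ⟨_, rfl, .core this⟩
  det := by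
    rintro S l l' ⟨t, rfl, h⟩ ⟨t', ht, h'⟩
    obtain rfl : t = t' := by simpa using ht
    exact (h.det le_rfl h').2
  inj := by
    rintro S S' l l' ⟨t, rfl, h⟩ ⟨t', rfl, h'⟩ hl
    rw [h.inj h' hl]
  simplex := by
    rintro S l ⟨t, rfl, h⟩
    exact ⟨fun b hb => h.bounds b (List.mem_toFinset.1 hb), fun b hb d hd =>
      h.compatible b (List.mem_toFinset.1 hb) d (List.mem_toFinset.1 hd)⟩
  blowUp := by
    rintro S l p ⟨t, rfl, h⟩ hp
    obtain ⟨q, hq, rfl⟩ := List.mem_map.1 hp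
    obtain ⟨b, l', h', hs⟩ := h.blowUp q hq
    exact ⟨b, l', ⟨_, rfl, h'⟩, hs⟩
  exists_blowUp := by
    rintro S l ⟨x, y⟩ ⟨t, rfl, h⟩ hb hsimp
    have hc : ∀ d ∈ l, ArcCompatible (x, y) d := fun d hd =>
      hsimp.2 _ (by simp) d (Finset.mem_insert_of_mem (List.mem_toFinset.2 hd))
    have : ∃ p ∈ t.blowUps, ∃ l', MarkedTree 2 p.2 (n + 2) l' ∧
        ∀ d, d ∈ l' ↔ d = (x, y) ∨ d ∈ l := by
      rcases hsimp.1 (x, y) (by simp) with ⟨v1, v2, v3⟩ | ⟨v1, v2, v3, v4⟩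
      · exact h.exists_blowUp_plain v1 v2 v3 hc hb
      · exact h.exists_blowUp_spine v1 v2 v3 v4 hc hb
    obtain ⟨p, hp, l', h', hl'⟩ := this
    exact ⟨_, List.mem_map.2 ⟨p, hp, rfl⟩, l', ⟨_, rfl, h'⟩, hl'⟩


/-! ### Bracketings as simplices -/

/-- A flag complex is determined by its vertices and edges, so a bijection of vertices respecting
compatibility induces an isomorphism of posets of simplices. -/
theorem exists_simplex_equiv {β β' : Type} [Nonempty β] [DecidableEq β'] {V : β → Prop} {C : β → β → Prop}
    {V' : β' → Prop} {C' : β' → β' → Prop} (f : β → β') (hV : ∀ b, V b → V' (f b))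
    (hinj : ∀ b c, V b → V c → f b = f c → b = c) (hsurj : ∀ b', V' b' → ∃ b, V b ∧ f b = b')
    (hC : ∀ b c, V b → V c → (C b c ↔ C' (f b) (f c))) :
    ∃ e : {A : Finset β // IsSimplex V C A} ≃ {A : Finset β' // IsSimplex V' C' A},
      ∀ A B, A.1 ⊆ B.1 ↔ (e A).1 ⊆ (e B).1 := by
  classical
  have him : ∀ A : Finset β, IsSimplex V C A → IsSimplex V' C' (A.image f) := by
    intro A hA
    refine ⟨?_, ?_⟩
    · simp only [Finset.forall_mem_image]
      exact fun b hb => hV b (hA.1 b hb)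
    · simp only [Finset.forall_mem_image]
      exact fun b hb c hc => (hC b c (hA.1 b hb) (hA.1 c hc)).1 (hA.2 b hb c hc)
  let F : {A : Finset β // IsSimplex V C A} → {A : Finset β' // IsSimplex V' C' A} :=
    fun A => ⟨A.1.image f, him A.1 A.2⟩
  have hF : ∀ A B, A.1 ⊆ B.1 ↔ (F A).1 ⊆ (F B).1 := by
    refine fun A B => ⟨fun h => Finset.image_subset_image h, fun h b hb => ?_⟩
    obtain ⟨c, hc, hcb⟩ := Finset.mem_image.1 (h (Finset.mem_image_of_mem f hb))
    exact hinj c b (B.2.1 c hc) (A.2.1 b hb) hcb ▸ hc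
  refine ⟨Equiv.ofBijective F ⟨fun A B h => ?_, fun A => ?_⟩, hF⟩
  · exact Subtype.ext (((hF A B).2 (h ▸ subset_rfl)).antisymm ((hF B A).2 (h ▸ subset_rfl)))
  · choose! g hg using hsurj
    have hA : IsSimplex V C (A.1.image g) := by
      refine ⟨?_, ?_⟩
      · simp only [Finset.forall_mem_image]
        exact fun b hb => (hg b (A.2.1 b hb)).1
      · simp only [Finset.forall_mem_image]
        intro b hb c hc
        obtain ⟨v, hv⟩ := hg b (A.2.1 b hb)
        obtain ⟨w, hw⟩ := hg c (A.2.1 c hc)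
        rw [hC _ _ v w, hv, hw]
        exact A.2.2 b hb c hc
    refine ⟨⟨A.1.image g, hA⟩, Subtype.ext ?_⟩
    change (A.1.image g).image f = A.1
    rw [Finset.image_image]
    exact (Finset.image_congr fun b hb => (hg b (A.2.1 b hb)).2).trans Finset.image_id

/-- The set of letters of the interval given by its first letter and the letter after its last
one, for letters numbered from `1`. -/
def letters (m : ℕ) (b : ℕ × ℕ) : Finset (Fin m) :=
  Finset.univ.filter fun i => b.1 ≤ i.1 + 1 ∧ i.1 + 1 < b.2

theorem mem_letters {m : ℕ} {b : ℕ × ℕ} {i : Fin m} :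
    i ∈ letters m b ↔ b.1 ≤ i.1 + 1 ∧ i.1 + 1 < b.2 := by
  simp [letters]

theorem letters_subset {m : ℕ} {b c : ℕ × ℕ} (hb : PathVertex m b) :
    letters m b ⊆ letters m c ↔ c.1 ≤ b.1 ∧ b.2 ≤ c.2 := by
  obtain ⟨h1, h2, h3, -⟩ := hb
  refine ⟨fun h => ?_, fun h i hi => ?_⟩
  -- It suffices to test the first and the last letter; positions in `Fin m` are one less than the
  -- letters, and `b.2` lies one beyond the last letter.
  · have k1 := mem_letters.1 (@h ⟨b.1 - 1, by omega⟩ (mem_letters.2 (by simp only; omega)))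
    have k2 := mem_letters.1 (@h ⟨b.2 - 2, by omega⟩ (mem_letters.2 (by simp only; omega)))
    simp only at k1 k2
    omega
  · rw [mem_letters] at *
    omega

theorem disjoint_letters {m : ℕ} {b c : ℕ × ℕ} (hb : PathVertex m b) (hc : PathVertex m c) :
    Disjoint (letters m b) (letters m c) ↔ b.2 ≤ c.1 ∨ c.2 ≤ b.1 := by
  obtain ⟨h1, h2, h3, -⟩ := hb
  obtain ⟨k1, k2, k3, -⟩ := hc
  rw [Finset.disjoint_left]
  refine ⟨fun h => ?_, fun h i hi hi' => ?_⟩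
  · by_contra hn
    -- If the intervals overlap, the later of the two first letters is common.
    refine @h ⟨max b.1 c.1 - 1, by omega⟩ (mem_letters.2 ?_) (mem_letters.2 ?_) <;>
      · simp only
        omega
  · rw [mem_letters] at *
    omega

theorem exists_pathBracketing_equiv (m : ℕ) :
    ∃ e : {A : Finset (ℕ × ℕ) // IsSimplex (PathVertex m) Laminar A} ≃ PathBracketing m,
      ∀ A B, A.1 ⊆ B.1 ↔ e B ≤ e A := by
  refine exists_simplex_equiv (V := PathVertex m) (C := Laminar)
    (V' := fun B : Finset (Fin m) => (∃ i j : Fin m, i < j ∧ B = Finset.Icc i j) ∧ B ≠ Finset.univ)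
    (C' := fun B C => B ⊆ C ∨ C ⊆ B ∨ Disjoint B C) (letters m) ?_ ?_ ?_ ?_
  · rintro b ⟨h1, h2, h3, h4⟩
    refine ⟨⟨⟨b.1 - 1, by omega⟩, ⟨b.2 - 2, by omega⟩, ?_, ?_⟩, fun h => h4 ?_⟩
    · rw [Fin.lt_def]
      simp only
      omega
    · ext i
      rw [mem_letters, Finset.mem_Icc, Fin.le_def, Fin.le_def]
      simp only
      omega
    · have k1 := mem_letters.1 (h ▸ Finset.mem_univ (⟨0, by omega⟩ : Fin m))
      have k2 := mem_letters.1 (h ▸ Finset.mem_univ (⟨m - 1, by omega⟩ : Fin m))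
      simp only at k1 k2
      omega
  · intro b c hb hc h
    have h1 := (letters_subset (c := c) hb).1 h.subset
    have h2 := (letters_subset (c := b) hc).1 h.symm.subset
    exact Prod.ext (by omega) (by omega)
  · rintro B ⟨⟨i, j, hij, rfl⟩, hB⟩
    have e : letters m (i.1 + 1, j.1 + 2) = Finset.Icc i j := by
      ext k
      rw [mem_letters, Finset.mem_Icc, Fin.le_def, Fin.le_def]
      simp only
      omega
    refine ⟨(i.1 + 1, j.1 + 2), ⟨by simp, ?_, ?_, fun h => hB ?_⟩, e⟩
    · simp only
      rw [Fin.lt_def] at hij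
      omega
    · simp only
      omega
    · rw [← e, Finset.eq_univ_iff_forall]
      intro k
      rw [mem_letters]
      simp only at h ⊢
      omega
  · intro b c hb hc
    rw [letters_subset hb, letters_subset hc, disjoint_letters hb hc, Laminar]
    omega

theorem val_sub_eq {n : ℕ} (a b : Fin (n + 1)) :
    (a - b).1 = if b.1 ≤ a.1 then a.1 - b.1 else n + 1 + a.1 - b.1 := by
  split_ifs with h
  · exact Fin.coe_sub_iff_le.2 h
  · exact Fin.coe_sub_iff_lt.2 (not_le.1 h)

/-- The right side lists the cyclic orders in which, starting from `c`, one meets `a` no later than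
`b`. It turns all conditions on arcs into linear arithmetic. -/
theorem sub_le_sub_iff_cyclic {n : ℕ} {a b c : Fin (n + 1)} : a - c ≤ b - c ↔
    (c.1 ≤ a.1 ∧ a.1 ≤ b.1) ∨ (b.1 < c.1 ∧ c.1 ≤ a.1) ∨ (a.1 ≤ b.1 ∧ b.1 < c.1) := by
  have := a.2
  have := b.2
  simp only [Fin.le_def, val_sub_eq]
  split_ifs <;> omega

/-- Two arcs that meet have a common letter which is the first letter of one of them. -/
theorem disjoint_arc {n : ℕ} {b c : Fin (n + 1) × Fin (n + 1)} :
    Disjoint (arc b) (arc c) ↔ ¬ b.1 - c.1 ≤ c.2 - c.1 ∧ ¬ c.1 - b.1 ≤ b.2 - b.1 := by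
  rw [Finset.disjoint_left]
  simp only [arc, Finset.mem_filter, Finset.mem_univ, true_and]
  refine ⟨fun h => ⟨h (by simp), fun h' => h h' (by simp)⟩, fun h a ha ha' => ?_⟩
  simp only [sub_le_sub_iff_cyclic] at *
  omega

theorem exists_cyclicBracketing_equiv (n : ℕ) :
    ∃ e : CyclicBracketing n ≃ {A : Finset (ℕ × ℕ) // IsSimplex (ArcVertex 2 (n + 2))
      ArcCompatible A}, ∀ A B, B ≤ A ↔ (e A).1 ⊆ (e B).1 := by
  refine exists_simplex_equiv (V := fun b : Fin (n + 1) × Fin (n + 1) => b.1 ≠ b.2)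
    (C := fun b c => IsSubarc b c ∨ IsSubarc c b ∨ Disjoint (arc b) (arc c))
    (V' := ArcVertex 2 (n + 2)) (C' := ArcCompatible)
    -- The letter `0` is the root and `i ≥ 1` is the leaf labelled `i + 1`; the second entry is one
    -- more than the last label. An arc that starts at the root has first entry `n + 2`, after all
    -- leaves, and one that ends there has second entry `2`, before all leaves, so arcs through the
    -- root are the pairs whose second entry is at most the first.
    (fun b => (if b.1.1 = 0 then n + 2 else b.1.1 + 1, b.2.1 + 2)) ?_ ?_ ?_ ?_
  · rintro ⟨⟨i, hi⟩, ⟨j, hj⟩⟩ h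
    simp only [ne_eq, Fin.mk.injEq, ArcVertex] at *
    split_ifs <;> omega
  · rintro ⟨⟨i, hi⟩, ⟨j, hj⟩⟩ ⟨⟨k, hk⟩, ⟨l, hl⟩⟩ - - h
    simp only [Prod.mk.injEq, Fin.mk.injEq] at *
    split_ifs at h <;> omega
  · rintro ⟨x, y⟩ h
    simp only [ArcVertex] at h
    refine ⟨(⟨if x = n + 2 then 0 else x - 1, by split_ifs <;> omega⟩, ⟨y - 2, by omega⟩), ?_, ?_⟩
    · simp only [ne_eq, Fin.mk.injEq]
      split_ifs <;> omega
    · simp only [Prod.mk.injEq]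
      split_ifs <;> omega
  · rintro ⟨⟨i, hi⟩, ⟨j, hj⟩⟩ ⟨⟨k, hk⟩, ⟨l, hl⟩⟩ h h'
    simp only [ne_eq, Fin.mk.injEq] at h h'
    simp only [IsSubarc, disjoint_arc, sub_le_sub_iff_cyclic, ArcCompatible, Laminar, Apart]
    split_ifs <;> omega

/-! ### Realizations -/

theorem IsPolytope.nonempty {E : Type*} [NormedAddCommGroup E] [NormedSpace ℝ E] {P : Set E}
    (hP : IsPolytope P) : P.Nonempty := by
  obtain ⟨s, hs, rfl⟩ := hP
  exact (Finset.coe_nonempty.2 hs).mono (subset_convexHull ℝ _)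

theorem finite_pathBracketing (m : ℕ) : Finite (PathBracketing m) :=
  inferInstanceAs (Finite (Subtype _))

theorem finite_cyclicBracketing (n : ℕ) : Finite (CyclicBracketing n) :=
  inferInstanceAs (Finite (Subtype _))

theorem forestNeutrals_leaves (a k : ℕ) : forestNeutrals (leaves a k) = 0 := by
  unfold leaves
  induction List.range k with
  | nil => rfl
  | cons i L ih => simp [forestNeutrals, RTree.neutrals, ih]

theorem degree_G (n : ℕ) : (G n).degree = n := by
  simp [Tr.degree, G, shift, PreTree.neutrals, STree.neutrals, forestNeutrals_leaves]

theorem degree_Gam (n : ℕ) : (Gam n).degree = n := by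
  simp [Tr.degree, Gam, shift, PreTree.neutrals, STree.neutrals, forestNeutrals_leaves]

theorem degree_M (n : ℕ) : (M n).degree = n := by
  simp [Tr.degree, M, shift, PreTree.neutrals, RTree.neutrals, forestNeutrals_leaves]

section

variable {E : Type*} [NormedAddCommGroup E] [NormedSpace ℝ E] [FiniteDimensional ℝ E]
  {I : List Colour} {x : Colour} {T : Tr I x} {R : PreTree → List (ℕ × ℕ) → Prop} {κ : ℕ × ℕ → ℤ}
  {P : Set E} {n : ℕ}

theorem TreeModel.givesCellularChains_of_isStasheffPolytope
    (M : TreeModel T (PathVertex (n + 2)) Laminar R κ) (hT : T.degree = n)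
    (hP : IsStasheffPolytope (n + 2) P) : GivesCellularChains T P := by
  obtain ⟨e, he⟩ := exists_pathBracketing_equiv (n + 2)
  obtain ⟨f⟩ := hP.faces
  have := finite_pathBracketing (n + 2)
  have hdim := hP.finrank_eq
  refine M.givesCellularChains hP.polytope.nonempty (by rw [hT]; omega) (Finite.of_equiv _ e.symm)
    (f.toEquiv.trans e.symm) fun F G => ?_
  rw [he]
  simp

theorem TreeModel.givesCellularChains_of_isCyclohedron
    (M : TreeModel T (ArcVertex 2 (n + 2)) ArcCompatible R κ) (hT : T.degree = n)
    (hP : IsCyclohedron n P) : GivesCellularChains T P := by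
  obtain ⟨e, he⟩ := exists_cyclicBracketing_equiv n
  obtain ⟨f⟩ := hP.faces
  have := finite_cyclicBracketing n
  have hdim := hP.finrank_eq
  refine M.givesCellularChains hP.polytope.nonempty (by rw [hT]; omega) (Finite.of_equiv _ e)
    (f.toEquiv.trans e) fun F G => ?_
  simp [← he]

end

end RelBrace

-- The three isomorphisms

theorem propositionP (n : ℕ) :
    (∀ (E : Type*) [NormedAddCommGroup E] [NormedSpace ℝ E] [FiniteDimensional ℝ E] (K : Set E),
      RelBrace.IsStasheffPolytope (n + 2) K →
        RelBrace.GivesCellularChains (RelBrace.G n) K) ∧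
    (∀ (E : Type*) [NormedAddCommGroup E] [NormedSpace ℝ E] [FiniteDimensional ℝ E] (K : Set E),
      RelBrace.IsStasheffPolytope (n + 2) K →
        RelBrace.GivesCellularChains (RelBrace.Gam n) K) ∧
    (∀ (E : Type*) [NormedAddCommGroup E] [NormedSpace ℝ E] [FiniteDimensional ℝ E] (W : Set E),
      RelBrace.IsCyclohedron n W →
        RelBrace.GivesCellularChains (RelBrace.M n) W) :=
  ⟨fun _ _ _ _ _ hK => (RelBrace.treeModel_G n).givesCellularChains_of_isStasheffPolytope
      (RelBrace.degree_G n) hK,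
    fun _ _ _ _ _ hK => (RelBrace.treeModel_Gam n).givesCellularChains_of_isStasheffPolytope
      (RelBrace.degree_Gam n) hK,
    fun _ _ _ _ _ hW => (RelBrace.treeModel_M n).givesCellularChains_of_isCyclohedron
      (RelBrace.degree_M n) hW⟩
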